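/- Let $m,M,\alpha,\beta,\tau,\sigma>0$ and let $a\in H^1(0,1)$ satisfy $a(x)\ge a_0>0$ for all $x\in[0,1]$. Assume $\alpha<\beta$ and let $K$ satisfy $\alpha\le K\le 2\beta-\alpha$. On the real space $\mathcal H=H^1(0,1)\times L^2(0,1)\times L^2(0,1)\times\mathbb R^2$ put, for $\varpi>0$, $$\langle(y,z,u,\xi,\eta),(\tilde y,\tilde z,\tilde u,\tilde\xi,\tilde\eta)\rangle_{\mathcal H}=\int_0^1(a\,y_x\tilde y_x+z\tilde z)\,dx+K\tau\int_0^1u\tilde u\,dx+m\xi\tilde\xi+M\eta\tilde\eta+\varpi\,L(y,z,u,\xi,\eta)\,L(\tilde y,\tilde z,\tilde u,\tilde\xi,\tilde\eta),$$ $$L(y,z,u,\xi,\eta)=\int_0^1(\sigma y+z)\,dx+m\xi+M\eta+(\beta-\alpha)y(0)+\tau\alpha\int_0^1u\,dx .$$ Let $\mathcal A$ be the linear operator on $\mathcal H$ with $$\mathcal D(\mathcal A)=\{(y,z,u,\xi,\eta)\in\mathcal H:\ y\in H^2(0,1),\ z,u\in H^1(0,1),\ \xi=u(0)=z(0),\ \eta=z(1)\},$$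 $$\mathcal A(y,z,u,\xi,\eta)=\Big(z,\ (ay_x)_x-\sigma z,\ -\tfrac{u_x}{\tau},\ \tfrac1m\big[(ay_x)(0)-\beta\xi+\alpha u(1)\big],\ -\tfrac{(ay_x)(1)}{M}\Big).$$ Then, for every $\varpi>0$: 1. $\langle\cdot,\cdot\rangle_{\mathcal H}$ is an inner product on $\mathcal H$ whose norm is equivalent to the usual norm. 2. $\mathcal A$ is densely defined in $\mathcal H$ and is the infinitesimal generator of a $C_0$-semigroup $(e^{t\mathcal A})_{t\ge0}$ on $\mathcal H$, which is a semigroup of contractions for the norm of $\langle\cdot,\cdot\rangle_{\mathcal H}$. 3. If $\Phi_0\in\mathcal D(\mathcal A)$, then $\Phi(t)=e^{t\mathcal A}\Phi_0$ is the unique strong solution of $\Phi_t=\mathcal A\Phi$, $\Phi(0)=\Phi_0$ in $C([0,\infty);\mathcal D(\mathcal A))\cap C^1([0,\infty);\mathcal H)$, where $\mathcal D(\mathcal A)$ carries the graph norm. 4. For every $\Phi_0\in\mathcal H$, $\Phi(t)=e^{t\mathcal A}\Phi_0$ is the unique mild solution in $C([0,\infty);\mathcal H)$, that is, the unique continuous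 $\Phi$ with $\int_0^t\Phi(s)\,ds\in\mathcal D(\mathcal A)$ and $\Phi(t)=\Phi_0+\mathcal A\int_0^t\Phi(s)\,ds$ for all $t\ge0$. 5. (The complexification of) $\mathcal A$ has nonempty resolvent set and compact resolvent, and its spectrum consists only of isolated eigenvalues of finite algebraic multiplicity (the rank of the Riesz projection). -/

import Mathlib

open MeasureTheory Set Filter Topology
open scoped ENNReal ContDiff

noncomputable section

namespace Crane

/-! ## Lebesgue and Sobolev spaces on the interval `(0,1)`

The scalar field `𝕜` is `ℝ` or `ℂ`. -/

/-- Lebesgue measure on the open interval `(0,1)`. -/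
abbrev vol01 : Measure ℝ := volume.restrict (Ioo 0 1)

/-- The Hilbert space `L²(0,1)`. -/
abbrev L2 (𝕜 : Type) [RCLike 𝕜] : Type := Lp 𝕜 2 vol01

/-- `w` is the weak derivative of `y` on `(0,1)`. -/
def IsWeakDeriv {𝕜 : Type} [RCLike 𝕜] (y w : ℝ → 𝕜) : Prop :=
  ∀ φ : ℝ → ℝ, ContDiff ℝ ∞ φ → HasCompactSupport φ → tsupport φ ⊆ Ioo 0 1 →
    ∫ x, deriv φ x • y x ∂vol01 = - ∫ x, φ x • w x ∂vol01

theorem L2.integrable {𝕜 : Type} [RCLike 𝕜] (f : L2 𝕜) : Integrable f vol01 :=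
  (Lp.memLp f).integrable (by norm_num)

theorem L2.integrable_smul {𝕜 : Type} [RCLike 𝕜] (f : L2 𝕜) {φ : ℝ → ℝ}
    (hφ : Continuous φ) : Integrable (fun x => φ x • f x) vol01 := by
  have h : IntegrableOn (fun x => φ x • f x) (Icc 0 1) volume := by
    refine IntegrableOn.continuousOn_smul ?_ hφ.continuousOn isCompact_Icc
    rw [integrableOn_Icc_iff_integrableOn_Ioo]
    exact L2.integrable f
  exact h.mono_set Ioo_subset_Icc_self

/-- The Sobolev space `H¹(0,1)`: pairs `(y, y_x)` of a function `y ∈ L²(0,1)` and its weak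
derivative `y_x ∈ L²(0,1)`, with the usual inner product `⟨y, ỹ⟩ + ⟨y_x, ỹ_x⟩` of `L²`. -/
def H1 (𝕜 : Type) [RCLike 𝕜] : Submodule 𝕜 (WithLp 2 (L2 𝕜 × L2 𝕜)) where
  carrier := {p | IsWeakDeriv (p.fst : ℝ → 𝕜) (p.snd : ℝ → 𝕜)}
  zero_mem' := by
    intro φ _ _ _
    have h : ((0 : L2 𝕜) : ℝ → 𝕜) =ᵐ[vol01] 0 := Lp.coeFn_zero _ _ _
    have h1 : ∫ x, deriv φ x • ((0 : L2 𝕜) : ℝ → 𝕜) x ∂vol01 = 0 := by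
      apply integral_eq_zero_of_ae
      filter_upwards [h] with x hx
      rw [hx, Pi.zero_apply, smul_zero]
    have h2 : ∫ x, φ x • ((0 : L2 𝕜) : ℝ → 𝕜) x ∂vol01 = 0 := by
      apply integral_eq_zero_of_ae
      filter_upwards [h] with x hx
      rw [hx, Pi.zero_apply, smul_zero]
    change ∫ x, deriv φ x • ((0 : L2 𝕜) : ℝ → 𝕜) x ∂vol01
      = -∫ x, φ x • ((0 : L2 𝕜) : ℝ → 𝕜) x ∂vol01
    rw [h1, h2, neg_zero]
  add_mem' := by
    intro p q hp hq φ h1 h2 h3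
    have hc := h1.continuous
    have hc' := h1.continuous_deriv (by simp)
    have e1 : ∫ x, deriv φ x • ((p.fst + q.fst : L2 𝕜) : ℝ → 𝕜) x ∂vol01
        = ∫ x, (deriv φ x • (p.fst : ℝ → 𝕜) x + deriv φ x • (q.fst : ℝ → 𝕜) x) ∂vol01 := by
      apply integral_congr_ae
      filter_upwards [Lp.coeFn_add p.fst q.fst] with x hx
      rw [hx, Pi.add_apply, smul_add]
    have e2 : ∫ x, φ x • ((p.snd + q.snd : L2 𝕜) : ℝ → 𝕜) x ∂vol01
        = ∫ x, (φ x • (p.snd : ℝ → 𝕜) x + φ x • (q.snd : ℝ → 𝕜) x) ∂vol01 := by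
      apply integral_congr_ae
      filter_upwards [Lp.coeFn_add p.snd q.snd] with x hx
      rw [hx, Pi.add_apply, smul_add]
    change ∫ x, deriv φ x • ((p.fst + q.fst : L2 𝕜) : ℝ → 𝕜) x ∂vol01
      = -∫ x, φ x • ((p.snd + q.snd : L2 𝕜) : ℝ → 𝕜) x ∂vol01
    rw [e1, e2, integral_add (L2.integrable_smul _ hc') (L2.integrable_smul _ hc'),
      integral_add (L2.integrable_smul _ hc) (L2.integrable_smul _ hc),
      hp φ h1 h2 h3, hq φ h1 h2 h3]
    abel
  smul_mem' := by
    intro c p hp φ h1 h2 h3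
    have e1 : ∫ x, deriv φ x • ((c • p.fst : L2 𝕜) : ℝ → 𝕜) x ∂vol01
        = ∫ x, c • (deriv φ x • (p.fst : ℝ → 𝕜) x) ∂vol01 := by
      apply integral_congr_ae
      filter_upwards [Lp.coeFn_smul c p.fst] with x hx
      rw [hx, Pi.smul_apply, smul_comm]
    have e2 : ∫ x, φ x • ((c • p.snd : L2 𝕜) : ℝ → 𝕜) x ∂vol01
        = ∫ x, c • (φ x • (p.snd : ℝ → 𝕜) x) ∂vol01 := by
      apply integral_congr_ae
      filter_upwards [Lp.coeFn_smul c p.snd] with x hx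
      rw [hx, Pi.smul_apply, smul_comm]
    change ∫ x, deriv φ x • ((c • p.fst : L2 𝕜) : ℝ → 𝕜) x ∂vol01
      = -∫ x, φ x • ((c • p.snd : L2 𝕜) : ℝ → 𝕜) x ∂vol01
    rw [e1, e2, integral_smul, integral_smul, hp φ h1 h2 h3, smul_neg]

/-- The underlying `L²` function of an `H¹` function. -/
def H1.fn {𝕜 : Type} [RCLike 𝕜] : H1 𝕜 →ₗ[𝕜] L2 𝕜 where
  toFun f := f.1.fst
  map_add' _ _ := rfl
  map_smul' _ _ := rfl

/-- The weak derivative of an `H¹` function. -/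
def H1.dx {𝕜 : Type} [RCLike 𝕜] : H1 𝕜 →ₗ[𝕜] L2 𝕜 where
  toFun f := f.1.snd
  map_add' _ _ := rfl
  map_smul' _ _ := rfl

/-- An integrable function on `(0,1)` whose weak derivative vanishes is a constant. -/
theorem ae_const_of_weakDeriv_zero {𝕜 : Type} [RCLike 𝕜] {g : ℝ → 𝕜}
    (hg : Integrable g vol01)
    (h : ∀ φ : ℝ → ℝ, ContDiff ℝ ∞ φ → HasCompactSupport φ → tsupport φ ⊆ Ioo 0 1 →
      ∫ x, deriv φ x • g x ∂vol01 = 0) :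
    ∃ c : 𝕜, g =ᵐ[vol01] fun _ => c := by
  have hint : ∀ {φ : ℝ → ℝ} {k : ℝ → 𝕜}, Continuous φ → Integrable k vol01 →
      Integrable (fun x => φ x • k x) vol01 := by
    intro φ k hφ hk
    have h : IntegrableOn (fun x => φ x • k x) (Icc 0 1) volume := by
      refine IntegrableOn.continuousOn_smul ?_ hφ.continuousOn isCompact_Icc
      rw [integrableOn_Icc_iff_integrableOn_Ioo]
      exact hk
    exact h.mono_set Ioo_subset_Icc_self
  let b : ContDiffBump (1 / 2 : ℝ) := ⟨1 / 8, 1 / 4, by norm_num, by norm_num⟩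
  let ψ : ℝ → ℝ := b.normed volume
  have hψ : ContDiff ℝ ∞ ψ := b.contDiff_normed
  have hψc : HasCompactSupport ψ := b.hasCompactSupport_normed
  have hψt : tsupport ψ ⊆ Ioo 0 1 := by
    rw [b.tsupport_normed_eq, Real.closedBall_eq_Icc]
    intro x hx
    simp only [b, mem_Icc] at hx
    constructor <;> linarith [hx.1, hx.2]
  have hψi : ∫ x, ψ x = 1 := b.integral_normed
  refine ⟨∫ x, ψ x • g x ∂vol01, ?_⟩
  set c : 𝕜 := ∫ x, ψ x • g x ∂vol01 with hc
  have key : ∀ φ : ℝ → ℝ, ContDiff ℝ ∞ φ → HasCompactSupport φ → tsupport φ ⊆ Ioo 0 1 →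
      ∫ x, φ x • (if x ∈ Ioo (0 : ℝ) 1 then g x - c else 0) = 0 := by
    intro φ h1 h2 h3
    set k : ℝ := ∫ x, φ x with hk
    let η : ℝ → ℝ := fun x => φ x - k * ψ x
    have hη : ContDiff ℝ ∞ η := h1.sub (contDiff_const.mul hψ)
    have hK : IsCompact (tsupport φ ∪ tsupport ψ) := h2.union hψc
    obtain ⟨p, q, hp, hq, hpq, hsub⟩ : ∃ p q : ℝ, 0 < p ∧ q < 1 ∧ p ≤ q ∧
        tsupport φ ∪ tsupport ψ ⊆ Icc p q := by
      have hne : (tsupport φ ∪ tsupport ψ).Nonempty := by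
        refine ⟨1 / 2, Or.inr ?_⟩
        rw [b.tsupport_normed_eq]
        exact Metric.mem_closedBall_self b.rOut_pos.le
      obtain ⟨p, hp, hp'⟩ := hK.exists_isLeast hne
      obtain ⟨q, hq, hq'⟩ := hK.exists_isGreatest hne
      have hU : tsupport φ ∪ tsupport ψ ⊆ Ioo 0 1 := union_subset h3 hψt
      exact ⟨p, q, (hU hp).1, (hU hq).2, hp' hq, fun x hx => ⟨hp' hx, hq' hx⟩⟩
    have hη0 : ∀ x, x ∉ Icc p q → η x = 0 := by
      intro x hx
      have a1 : φ x = 0 := image_eq_zero_of_notMem_tsupport fun hh => hx (hsub (Or.inl hh))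
      have a2 : ψ x = 0 := image_eq_zero_of_notMem_tsupport fun hh => hx (hsub (Or.inr hh))
      simp [η, a1, a2]
    have hηi : ∫ x, η x = 0 := by
      simp only [η]
      rw [integral_sub (h1.continuous.integrable_of_hasCompactSupport h2)
        ((hψ.continuous.integrable_of_hasCompactSupport hψc).const_mul k),
        integral_const_mul, hψi, mul_one, sub_self]
    let Φ : ℝ → ℝ := fun x => ∫ t in (0 : ℝ)..x, η t
    have hΦd : ∀ x, HasDerivAt Φ (η x) x := fun x =>
      intervalIntegral.integral_hasDerivAt_right (hη.continuous.intervalIntegrable _ _)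
        (hη.continuous.stronglyMeasurableAtFilter _ _) hη.continuous.continuousAt
    have hΦ' : deriv Φ = η := funext fun x => (hΦd x).deriv
    have hΦs : ContDiff ℝ ∞ Φ := by
      rw [contDiff_infty_iff_deriv]
      exact ⟨fun x => (hΦd x).differentiableAt, by rw [hΦ']; exact hη⟩
    have hΦ0 : ∀ x, x ∉ Icc p q → Φ x = 0 := by
      intro x hx
      rcases lt_or_ge x p with hxp | hxp
      · apply intervalIntegral.integral_zero_ae
        filter_upwards with t ht
        apply hη0
        rintro ⟨h5, -⟩
        have := ht.2
        rcases le_max_iff.mp this with h6 | h6 <;> linarith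
      · have hxq : q < x := by
          by_contra hcon
          exact hx ⟨hxp, not_lt.mp hcon⟩
        change ∫ t in (0 : ℝ)..x, η t = 0
        rw [intervalIntegral.integral_eq_integral_of_support_subset, hηi]
        intro t ht
        have : t ∈ Icc p q := by
          by_contra hcon
          exact ht (hη0 t hcon)
        exact ⟨by linarith [this.1], by linarith [this.2]⟩
    have hΦt : tsupport Φ ⊆ Icc p q := by
      refine closure_minimal ?_ isClosed_Icc
      intro x hx
      by_contra hcon
      exact hx (hΦ0 x hcon)
    have hΦc : HasCompactSupport Φ :=
      isCompact_Icc.of_isClosed_subset (isClosed_tsupport _) hΦt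
    have h0 := h Φ hΦs hΦc (hΦt.trans fun x hx => ⟨by linarith [hx.1], by linarith [hx.2]⟩)
    rw [hΦ'] at h0
    have hφi : ∫ x, φ x ∂vol01 = k := by
      rw [hk]
      exact setIntegral_eq_integral_of_forall_compl_eq_zero fun x hx =>
        image_eq_zero_of_notMem_tsupport fun hh => hx (h3 hh)
    have e0 : ∫ x, η x • g x ∂vol01 = ∫ x, φ x • g x ∂vol01 - k • c := by
      rw [hc, ← integral_smul, ← integral_sub (hint h1.continuous hg)
        (Integrable.fun_smul k (hint hψ.continuous hg))]
      refine integral_congr_ae (ae_of_all _ fun x => ?_)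
      simp only [η, sub_smul, mul_smul]
    have e1 : ∫ x, φ x • (if x ∈ Ioo (0 : ℝ) 1 then g x - c else 0)
        = ∫ x, φ x • (g x - c) ∂vol01 := by
      rw [← integral_indicator measurableSet_Ioo]
      refine integral_congr_ae (ae_of_all _ fun x => ?_)
      by_cases hx : x ∈ Ioo (0 : ℝ) 1
      · simp only [indicator_of_mem hx, if_pos hx]
      · simp only [indicator_of_notMem hx, if_neg hx, smul_zero]
    have e2 : ∫ x, φ x • (g x - c) ∂vol01 = ∫ x, φ x • g x ∂vol01 - k • c := by
      simp only [smul_sub]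
      rw [integral_sub (hint h1.continuous hg)
        (hint h1.continuous (integrable_const c)), integral_smul_const, hφi]
    rw [e1, e2, ← e0, h0]
  have hloc : LocallyIntegrableOn
      (fun x => if x ∈ Ioo (0 : ℝ) 1 then g x - c else 0) (Ioo 0 1) volume := by
    apply IntegrableOn.locallyIntegrableOn
    have : IntegrableOn (fun x => g x - c) (Ioo 0 1) volume :=
      hg.sub (integrable_const c)
    refine this.congr_fun (fun x hx => ?_) measurableSet_Ioo
    simp only [if_pos hx]
  have := isOpen_Ioo.ae_eq_zero_of_integral_contDiff_smul_eq_zero hloc key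
  change ∀ᵐ x ∂vol01, g x = c
  rw [ae_restrict_iff' measurableSet_Ioo]
  filter_upwards [this] with x hx hxI
  have := hx hxI
  rw [if_pos hxI] at this
  exact sub_eq_zero.mp this

/-- A primitive of an integrable function on `[0,1]` is absolutely continuous. -/
theorem absCont_primitive {𝕜 : Type} [RCLike 𝕜] {w : ℝ → 𝕜} (c : 𝕜)
    (hw : IntervalIntegrable w volume 0 1) :
    AbsolutelyContinuousOnInterval (fun x => c + ∫ t in (0 : ℝ)..x, w t) 0 1 := by
  have hconst : ∀ d : 𝕜, AbsolutelyContinuousOnInterval (fun _ : ℝ => d) 0 1 := fun d =>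
    ContDiffOn.absolutelyContinuousOnInterval contDiffOn_const
  have hre : IntervalIntegrable (fun x => RCLike.re (w x)) volume 0 1 := ⟨hw.1.re, hw.2.re⟩
  have him : IntervalIntegrable (fun x => RCLike.im (w x)) volume 0 1 := ⟨hw.1.im, hw.2.im⟩
  have h1 := (hre.absolutelyContinuousOnInterval_intervalIntegral
    (c := 0) (by simp)).smul (hconst (1 : 𝕜))
  have h2 := (him.absolutelyContinuousOnInterval_intervalIntegral
    (c := 0) (by simp)).smul (hconst (RCLike.I : 𝕜))
  have h3 := (hconst c).add (h1.add h2)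
  rw [absolutelyContinuousOnInterval_iff] at h3 ⊢
  have hEq : ∀ x ∈ uIcc (0 : ℝ) 1, c + ∫ t in (0 : ℝ)..x, w t =
      c + ((∫ v in (0 : ℝ)..x, RCLike.re (w v)) • (1 : 𝕜) +
        (∫ v in (0 : ℝ)..x, RCLike.im (w v)) • (RCLike.I : 𝕜)) := by
    intro x hx
    have hwx : IntervalIntegrable w volume 0 x :=
      hw.mono_set (uIcc_subset_uIcc (by simp) hx)
    have er : ∫ v in (0 : ℝ)..x, RCLike.re (w v) = RCLike.re (∫ v in (0 : ℝ)..x, w v) :=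
      (RCLike.reCLM (K := 𝕜)).intervalIntegral_comp_comm hwx
    have ei : ∫ v in (0 : ℝ)..x, RCLike.im (w v) = RCLike.im (∫ v in (0 : ℝ)..x, w v) :=
      (RCLike.imCLM (K := 𝕜)).intervalIntegral_comp_comm hwx
    simp only [er, ei, RCLike.real_smul_eq_coe_mul, mul_one,
      RCLike.re_add_im]
  intro ε hε
  obtain ⟨δ, hδ, H⟩ := h3 ε hε
  refine ⟨δ, hδ, fun E hE hlt => ?_⟩
  have := H E hE hlt
  refine lt_of_eq_of_lt (Finset.sum_congr rfl fun i hi => ?_) this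
  have hm := hE.1 i hi
  exact congrArg₂ dist (hEq _ hm.1) (hEq _ hm.2)

theorem hasDerivAt_primitive {𝕜 : Type} [RCLike 𝕜] {w : ℝ → 𝕜} (c : 𝕜)
    (hw : IntervalIntegrable w volume 0 1) :
    ∀ᵐ x, x ∈ uIcc (0 : ℝ) 1 → HasDerivAt (fun x => c + ∫ t in (0 : ℝ)..x, w t) (w x) x := by
  filter_upwards [hw.ae_hasDerivAt_integral] with x hx hxI
  exact (hx hxI 0 (by simp)).const_add c

/-- Product rule for primitives. -/
theorem primitive_smul {𝕜 : Type} [RCLike 𝕜] {v : ℝ → ℝ} {w : ℝ → 𝕜} (b : ℝ) (c : 𝕜)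
    (hv : IntervalIntegrable v volume 0 1) (hw : IntervalIntegrable w volume 0 1) :
    IntervalIntegrable (fun t => v t • (c + ∫ s in (0 : ℝ)..t, w s)
        + (b + ∫ s in (0 : ℝ)..t, v s) • w t) volume 0 1 ∧
    ∀ x ∈ uIcc (0 : ℝ) 1, (b + ∫ t in (0 : ℝ)..x, v t) • (c + ∫ t in (0 : ℝ)..x, w t)
      = b • c + ∫ t in (0 : ℝ)..x, (v t • (c + ∫ s in (0 : ℝ)..t, w s)
        + (b + ∫ s in (0 : ℝ)..t, v s) • w t) := by
  have aw := absCont_primitive c hw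
  have av := absCont_primitive b hv
  have hint : IntervalIntegrable (fun t => v t • (c + ∫ s in (0 : ℝ)..t, w s)
        + (b + ∫ s in (0 : ℝ)..t, v s) • w t) volume 0 1 :=
    (hv.smul_continuousOn aw.continuousOn).add (hw.continuousOn_smul av.continuousOn)
  refine ⟨hint, ?_⟩
  have aP := absCont_primitive (b • c) hint
  have aS := (av.smul aw).sub aP
  have hd : ∀ᵐ x, x ∈ uIcc (0 : ℝ) 1 → HasDerivAt
      ((fun x => b + ∫ t in (0 : ℝ)..x, v t) • (fun x => c + ∫ t in (0 : ℝ)..x, w t)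
        - fun x => b • c + ∫ t in (0 : ℝ)..x, (v t • (c + ∫ s in (0 : ℝ)..t, w s)
        + (b + ∫ s in (0 : ℝ)..t, v s) • w t)) 0 x := by
    filter_upwards [hasDerivAt_primitive c hw, hasDerivAt_primitive b hv,
      hasDerivAt_primitive (b • c) hint] with x h1 h2 h3 hx
    have := ((h2 hx).smul (h1 hx)).sub (h3 hx)
    convert! this using 1
    abel
  obtain ⟨C, hC⟩ := aS.const_of_ae_hasDerivAt_zero hd
  intro x hx
  have h0 := hC 0 (by simp)
  have hx' := hC x hx
  simp only [Pi.sub_apply, Pi.smul_apply', intervalIntegral.integral_same, add_zero,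
    sub_self] at h0 hx'
  rw [← h0] at hx'
  exact sub_eq_zero.mp hx'

theorem intervalIntegrable_of_vol01 {𝕜 : Type} [RCLike 𝕜] {w : ℝ → 𝕜}
    (hw : Integrable w vol01) : IntervalIntegrable w volume 0 1 := by
  rw [intervalIntegrable_iff_integrableOn_Ioo_of_le zero_le_one]
  exact hw

theorem integral_vol01 {𝕜 : Type} [RCLike 𝕜] (w : ℝ → 𝕜) :
    ∫ x, w x ∂vol01 = ∫ x in (0 : ℝ)..1, w x := by
  rw [intervalIntegral.integral_of_le zero_le_one, integral_Ioc_eq_integral_Ioo]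

/-- A primitive of `w` has the weak derivative `w`. -/
theorem isWeakDeriv_primitive {𝕜 : Type} [RCLike 𝕜] {w : ℝ → 𝕜} (c : 𝕜)
    (hw : Integrable w vol01) :
    IsWeakDeriv (fun x => c + ∫ t in (0 : ℝ)..x, w t) w := by
  intro φ h1 h2 h3
  have hw' := intervalIntegrable_of_vol01 hw
  have hφ' : Continuous (deriv φ) := h1.continuous_deriv (by simp)
  have hv : IntervalIntegrable (deriv φ) volume 0 1 := hφ'.intervalIntegrable _ _
  have hφ0 : φ 0 = 0 := image_eq_zero_of_notMem_tsupport fun h => lt_irrefl _ (h3 h).1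
  have hφ1 : φ 1 = 0 := image_eq_zero_of_notMem_tsupport fun h => lt_irrefl _ (h3 h).2
  have hφ : ∀ x, (0 : ℝ) + ∫ t in (0 : ℝ)..x, deriv φ t = φ x := by
    intro x
    rw [intervalIntegral.integral_deriv_eq_sub
      (fun y _ => (h1.differentiable (by simp)).differentiableAt)
      (hφ'.intervalIntegrable _ _), hφ0, sub_zero, zero_add]
  have key := (primitive_smul 0 c hv hw').2 1 (by simp)
  simp only [hφ, hφ1, zero_smul, zero_add] at key
  have hF := (absCont_primitive c hw').continuousOn
  rw [intervalIntegral.integral_add (hv.smul_continuousOn hF)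
    (hw'.continuousOn_smul h1.continuous.continuousOn)] at key
  rw [integral_vol01, integral_vol01]
  exact eq_neg_of_add_eq_zero_left key.symm

/-- `y` has the weak derivative `w` if and only if it is a.e. a primitive of `w`. -/
theorem isWeakDeriv_iff {𝕜 : Type} [RCLike 𝕜] {y w : ℝ → 𝕜}
    (hy : Integrable y vol01) (hw : Integrable w vol01) :
    IsWeakDeriv y w ↔ ∃ c : 𝕜, y =ᵐ[vol01] fun x => c + ∫ t in (0 : ℝ)..x, w t := by
  have hcont : ∀ c : 𝕜, ContinuousOn (fun x => c + ∫ t in (0 : ℝ)..x, w t) (uIcc 0 1) :=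
    fun c => (absCont_primitive c (intervalIntegrable_of_vol01 hw)).continuousOn
  constructor
  · intro h
    have hF : Integrable (fun x => (0 : 𝕜) + ∫ t in (0 : ℝ)..x, w t) vol01 := by
      have h5 := (hcont 0).integrableOn_compact (μ := volume) isCompact_uIcc
      rw [uIcc_of_le zero_le_one] at h5
      exact h5.mono_set Ioo_subset_Icc_self
    have hsm : ∀ {φ : ℝ → ℝ} {k : ℝ → 𝕜}, Continuous φ → Integrable k vol01 →
        Integrable (fun x => φ x • k x) vol01 := by
      intro φ k hφ hk
      have h : IntegrableOn (fun x => φ x • k x) (Icc 0 1) volume := by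
        refine IntegrableOn.continuousOn_smul ?_ hφ.continuousOn isCompact_Icc
        rw [integrableOn_Icc_iff_integrableOn_Ioo]
        exact hk
      exact h.mono_set Ioo_subset_Icc_self
    obtain ⟨c, hc⟩ := ae_const_of_weakDeriv_zero (hy.sub hF) (by
      intro φ h1 h2 h3
      have hφ' : Continuous (deriv φ) := h1.continuous_deriv (by simp)
      have e1 := h φ h1 h2 h3
      have e2 := isWeakDeriv_primitive 0 hw φ h1 h2 h3
      simp only [Pi.sub_apply, smul_sub]
      rw [integral_sub (hsm hφ' hy) (hsm hφ' hF), e1, e2, sub_self])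
    refine ⟨c, ?_⟩
    filter_upwards [hc] with x hx
    simp only [Pi.sub_apply, zero_add] at hx
    rw [← hx]
    abel
  · rintro ⟨c, hc⟩ φ h1 h2 h3
    rw [← isWeakDeriv_primitive c hw φ h1 h2 h3]
    apply integral_congr_ae
    filter_upwards [hc] with x hx
    rw [hx]

theorem H1.exists_primitive {𝕜 : Type} [RCLike 𝕜] (f : H1 𝕜) :
    ∃ c : 𝕜, (H1.fn f : ℝ → 𝕜) =ᵐ[vol01] fun x => c + ∫ t in (0 : ℝ)..x, H1.dx f t :=
  (isWeakDeriv_iff (L2.integrable _) (L2.integrable _)).1 f.2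

/-- Every `H¹(0,1)` function has exactly one continuous representative on `[0,1]`. -/
theorem H1.existsUnique_rep {𝕜 : Type} [RCLike 𝕜] (f : H1 𝕜) :
    ∃! g : C(unitInterval, 𝕜),
      IccExtend (zero_le_one' ℝ) g =ᵐ[vol01] (H1.fn f : ℝ → 𝕜) := by
  obtain ⟨c, hc⟩ := H1.exists_primitive f
  have hcont := (absCont_primitive c
    (intervalIntegrable_of_vol01 (L2.integrable (H1.dx f)))).continuousOn
  rw [uIcc_of_le zero_le_one] at hcont
  refine ⟨⟨_, continuousOn_iff_continuous_domRestrict.1 hcont⟩, ?_, ?_⟩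
  · filter_upwards [hc, ae_restrict_mem measurableSet_Ioo] with x hx hxI
    rw [hx, IccExtend_of_mem _ _ (Ioo_subset_Icc_self hxI)]
    rfl
  · intro g hg
    have h1 : IccExtend (zero_le_one' ℝ) g =ᵐ[volume.restrict (Icc (0 : ℝ) 1)]
        fun x => c + ∫ t in (0 : ℝ)..x, H1.dx f t := by
      rw [← restrict_Ioo_eq_restrict_Icc]
      exact hg.trans hc
    have h2 := Measure.eqOn_Icc_of_ae_eq volume zero_ne_one h1
      g.continuous.Icc_extend'.continuousOn hcont
    ext x
    have h3 := h2 x.2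
    rw [IccExtend_val] at h3
    exact h3

/-- The continuous representative on `[0,1]` of an `H¹` function. It gives a meaning to point
values such as `y(0)` and `y(1)`. -/
def H1.rep {𝕜 : Type} [RCLike 𝕜] (f : H1 𝕜) : C(unitInterval, 𝕜) :=
  (H1.existsUnique_rep f).choose

theorem H1.rep_ae {𝕜 : Type} [RCLike 𝕜] (f : H1 𝕜) :
    IccExtend (zero_le_one' ℝ) (H1.rep f) =ᵐ[vol01] (H1.fn f : ℝ → 𝕜) :=
  (H1.existsUnique_rep f).choose_spec.1

theorem H1.rep_unique {𝕜 : Type} [RCLike 𝕜] (f : H1 𝕜) (g : C(unitInterval, 𝕜))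
    (hg : IccExtend (zero_le_one' ℝ) g =ᵐ[vol01] (H1.fn f : ℝ → 𝕜)) : H1.rep f = g :=
  ((H1.existsUnique_rep f).choose_spec.2 g hg).symm

theorem H1.rep_add {𝕜 : Type} [RCLike 𝕜] (f g : H1 𝕜) :
    H1.rep (f + g) = H1.rep f + H1.rep g := by
  apply H1.rep_unique
  rw [map_add]
  filter_upwards [H1.rep_ae f, H1.rep_ae g, Lp.coeFn_add (H1.fn f) (H1.fn g)] with x h1 h2 h3
  rw [h3, Pi.add_apply, ← h1, ← h2]
  rfl

theorem H1.rep_smul {𝕜 : Type} [RCLike 𝕜] (c : 𝕜) (f : H1 𝕜) :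
    H1.rep (c • f) = c • H1.rep f := by
  apply H1.rep_unique
  rw [map_smul]
  filter_upwards [H1.rep_ae f, Lp.coeFn_smul c (H1.fn f)] with x h1 h3
  rw [h3, Pi.smul_apply, ← h1]
  rfl

/-- The weak derivative is unique, so an `H¹` function is determined by its values. -/
theorem H1.fn_injective {𝕜 : Type} [RCLike 𝕜] :
    Function.Injective (H1.fn : H1 𝕜 →ₗ[𝕜] L2 𝕜) := by
  intro f g hfg
  have hd : H1.dx f = H1.dx g := by
    apply Lp.ext
    have hloc : LocallyIntegrableOn
        (fun x => (H1.dx f : ℝ → 𝕜) x - (H1.dx g : ℝ → 𝕜) x) (Ioo 0 1) volume := by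
      apply IntegrableOn.locallyIntegrableOn
      exact (L2.integrable (H1.dx f)).sub (L2.integrable (H1.dx g))
    change ∀ᵐ x ∂vol01, (H1.dx f : ℝ → 𝕜) x = (H1.dx g : ℝ → 𝕜) x
    rw [ae_restrict_iff' measurableSet_Ioo]
    have key := isOpen_Ioo.ae_eq_zero_of_integral_contDiff_smul_eq_zero hloc (by
      intro φ h1 h2 h3
      have e : ∫ x, φ x • ((H1.dx f : ℝ → 𝕜) x - (H1.dx g : ℝ → 𝕜) x)
          = ∫ x, φ x • ((H1.dx f : ℝ → 𝕜) x - (H1.dx g : ℝ → 𝕜) x) ∂vol01 := by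
        symm
        apply setIntegral_eq_integral_of_forall_compl_eq_zero
        intro x hx
        rw [image_eq_zero_of_notMem_tsupport fun hh => hx (h3 hh), zero_smul]
      rw [e]
      simp only [smul_sub]
      rw [integral_sub (L2.integrable_smul _ h1.continuous)
        (L2.integrable_smul _ h1.continuous)]
      have hf := f.2 φ h1 h2 h3
      have hg := g.2 φ h1 h2 h3
      change ∫ x, deriv φ x • (H1.fn f : ℝ → 𝕜) x ∂vol01
        = -∫ x, φ x • (H1.dx f : ℝ → 𝕜) x ∂vol01 at hf
      change ∫ x, deriv φ x • (H1.fn g : ℝ → 𝕜) x ∂vol01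
        = -∫ x, φ x • (H1.dx g : ℝ → 𝕜) x ∂vol01 at hg
      rw [hfg, hg] at hf
      rw [neg_injective hf, sub_self])
    filter_upwards [key] with x hx hxI
    exact sub_eq_zero.mp (hx hxI)
  apply Subtype.ext
  apply (WithLp.equiv 2 (L2 𝕜 × L2 𝕜)).injective
  exact Prod.ext hfg hd

/-- `H¹(0,1)` viewed as a subspace of `L²(0,1)`. -/
abbrev H1InL2 (𝕜 : Type) [RCLike 𝕜] : Submodule 𝕜 (L2 𝕜) :=
  LinearMap.range (H1.fn : H1 𝕜 →ₗ[𝕜] L2 𝕜)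

/-- An `L²` function that lies in `H¹(0,1)`, as an element of the space `H¹(0,1)`. -/
def H1.lift {𝕜 : Type} [RCLike 𝕜] : H1InL2 𝕜 →ₗ[𝕜] H1 𝕜 :=
  (LinearEquiv.ofInjective H1.fn H1.fn_injective).symm.toLinearMap

theorem H1.fn_lift {𝕜 : Type} [RCLike 𝕜] (f : H1InL2 𝕜) : H1.fn (H1.lift f) = f :=
  congrArg Subtype.val ((LinearEquiv.ofInjective H1.fn H1.fn_injective).apply_symm_apply f)

/-- The product of two `H¹(0,1)` functions is in `H¹(0,1)`. -/
theorem H1.existsUnique_mul {𝕜 : Type} [RCLike 𝕜] (a : H1 ℝ) (f : H1 𝕜) :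
    ∃! q : H1 𝕜, (H1.fn q : ℝ → 𝕜) =ᵐ[vol01] fun x => H1.fn a x • H1.fn f x := by
  obtain ⟨b, hb⟩ := H1.exists_primitive a
  obtain ⟨c, hc⟩ := H1.exists_primitive f
  have hv := intervalIntegrable_of_vol01 (L2.integrable (H1.dx a))
  have hw := intervalIntegrable_of_vol01 (L2.integrable (H1.dx f))
  have hF := (absCont_primitive b hv).continuousOn
  have hG := (absCont_primitive c hw).continuousOn
  rw [uIcc_of_le zero_le_one] at hF hG
  have memF : MemLp (fun x => b + ∫ t in (0 : ℝ)..x, H1.dx a t) ∞ vol01 := by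
    obtain ⟨C, hC⟩ := isCompact_Icc.exists_bound_of_continuousOn hF
    refine memLp_top_of_bound ((hF.mono Ioo_subset_Icc_self).aestronglyMeasurable
      measurableSet_Ioo) C ?_
    filter_upwards [ae_restrict_mem measurableSet_Ioo] with x hx
    exact hC x (Ioo_subset_Icc_self hx)
  have memG : MemLp (fun x => c + ∫ t in (0 : ℝ)..x, H1.dx f t) ∞ vol01 := by
    obtain ⟨C, hC⟩ := isCompact_Icc.exists_bound_of_continuousOn hG
    refine memLp_top_of_bound ((hG.mono Ioo_subset_Icc_self).aestronglyMeasurable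
      measurableSet_Ioo) C ?_
    filter_upwards [ae_restrict_mem measurableSet_Ioo] with x hx
    exact hC x (Ioo_subset_Icc_self hx)
  have mem1 : MemLp (fun x => H1.fn a x • H1.fn f x) 2 vol01 := by
    have h1 : MemLp (fun x => (b + ∫ t in (0 : ℝ)..x, H1.dx a t) • H1.fn f x) 2 vol01 :=
      (Lp.memLp (H1.fn f)).smul memF
    refine (memLp_congr_ae ?_).1 h1
    filter_upwards [hb] with x hx
    rw [hx]
  have mem2 : MemLp (fun t => H1.dx a t • (c + ∫ s in (0 : ℝ)..t, H1.dx f s)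
      + (b + ∫ s in (0 : ℝ)..t, H1.dx a s) • H1.dx f t) 2 vol01 :=
    (memG.smul (Lp.memLp (H1.dx a))).add ((Lp.memLp (H1.dx f)).smul memF)
  have hwd : IsWeakDeriv (mem1.toLp _ : ℝ → 𝕜) (mem2.toLp _ : ℝ → 𝕜) := by
    rw [isWeakDeriv_iff (L2.integrable _) (L2.integrable _)]
    refine ⟨b • c, ?_⟩
    filter_upwards [mem1.coeFn_toLp, hb, hc, ae_restrict_mem measurableSet_Ioo]
      with x h1 h2 h3 hx
    have hx' : x ∈ uIcc (0 : ℝ) 1 := by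
      rw [uIcc_of_le zero_le_one]
      exact Ioo_subset_Icc_self hx
    rw [h1, h2, h3, (primitive_smul b c hv hw).2 x hx']
    congr 1
    apply intervalIntegral.integral_congr_ae
    have h4 := (ae_restrict_iff' measurableSet_Ioo).1 mem2.coeFn_toLp
    filter_upwards [h4] with t ht htx
    rw [uIoc_of_le hx.1.le] at htx
    exact (ht ⟨htx.1, htx.2.trans_lt hx.2⟩).symm
  refine ⟨⟨WithLp.toLp 2 (mem1.toLp _, mem2.toLp _), hwd⟩, mem1.coeFn_toLp, ?_⟩
  intro q hq
  apply H1.fn_injective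
  exact Lp.ext (hq.trans mem1.coeFn_toLp.symm)

/-- The product `a f` of a real `H¹` function and an `H¹` function, as an `H¹` function. -/
def H1.mul {𝕜 : Type} [RCLike 𝕜] (a : H1 ℝ) (f : H1 𝕜) : H1 𝕜 :=
  (H1.existsUnique_mul a f).choose

theorem H1.mul_ae {𝕜 : Type} [RCLike 𝕜] (a : H1 ℝ) (f : H1 𝕜) :
    (H1.fn (H1.mul a f) : ℝ → 𝕜) =ᵐ[vol01] fun x => H1.fn a x • H1.fn f x :=
  (H1.existsUnique_mul a f).choose_spec.1

theorem H1.mul_unique {𝕜 : Type} [RCLike 𝕜] (a : H1 ℝ) (f q : H1 𝕜)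
    (hq : (H1.fn q : ℝ → 𝕜) =ᵐ[vol01] fun x => H1.fn a x • H1.fn f x) : H1.mul a f = q :=
  ((H1.existsUnique_mul a f).choose_spec.2 q hq).symm

theorem H1.mul_add {𝕜 : Type} [RCLike 𝕜] (a : H1 ℝ) (f g : H1 𝕜) :
    H1.mul a (f + g) = H1.mul a f + H1.mul a g := by
  apply H1.mul_unique
  rw [map_add, map_add]
  filter_upwards [H1.mul_ae a f, H1.mul_ae a g, Lp.coeFn_add (H1.fn f) (H1.fn g),
    Lp.coeFn_add (H1.fn (H1.mul a f)) (H1.fn (H1.mul a g))] with x h1 h2 h3 h4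
  rw [h4, Pi.add_apply, h1, h2, h3, Pi.add_apply, smul_add]

theorem H1.mul_smul {𝕜 : Type} [RCLike 𝕜] (a : H1 ℝ) (c : 𝕜) (f : H1 𝕜) :
    H1.mul a (c • f) = c • H1.mul a f := by
  apply H1.mul_unique
  rw [map_smul, map_smul]
  filter_upwards [H1.mul_ae a f, Lp.coeFn_smul c (H1.fn f),
    Lp.coeFn_smul c (H1.fn (H1.mul a f))] with x h1 h3 h4
  rw [h4, Pi.smul_apply, h1, h3, Pi.smul_apply, smul_comm]

/-- `H¹(0,1)` is a Hilbert space. -/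
instance H1.instCompleteSpace {𝕜 : Type} [RCLike 𝕜] : CompleteSpace (H1 𝕜) := by
  have hcl : IsClosed (H1 𝕜 : Set (WithLp 2 (L2 𝕜 × L2 𝕜))) := by
    have hfun : ∀ {φ : ℝ → ℝ}, Continuous φ → HasCompactSupport φ →
        Continuous fun f : L2 𝕜 => ∫ x, φ x • f x ∂vol01 := by
      intro φ h1 h2
      have hm : MemLp (fun x => (φ x : 𝕜)) 2 vol01 :=
        ((RCLike.continuous_ofReal.comp h1).memLp_of_hasCompactSupport
          (h2.comp_left (g := fun r : ℝ => (r : 𝕜)) (by simp))).restrict _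
      have e : ∀ f : L2 𝕜, inner 𝕜 (hm.toLp _) f = ∫ x, φ x • f x ∂vol01 := by
        intro f
        rw [L2.inner_def]
        apply integral_congr_ae
        filter_upwards [hm.coeFn_toLp] with x hx
        rw [hx, RCLike.inner_apply, RCLike.conj_ofReal, RCLike.real_smul_eq_coe_mul, mul_comm]
      simp only [← e]
      exact continuous_const.inner continuous_id
    have hEq : (H1 𝕜 : Set (WithLp 2 (L2 𝕜 × L2 𝕜))) =
        ⋂ (φ : ℝ → ℝ) (_ : ContDiff ℝ ∞ φ) (_ : HasCompactSupport φ)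
          (_ : tsupport φ ⊆ Ioo 0 1), {p | ∫ x, deriv φ x • (p.fst : ℝ → 𝕜) x ∂vol01
            = - ∫ x, φ x • (p.snd : ℝ → 𝕜) x ∂vol01} := by
      ext p
      simp only [mem_iInter]
      rfl
    rw [hEq]
    refine isClosed_iInter fun φ => isClosed_iInter fun h1 => isClosed_iInter fun h2 =>
      isClosed_iInter fun _ => isClosed_eq ?_ ?_
    · exact (hfun (h1.continuous_deriv (by simp)) h2.deriv).comp
        (WithLp.continuous_fst 2 _ _)
    · exact ((hfun h1.continuous h2).comp (WithLp.continuous_snd 2 _ _)).neg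
  exact hcl.completeSpace_coe

/-! ## The crane system -/

/-- The data of the system: masses `m` (platform) and `M` (load), feedback gains `α`, `β`,
delay `τ`, interior damping `σ`, and the modulus of tension `a ∈ H¹(0,1)`. -/
structure Params where
  m : ℝ
  M : ℝ
  α : ℝ
  β : ℝ
  τ : ℝ
  σ : ℝ
  a : H1 ℝ

/-- The state space `H¹(0,1) × L²(0,1) × L²(0,1) × 𝕜²` of states `(y, z, u, ξ, η)`. -/
abbrev State (𝕜 : Type) [RCLike 𝕜] : Type := H1 𝕜 × L2 𝕜 × L2 𝕜 × 𝕜 × 𝕜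

namespace State

/-- Displacement. -/
abbrev y {𝕜 : Type} [RCLike 𝕜] (Φ : State 𝕜) : H1 𝕜 := Φ.1
/-- Velocity. -/
abbrev z {𝕜 : Type} [RCLike 𝕜] (Φ : State 𝕜) : L2 𝕜 := Φ.2.1
/-- Delay variable. -/
abbrev u {𝕜 : Type} [RCLike 𝕜] (Φ : State 𝕜) : L2 𝕜 := Φ.2.2.1
/-- Velocity of the platform. -/
abbrev ξ {𝕜 : Type} [RCLike 𝕜] (Φ : State 𝕜) : 𝕜 := Φ.2.2.2.1
/-- Velocity of the load. -/
abbrev η {𝕜 : Type} [RCLike 𝕜] (Φ : State 𝕜) : 𝕜 := Φ.2.2.2.2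

/-- The square of the usual Hilbert norm of the state space. -/
def usualNormSq {𝕜 : Type} [RCLike 𝕜] (Φ : State 𝕜) : ℝ :=
  ‖Φ.y‖ ^ 2 + ‖Φ.z‖ ^ 2 + ‖Φ.u‖ ^ 2 + ‖Φ.ξ‖ ^ 2 + ‖Φ.η‖ ^ 2

end State

/-- The functional
`∫₀¹ (σ y + z) dx + m ξ + M η + (β - α) y(0) + τ α ∫₀¹ u dx`. -/
def invariantFunctional (P : Params) (Φ : State ℝ) : ℝ :=
  (∫ x, (P.σ * H1.fn Φ.y x + Φ.z x) ∂vol01) + P.m * Φ.ξ + P.M * Φ.η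
    + (P.β - P.α) * H1.rep Φ.y 0 + P.τ * P.α * ∫ x, Φ.u x ∂vol01

/-- The inner product on the real state space with the parameters `K` and `ϖ`. -/
def energyInner (P : Params) (K ϖ : ℝ) (Φ Ψ : State ℝ) : ℝ :=
  (∫ x, (H1.fn P.a x * H1.dx Φ.y x * H1.dx Ψ.y x + Φ.z x * Ψ.z x) ∂vol01)
    + K * P.τ * (∫ x, Φ.u x * Ψ.u x ∂vol01) + P.m * Φ.ξ * Ψ.ξ + P.M * Φ.η * Ψ.η
    + ϖ * invariantFunctional P Φ * invariantFunctional P Ψ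

/-- The norm induced by `energyInner`. -/
def energyNorm (P : Params) (K ϖ : ℝ) (Φ : State ℝ) : ℝ := √(energyInner P K ϖ Φ Φ)

/-- The domain of the operator: `y ∈ H²(0,1)` (that is, `y_x ∈ H¹(0,1)`), `z, u ∈ H¹(0,1)`,
`ξ = u(0) = z(0)` and `η = z(1)`. -/
def domain (𝕜 : Type) [RCLike 𝕜] : Submodule 𝕜 (State 𝕜) where
  carrier := {Φ | H1.dx Φ.y ∈ H1InL2 𝕜 ∧
    ∃ (hz : Φ.z ∈ H1InL2 𝕜) (hu : Φ.u ∈ H1InL2 𝕜),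
      Φ.ξ = H1.rep (H1.lift ⟨Φ.u, hu⟩) 0 ∧ Φ.ξ = H1.rep (H1.lift ⟨Φ.z, hz⟩) 0 ∧
        Φ.η = H1.rep (H1.lift ⟨Φ.z, hz⟩) 1}
  zero_mem' := by
    have h : H1.rep (H1.lift (0 : H1InL2 𝕜)) = 0 := by
      have := H1.rep_smul (0 : 𝕜) (0 : H1 𝕜)
      rw [zero_smul, zero_smul] at this
      rw [map_zero, this]
    refine ⟨?_, Submodule.zero_mem _, Submodule.zero_mem _, ?_, ?_, ?_⟩
    · change H1.dx (0 : H1 𝕜) ∈ _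
      rw [map_zero]
      exact Submodule.zero_mem _
    · exact (congrArg (fun g : C(unitInterval, 𝕜) => g 0) h).symm
    · exact (congrArg (fun g : C(unitInterval, 𝕜) => g 0) h).symm
    · exact (congrArg (fun g : C(unitInterval, 𝕜) => g 1) h).symm
  add_mem' := by
    rintro Φ Ψ ⟨h1, hz, hu, h2, h3, h4⟩ ⟨k1, kz, ku, k2, k3, k4⟩
    have h : ∀ f g : H1InL2 𝕜,
        H1.rep (H1.lift (f + g)) = H1.rep (H1.lift f) + H1.rep (H1.lift g) := fun f g => by
      rw [map_add, H1.rep_add]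
    refine ⟨?_, Submodule.add_mem _ hz kz, Submodule.add_mem _ hu ku, ?_, ?_, ?_⟩
    · change H1.dx (Φ.y + Ψ.y) ∈ _
      rw [map_add]
      exact Submodule.add_mem _ h1 k1
    · have := congrArg (fun g : C(unitInterval, 𝕜) => g 0) (h ⟨Φ.u, hu⟩ ⟨Ψ.u, ku⟩)
      exact (congrArg₂ (· + ·) h2 k2).trans this.symm
    · have := congrArg (fun g : C(unitInterval, 𝕜) => g 0) (h ⟨Φ.z, hz⟩ ⟨Ψ.z, kz⟩)
      exact (congrArg₂ (· + ·) h3 k3).trans this.symm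
    · have := congrArg (fun g : C(unitInterval, 𝕜) => g 1) (h ⟨Φ.z, hz⟩ ⟨Ψ.z, kz⟩)
      exact (congrArg₂ (· + ·) h4 k4).trans this.symm
  smul_mem' := by
    rintro c Φ ⟨h1, hz, hu, h2, h3, h4⟩
    have h : ∀ f : H1InL2 𝕜, H1.rep (H1.lift (c • f)) = c • H1.rep (H1.lift f) := fun f => by
      rw [map_smul, H1.rep_smul]
    refine ⟨?_, Submodule.smul_mem _ c hz, Submodule.smul_mem _ c hu, ?_, ?_, ?_⟩
    · change H1.dx (c • Φ.y) ∈ _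
      rw [map_smul]
      exact Submodule.smul_mem _ c h1
    · have := congrArg (fun g : C(unitInterval, 𝕜) => g 0) (h ⟨Φ.u, hu⟩)
      exact (congrArg (c • ·) h2).trans this.symm
    · have := congrArg (fun g : C(unitInterval, 𝕜) => g 0) (h ⟨Φ.z, hz⟩)
      exact (congrArg (c • ·) h3).trans this.symm
    · have := congrArg (fun g : C(unitInterval, 𝕜) => g 1) (h ⟨Φ.z, hz⟩)
      exact (congrArg (c • ·) h4).trans this.symm

/-- `y_x` as an `H¹` function, for a state in the domain. -/
def domYx {𝕜 : Type} [RCLike 𝕜] (Φ : domain 𝕜) : H1 𝕜 := H1.lift ⟨H1.dx Φ.1.y, Φ.2.1⟩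

/-- `z` as an `H¹` function, for a state in the domain. -/
def domZ {𝕜 : Type} [RCLike 𝕜] (Φ : domain 𝕜) : H1 𝕜 := H1.lift ⟨Φ.1.z, Φ.2.2.1⟩

/-- `u` as an `H¹` function, for a state in the domain. -/
def domU {𝕜 : Type} [RCLike 𝕜] (Φ : domain 𝕜) : H1 𝕜 := H1.lift ⟨Φ.1.u, Φ.2.2.2.1⟩

/-- The tension `a y_x` as an `H¹` function, for a state in the domain. -/
def tension {𝕜 : Type} [RCLike 𝕜] (P : Params) (Φ : domain 𝕜) : H1 𝕜 := H1.mul P.a (domYx Φ)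

/-- The operator of the crane system,
`A (y, z, u, ξ, η) = (z, (a y_x)_x - σ z, -u_x / τ, ((a y_x)(0) - β ξ + α u(1)) / m,
-(a y_x)(1) / M)`. For `𝕜 = ℝ` it is the operator of the system; for `𝕜 = ℂ` it is its
complexification, which carries the spectral theory. -/
def craneOperator (𝕜 : Type) [RCLike 𝕜] (P : Params) : State 𝕜 →ₗ.[𝕜] State 𝕜 where
  domain := domain 𝕜
  toFun :=
    { toFun := fun Φ =>
        (domZ Φ,
          H1.dx (tension P Φ) - (P.σ : 𝕜) • Φ.1.z,
          -((P.τ : 𝕜)⁻¹ • H1.dx (domU Φ)),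
          (P.m : 𝕜)⁻¹ * (H1.rep (tension P Φ) 0 - (P.β : 𝕜) * Φ.1.ξ
            + (P.α : 𝕜) * H1.rep (domU Φ) 1),
          -((P.M : 𝕜)⁻¹ * H1.rep (tension P Φ) 1))
      map_add' := by
        intro Φ Ψ
        have hz : domZ (Φ + Ψ) = domZ Φ + domZ Ψ :=
          H1.lift.map_add ⟨Φ.1.z, Φ.2.2.1⟩ ⟨Ψ.1.z, Ψ.2.2.1⟩
        have hu : domU (Φ + Ψ) = domU Φ + domU Ψ :=
          H1.lift.map_add ⟨Φ.1.u, Φ.2.2.2.1⟩ ⟨Ψ.1.u, Ψ.2.2.2.1⟩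
        have hy : domYx (Φ + Ψ) = domYx Φ + domYx Ψ :=
          H1.lift.map_add ⟨H1.dx Φ.1.y, Φ.2.1⟩ ⟨H1.dx Ψ.1.y, Ψ.2.1⟩
        have ht : tension P (Φ + Ψ) = tension P Φ + tension P Ψ := by
          rw [tension, hy, H1.mul_add]
          rfl
        rw [hz, hu, ht, H1.rep_add, H1.rep_add, map_add, map_add]
        refine Prod.ext rfl (Prod.ext ?_ (Prod.ext ?_ (Prod.ext ?_ ?_)))
        · change _ - (P.σ : 𝕜) • (Φ.1.z + Ψ.1.z) = (_ - _) + (_ - _)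
          rw [smul_add]
          abel
        · change -((P.τ : 𝕜)⁻¹ • _) = -((P.τ : 𝕜)⁻¹ • _) + -((P.τ : 𝕜)⁻¹ • _)
          rw [smul_add]
          abel
        · change (P.m : 𝕜)⁻¹ * (H1.rep (tension P Φ) 0 + H1.rep (tension P Ψ) 0
              - (P.β : 𝕜) * (Φ.1.ξ + Ψ.1.ξ)
              + (P.α : 𝕜) * (H1.rep (domU Φ) 1 + H1.rep (domU Ψ) 1))
            = (P.m : 𝕜)⁻¹ * (_ - _ + _) + (P.m : 𝕜)⁻¹ * (_ - _ + _)
          ring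
        · change -((P.M : 𝕜)⁻¹ * (H1.rep (tension P Φ) 1 + H1.rep (tension P Ψ) 1))
            = -((P.M : 𝕜)⁻¹ * _) + -((P.M : 𝕜)⁻¹ * _)
          ring
      map_smul' := by
        intro c Φ
        have hz : domZ (c • Φ) = c • domZ Φ := H1.lift.map_smul c ⟨Φ.1.z, Φ.2.2.1⟩
        have hu : domU (c • Φ) = c • domU Φ := H1.lift.map_smul c ⟨Φ.1.u, Φ.2.2.2.1⟩
        have hy : domYx (c • Φ) = c • domYx Φ := H1.lift.map_smul c ⟨H1.dx Φ.1.y, Φ.2.1⟩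
        have ht : tension P (c • Φ) = c • tension P Φ := by
          rw [tension, hy, H1.mul_smul]
          rfl
        rw [hz, hu, ht, H1.rep_smul, H1.rep_smul, map_smul, map_smul, RingHom.id_apply]
        refine Prod.ext rfl (Prod.ext ?_ (Prod.ext ?_ (Prod.ext ?_ ?_)))
        · change _ - (P.σ : 𝕜) • (c • Φ.1.z) = c • (_ - (P.σ : 𝕜) • Φ.1.z)
          rw [smul_sub, smul_comm c]
        · change -((P.τ : 𝕜)⁻¹ • c • _) = c • -((P.τ : 𝕜)⁻¹ • _)
          rw [smul_neg, smul_comm c]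
        · change (P.m : 𝕜)⁻¹ * (c * H1.rep (tension P Φ) 0 - (P.β : 𝕜) * (c * Φ.1.ξ)
              + (P.α : 𝕜) * (c * H1.rep (domU Φ) 1)) = c * ((P.m : 𝕜)⁻¹ * (_ - _ + _))
          ring
        · change -((P.M : 𝕜)⁻¹ * (c * H1.rep (tension P Φ) 1)) = c * -((P.M : 𝕜)⁻¹ * _)
          ring }

/-! ## Semigroups and their generators -/

/-- `(S t)`, `t ≥ 0`, is a `C₀`-semigroup. The values at negative times play no role. -/
structure IsC0Semigroup {X : Type} [NormedAddCommGroup X] [NormedSpace ℝ X]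
    (S : ℝ → X →L[ℝ] X) : Prop where
  zero : S 0 = ContinuousLinearMap.id ℝ X
  add : ∀ s t : ℝ, 0 ≤ s → 0 ≤ t → S (s + t) = (S s).comp (S t)
  continuous : ∀ x : X, Tendsto (fun t => S t x) (𝓝[>] 0) (𝓝 x)

/-- `A` is the infinitesimal generator of `S`: `x` is in the domain of `A` and `A x = v`
exactly if `(S t x - x) / t → v` as `t ↓ 0`. -/
def IsGenerator {X : Type} [NormedAddCommGroup X] [NormedSpace ℝ X]
    (A : X →ₗ.[ℝ] X) (S : ℝ → X →L[ℝ] X) : Prop :=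
  ∀ x v : X, (x, v) ∈ A.graph ↔ Tendsto (fun t : ℝ => t⁻¹ • (S t x - x)) (𝓝[>] 0) (𝓝 v)

/-- `Φ` is a strong solution of `Φ' = A Φ`, `Φ(0) = Φ₀`, in the class
`C([0,∞); D(A)) ∩ C¹([0,∞); X)`, where `D(A)` carries the graph norm. -/
def IsStrongSolution {X : Type} [NormedAddCommGroup X] [NormedSpace ℝ X]
    (A : X →ₗ.[ℝ] X) (Φ₀ : X) (Φ : ℝ → X) : Prop :=
  Φ 0 = Φ₀ ∧ ∃ AΦ : ℝ → X, (∀ t, 0 ≤ t → (Φ t, AΦ t) ∈ A.graph) ∧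
    ContinuousOn Φ (Ici 0) ∧ ContinuousOn AΦ (Ici 0) ∧
    ∀ t, 0 ≤ t → HasDerivWithinAt Φ (AΦ t) (Ici 0) t

/-- `Φ` is a mild solution of `Φ' = A Φ`, `Φ(0) = Φ₀`: it is continuous on `[0,∞)` and
`∫₀ᵗ Φ ∈ D(A)`, `Φ(t) = Φ₀ + A ∫₀ᵗ Φ` for every `t ≥ 0`. -/
def IsMildSolution {X : Type} [NormedAddCommGroup X] [NormedSpace ℝ X]
    (A : X →ₗ.[ℝ] X) (Φ₀ : X) (Φ : ℝ → X) : Prop :=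
  ContinuousOn Φ (Ici 0) ∧
    ∀ t : ℝ, 0 ≤ t → ∃ h : (∫ s in (0 : ℝ)..t, Φ s) ∈ A.domain,
      Φ t = Φ₀ + A ⟨∫ s in (0 : ℝ)..t, Φ s, h⟩

/-! ## Spectral theory of unbounded operators -/

/-- `R` is a bounded inverse of `ζ - A : D(A) → X`. -/
def IsResolventAt {X : Type} [NormedAddCommGroup X] [NormedSpace ℂ X]
    (A : X →ₗ.[ℂ] X) (ζ : ℂ) (R : X →L[ℂ] X) : Prop :=
  (∀ v : X, ∃ h : R v ∈ A.domain, ζ • R v - A ⟨R v, h⟩ = v) ∧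
    ∀ x : A.domain, R (ζ • (x : X) - A x) = x

/-- The resolvent set of `A`. -/
def resolventSet {X : Type} [NormedAddCommGroup X] [NormedSpace ℂ X]
    (A : X →ₗ.[ℂ] X) : Set ℂ := {ζ | ∃ R, IsResolventAt A ζ R}

/-- The spectrum of `A`. -/
def spectrum {X : Type} [NormedAddCommGroup X] [NormedSpace ℂ X]
    (A : X →ₗ.[ℂ] X) : Set ℂ := (resolventSet A)ᶜ

open Classical in
/-- The resolvent `(ζ - A)⁻¹` (used only for `ζ` in the resolvent set). -/
def resolvent {X : Type} [NormedAddCommGroup X] [NormedSpace ℂ X]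
    (A : X →ₗ.[ℂ] X) (ζ : ℂ) : X →L[ℂ] X :=
  if h : ∃ R, IsResolventAt A ζ R then h.choose else 0

/-- `lam` is an eigenvalue of `A`. -/
def IsEigenvalue {X : Type} [NormedAddCommGroup X] [NormedSpace ℂ X]
    (A : X →ₗ.[ℂ] X) (lam : ℂ) : Prop :=
  ∃ x : A.domain, (x : X) ≠ 0 ∧ A x = lam • (x : X)

/-- The closed disc of radius `r > 0` around `lam` meets the spectrum of `A` in `lam` only. -/
def IsolatesAt {X : Type} [NormedAddCommGroup X] [NormedSpace ℂ X]
    (A : X →ₗ.[ℂ] X) (lam : ℂ) (r : ℝ) : Prop :=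
  0 < r ∧ Metric.closedBall lam r ∩ spectrum A = {lam}

/-- The Riesz projection `(2πi)⁻¹ ∮ (ζ - A)⁻¹ dζ` over the circle of radius `r` around `lam`. -/
def rieszProjection {X : Type} [NormedAddCommGroup X] [NormedSpace ℂ X]
    (A : X →ₗ.[ℂ] X) (lam : ℂ) (r : ℝ) : X →L[ℂ] X :=
  (2 * Real.pi * Complex.I : ℂ)⁻¹ • ∮ ζ in C(lam, r), resolvent A ζ

/-- `lam` is an isolated point of the spectrum, it is an eigenvalue, and its algebraic
multiplicity, that is, the rank of its Riesz projection, is finite. -/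
def IsIsolatedEigenvalueOfFiniteMultiplicity {X : Type} [NormedAddCommGroup X]
    [NormedSpace ℂ X] (A : X →ₗ.[ℂ] X) (lam : ℂ) : Prop :=
  IsEigenvalue A lam ∧ (∃ r, IsolatesAt A lam r) ∧
    ∀ r, IsolatesAt A lam r →
      FiniteDimensional ℂ (LinearMap.range (rieszProjection A lam r).toLinearMap)

end Crane

end

/-!
The operator is maximal dissipative for the given inner product. That inner product is the energy
form `craneForm` plus the rank-one term `ϖ L(Φ) L(Ψ)`. The rank-one term does not interfere with
dissipativity, because integration of the equations shows `L ∘ A = 0` (`invariantL_craneMap`), and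
it makes the form definite: the energy form alone does not see constant displacements, while `y(0)`
enters `L` with the total coefficient `σ + β - α > 0` (`exists_norm_le_energyNorm`). For the energy
form itself, integration by parts turns `Re ⟨A Φ, Φ⟩` into `-σ ‖z‖²` plus a quadratic form in
`(ξ, u(1))` which is nonpositive for `α ≤ K ≤ 2β - α` (`re_craneForm_craneMap_le`). The range
condition, `l - A` is onto for `l > 0`, is a boundary value problem: the transport equation for `u`
is solved explicitly, and eliminating all other unknowns leaves a coercive weak equation for
`y ∈ H¹(0,1)`, to which the Lax–Milgram lemma applies (`exists_smul_sub_craneMap_eq`).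

The semigroup then comes from the Hille–Yosida theorem in a Hilbert space, proved here with Yosida
approximations (`IsMaxDissipative.exists_semigroup`). Density of the domain is automatic, strong and
mild solutions are orbits of the semigroup, and they are unique by dissipativity. The theorem is
applied in the state space with the equivalent energy norm and carried back to the original norm
(`exists_contraction_semigroup`).

The spectral part rests on the compactness of one resolvent. Over `ℂ` the same dissipativity estimate
and the same boundary value problem show that `1` is in the resolvent set of the operator. The
equations express the velocity, the delay variable and the tension of `(1 - A)⁻¹ v` as `H¹`
functions that depend continuously on `v`, so that the resolvent factors through the embedding of
`H¹(0,1)` in `L²(0,1)`, which is compact by the Arzelà–Ascoli theorem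
(`isCompactOperator_resolvent_one`). For an arbitrary operator with compact resolvent
`T = (ζ₀ - A)⁻¹` and a spectral point `λ`, Riesz theory for `1 - (ζ₀ - λ) T` gives a finite-rank
projection `Q` commuting with `T`. The point is an eigenvalue by the Fredholm alternative, it is
isolated since `1 - (ζ₀ - λ) T` is nilpotent on the range of `Q` and left invertible on its kernel,
and `(1 - Q) (ζ - A)⁻¹` extends holomorphically to `λ`, so that the Riesz projection has its range in
the range of `Q` (`isIsolatedEigenvalue_of_compact_resolvent`).
-/

noncomputable section

namespace Crane

/-! ### Riesz theory of compact operators -/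

section RieszTheory

variable {X : Type*} [NormedAddCommGroup X] [NormedSpace ℂ X]

/-- The kernels of the powers of `1 - K` do not grow forever: otherwise Riesz's lemma gives a bounded
sequence whose image under `K` has no convergent subsequence. -/
theorem exists_ker_pow_eq_ker_pow_succ {K : X →L[ℂ] X} (hK : IsCompactOperator K) :
    ∃ n : ℕ, LinearMap.ker ((1 - K) ^ (n + 1)).toLinearMap
      ≤ LinearMap.ker ((1 - K) ^ n).toLinearMap := by
  by_contra! hcon
  set L : X →L[ℂ] X := 1 - K with hL
  let V : ℕ → Submodule ℂ X := fun n => LinearMap.ker (L ^ n).toLinearMap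
  have memV : ∀ n x, x ∈ V n ↔ (L ^ n) x = 0 := fun n x => Iff.rfl
  have hmono : ∀ {m n : ℕ}, m ≤ n → V m ≤ V n := by
    intro m n hmn x hx
    obtain ⟨d, rfl⟩ := Nat.exists_eq_add_of_le' hmn
    rw [memV] at hx ⊢
    rw [pow_add, mul_apply_eq_comp, hx, map_zero]
  have hLV : ∀ {n : ℕ} {x : X}, x ∈ V (n + 1) → L x ∈ V n := by
    intro n x hx
    rw [memV] at hx ⊢
    rwa [← mul_apply_eq_comp, ← pow_succ]
  have hx : ∀ n, ∃ x ∈ V (n + 1), ‖x‖ ≤ 3 ∧ ∀ y ∈ V n, 1 ≤ ‖x - y‖ := by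
    intro n
    have h1 : IsClosed ((V n).comap (V (n + 1)).subtype : Set (V (n + 1))) := by
      have h2 : IsClosed (V n : Set X) := (L ^ n).isClosed_ker
      exact h2.preimage continuous_subtype_val
    obtain ⟨x, hx, hx'⟩ := SetLike.not_le_iff_exists.1 (hcon n)
    obtain ⟨x₀, h3, h4⟩ := riesz_lemma_of_norm_lt (c := (2 : ℂ)) (R := 3) (by norm_num)
      (by norm_num) h1 ⟨⟨x, hx⟩, hx'⟩
    exact ⟨x₀, x₀.2, h3, fun y hy => h4 ⟨y, hmono (Nat.le_succ n) hy⟩ hy⟩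
  choose f hfV hfn hfd using hx
  -- the images `K (f n)` are at mutual distance at least `1`
  have key : ∀ m n, m < n → 1 ≤ ‖K (f n) - K (f m)‖ := by
    intro m n hmn
    have e : K (f n) - K (f m) = f n - (L (f n) + f m - L (f m)) := by
      simp only [hL, sub_apply, one_apply_eq_self]
      abel
    rw [e]
    refine hfd n _ (Submodule.sub_mem _ (Submodule.add_mem _ (hLV (hfV n)) ?_) ?_)
    · exact hmono hmn (hfV m)
    · exact hmono hmn.le (hLV (hfV m))
  obtain ⟨C, hC, hC'⟩ := hK.image_closedBall_subset_compact 3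
  obtain ⟨y, -, ψ, hψ, hψy⟩ := hC.tendsto_subseq
    (fun n => hC' ⟨f n, by simpa using hfn n, rfl⟩)
  obtain ⟨N, hN⟩ := Metric.cauchySeq_iff'.1 hψy.cauchySeq 1 one_pos
  have h1 := hN (N + 1) (Nat.le_succ N)
  rw [dist_eq_norm] at h1
  exact absurd h1 (not_lt.2 (key _ _ (hψ (Nat.lt_succ_self N))))

theorem ker_pow_stable {L : X →L[ℂ] X} {n : ℕ}
    (h : LinearMap.ker (L ^ (n + 1)).toLinearMap ≤ LinearMap.ker (L ^ n).toLinearMap) (k : ℕ)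
    {x : X} (hx : (L ^ (n + k)) x = 0) : (L ^ n) x = 0 := by
  induction k generalizing x with
  | zero => exact hx
  | succ k ih =>
    have h1 : (L ^ n) (L x) = 0 := by
      apply ih
      rwa [← mul_apply_eq_comp, ← pow_succ]
    apply h
    change (L ^ (n + 1)) x = 0
    rwa [pow_succ, mul_apply_eq_comp]

theorem exists_one_sub_pow_eq_one_sub {K : X →L[ℂ] X} (hK : IsCompactOperator K) (n : ℕ) :
    ∃ K' : X →L[ℂ] X, IsCompactOperator K' ∧ (1 - K) ^ n = 1 - K' := by
  induction n with
  | zero => exact ⟨0, isCompactOperator_zero, by simp⟩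
  | succ n ih =>
    obtain ⟨K', h1, h2⟩ := ih
    refine ⟨K' + (K - K' * K), h1.add (hK.sub (h1.comp_clm K)), ?_⟩
    rw [pow_succ, h2]
    noncomm_ring

variable [CompleteSpace X]

/-- The Fredholm alternative. -/
theorem isUnit_one_sub_of_compact {K : X →L[ℂ] X} (hK : IsCompactOperator K)
    (h : ∀ x, K x = x → x = 0) : IsUnit (1 - K) := by
  rcases hK.hasEigenvalue_or_mem_resolventSet (one_ne_zero (α := ℂ)) with h1 | h1
  · obtain ⟨x, hx⟩ := h1.exists_hasEigenvector
    exact absurd (h x (by simpa using hx.apply_eq_smul)) hx.2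
  · simpa [_root_.spectrum.mem_resolventSet_iff] using h1

/-- Riesz decomposition for `1 - K`, `K` compact: `Q` is a finite-rank projection which commutes
with everything that commutes with `K`, `1 - K` is nilpotent on its range, and `B` inverts `1 - K`
on its kernel. -/
theorem exists_riesz_decomposition {K : X →L[ℂ] X} (hK : IsCompactOperator K) :
    ∃ (n : ℕ) (Q B : X →L[ℂ] X), FiniteDimensional ℂ (LinearMap.range Q.toLinearMap) ∧
      Q * Q = Q ∧ (∀ T, Commute T K → Commute T Q) ∧ (1 - K) ^ n * Q = 0 ∧
      B * (1 - K) = 1 - Q ∧ B * Q = 0 := by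
  obtain ⟨m, hm⟩ := exists_ker_pow_eq_ker_pow_succ hK
  set L : X →L[ℂ] X := 1 - K with hL
  -- a positive exponent at which the kernels are stable
  obtain ⟨n, hn⟩ : ∃ n, n = m + 1 := ⟨_, rfl⟩
  have hst : ∀ x, (L ^ n) ((L ^ n) x) = 0 → (L ^ n) x = 0 := by
    intro x hx
    rw [← mul_apply_eq_comp, ← pow_add] at hx
    have h1 : (L ^ m) x = 0 := ker_pow_stable hm (n + n - m) (by
      rwa [Nat.add_sub_cancel' (by omega)])
    rw [hn, pow_succ', mul_apply_eq_comp, h1, map_zero]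
  obtain ⟨K', hK', hLK'⟩ := exists_one_sub_pow_eq_one_sub hK n
  rw [← hL] at hLK'
  let N : Submodule ℂ X := LinearMap.ker (L ^ n).toLinearMap
  have memN : ∀ x, x ∈ N ↔ (L ^ n) x = 0 := fun x => Iff.rfl
  have hNc : IsClosed (N : Set X) := (L ^ n).isClosed_ker
  have hK'N : ∀ x ∈ N, K' x = x := by
    intro x hx
    rw [memN, hLK', sub_apply, one_apply_eq_self] at hx
    exact (sub_eq_zero.1 hx).symm
  have hfin : FiniteDimensional ℂ N := by
    apply FiniteDimensional.of_isCompactOperator_id (𝕜 := ℂ)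
    have h1 := IsCompactOperator.restrict (f := K'.toLinearMap) hK'
      (V := N) (fun v hv => by
        change K' v ∈ N
        rwa [hK'N v hv]) hNc
    convert! h1 using 1
    ext x
    exact (hK'N x x.2).symm
  obtain ⟨p, hp⟩ := Submodule.ClosedComplemented.of_finiteDimensional (𝕜 := ℂ) N
  let Q₀ : X →L[ℂ] X := N.subtypeL.comp p
  have hQ₀ : ∀ x ∈ N, Q₀ x = x := fun x hx => congrArg Subtype.val (hp ⟨x, hx⟩)
  have hQ₀N : ∀ x, Q₀ x ∈ N := fun x => (p x).2
  have hcomp : ∀ p : X →L[ℂ] N, IsCompactOperator (N.subtypeL.comp p) := fun p =>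
    (isCompactOperator_of_locallyCompactSpace_dom p).clm_comp
      N.subtypeL
  -- adding a projection onto the kernel makes `L ^ n` invertible
  have hunit : ∀ q : X →L[ℂ] N, (∀ x ∈ N, N.subtypeL.comp q x = x) →
      IsUnit (L ^ n + N.subtypeL.comp q) := by
    intro q hq
    have e : L ^ n + N.subtypeL.comp q = 1 - (K' - N.subtypeL.comp q) := by
      rw [hLK']
      abel
    rw [e]
    refine isUnit_one_sub_of_compact (hK'.sub (hcomp q)) fun x hx => ?_
    have h1 : (L ^ n) x = -(N.subtypeL.comp q x) := by
      rw [hLK']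
      simp only [sub_apply, one_apply_eq_self] at hx ⊢
      nth_rewrite 1 [← hx]
      abel
    have h2 : (L ^ n) x = 0 := by
      apply hst
      rw [h1]
      exact (memN _).1 (N.neg_mem (q x).2)
    rw [h2, zero_eq_neg] at h1
    rw [← hq x h2, h1]
  obtain ⟨U, hU⟩ := hunit p hQ₀
  set W : X →L[ℂ] X := ((U⁻¹ : (X →L[ℂ] X)ˣ) : X →L[ℂ] X) with hW
  have hUW : ∀ x, (L ^ n) (W x) + Q₀ (W x) = x := by
    intro x
    have : (U : X →L[ℂ] X) * W = 1 := U.mul_inv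
    rw [hU] at this
    exact congrArg (fun f : X →L[ℂ] X => f x) this
  have hWU : ∀ x, W ((L ^ n) x + Q₀ x) = x := by
    intro x
    have : W * (U : X →L[ℂ] X) = 1 := U.inv_mul
    rw [hU] at this
    exact congrArg (fun f : X →L[ℂ] X => f x) this
  -- `Q` is the projection onto the kernel of `L ^ n` along its range
  let Q : X →L[ℂ] X := N.subtypeL.comp (p.comp W)
  have hQN : ∀ x, Q x ∈ N := fun x => (p (W x)).2
  have hQid : ∀ x ∈ N, Q x = x := by
    intro x hx
    have h1 : W x = x := by
      have := hWU x
      rwa [(memN x).1 hx, hQ₀ x hx, zero_add] at this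
    change Q₀ (W x) = x
    rw [h1, hQ₀ x hx]
  have hQL : ∀ x, Q ((L ^ n) x) = 0 := by
    intro x
    have h1 : Q ((L ^ n) x) = (L ^ n) (x - W ((L ^ n) x)) := by
      rw [map_sub, eq_sub_iff_add_eq']
      exact hUW _
    rw [h1]
    apply hst
    rw [← h1]
    exact (memN _).1 (hQN _)
  have hQQ : Q * Q = Q := by
    ext x
    exact hQid _ (hQN x)
  have hQc : ∀ T, Commute T K → Commute T Q := by
    intro T hT
    have hTL : ∀ x, T ((L ^ n) x) = (L ^ n) (T x) := fun x =>
      congrArg (fun f : X →L[ℂ] X => f x) (((Commute.one_right T).sub_right hT).pow_right n).eq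
    have h1 : ∀ x ∈ N, T x ∈ N := by
      intro x hx
      rw [memN, ← hTL, (memN x).1 hx, map_zero]
    ext x
    change T (Q x) = Q (T x)
    have h2 : x = (L ^ n) (W x) + Q x := (hUW x).symm
    nth_rewrite 2 [h2]
    rw [map_add, map_add, hTL, hQL, zero_add, hQid _ (h1 _ (hQN x))]
  obtain ⟨U', hU'⟩ := hunit (p.comp W) hQid
  change (U' : X →L[ℂ] X) = L ^ n + Q at hU'
  set W' : X →L[ℂ] X := ((U'⁻¹ : (X →L[ℂ] X)ˣ) : X →L[ℂ] X) with hW'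
  have hW'U : W' * (L ^ n + Q) = 1 := by
    rw [← hU']
    exact U'.inv_mul
  have hQLn : (L ^ n) * Q = 0 := by
    ext x
    exact (memN _).1 (hQN x)
  have hLc : Commute L Q := hQc L ((Commute.one_left K).sub_left (Commute.refl K))
  have hW'Q : W' * Q = Q := by
    have h1 : (L ^ n + Q) * Q = Q := by rw [add_mul, hQLn, hQQ, zero_add]
    calc W' * Q = W' * ((L ^ n + Q) * Q) := by rw [h1]
      _ = Q := by rw [← mul_assoc, hW'U, one_mul]
  refine ⟨n, Q, (1 - Q) * W' * L ^ m, ?_, hQQ, hQc, hQLn, ?_, ?_⟩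
  · have hle : LinearMap.range Q.toLinearMap ≤ N := by
      rintro _ ⟨x, rfl⟩
      exact hQN x
    exact Submodule.finiteDimensional_of_le hle
  · have h1 : W' * L ^ n = 1 - Q := by
      rw [← hW'U, mul_add, hW'Q, add_sub_cancel_right]
    rw [mul_assoc, ← pow_succ, ← hn, mul_assoc, h1]
    simp only [mul_sub, sub_mul, mul_one, one_mul, hQQ, sub_self, sub_zero]
  · rw [mul_assoc, (hLc.pow_left m).eq, ← mul_assoc, mul_assoc (1 - Q), hW'Q, sub_mul, one_mul,
      hQQ, sub_self, zero_mul]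

end RieszTheory

/-! ### Operators with compact resolvent -/

section CompactResolvent

variable {X : Type} [NormedAddCommGroup X] [NormedSpace ℂ X] {A : X →ₗ.[ℂ] X}

theorem IsResolventAt.unique {ζ : ℂ} {R R' : X →L[ℂ] X} (h : IsResolventAt A ζ R)
    (h' : IsResolventAt A ζ R') : R = R' := by
  ext v
  obtain ⟨hv, e⟩ := h.1 v
  have := h'.2 ⟨R v, hv⟩
  change R' (ζ • R v - A ⟨R v, hv⟩) = R v at this
  rw [← this, e]

theorem isResolventAt_resolvent {ζ : ℂ} (h : ζ ∈ resolventSet A) :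
    IsResolventAt A ζ (resolvent A ζ) := by
  have h' : ∃ R, IsResolventAt A ζ R := h
  rw [resolvent, dif_pos h']
  exact h'.choose_spec

/-- The resolvent identity. -/
theorem IsResolventAt.resolvent_identity {ζ₀ ζ : ℂ} {T R : X →L[ℂ] X}
    (hT : IsResolventAt A ζ₀ T) (hR : IsResolventAt A ζ R) (v : X) :
    R v - T v = (ζ₀ - ζ) • T (R v) := by
  obtain ⟨hv, e⟩ := hR.1 v
  have h1 := hT.2 ⟨R v, hv⟩
  change T (ζ₀ • R v - A ⟨R v, hv⟩) = R v at h1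
  have h2 : R v - T v = T (ζ₀ • R v - A ⟨R v, hv⟩ - (ζ • R v - A ⟨R v, hv⟩)) := by
    rw [map_sub, h1, e]
  rw [h2, ← map_smul T]
  congr 1
  module

/-- If `1 - (ζ₀ - ζ) (ζ₀ - A)⁻¹` has the inverse `V`, then `(ζ₀ - A)⁻¹ V` is the resolvent
at `ζ`. -/
theorem IsResolventAt.mul_inverse {ζ₀ ζ : ℂ} {T V : X →L[ℂ] X}
    (hT : IsResolventAt A ζ₀ T) (h1 : (1 - (ζ₀ - ζ) • T) * V = 1)
    (h2 : V * (1 - (ζ₀ - ζ) • T) = 1) : IsResolventAt A ζ (T * V) := by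
  have hc : T * V = V * T := by
    have h3 : Commute T (1 - (ζ₀ - ζ) • T) :=
      (Commute.one_right T).sub_right ((Commute.refl T).smul_right _)
    calc T * V = V * (1 - (ζ₀ - ζ) • T) * (T * V) := by rw [h2, one_mul]
      _ = V * (((1 - (ζ₀ - ζ) • T) * T) * V) := by simp only [mul_assoc]
      _ = V * T * ((1 - (ζ₀ - ζ) • T) * V) := by rw [← h3.eq]; simp only [mul_assoc]
      _ = V * T := by rw [h1, mul_one]
  constructor
  · intro v
    obtain ⟨hv, e⟩ := hT.1 (V v)
    refine ⟨hv, ?_⟩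
    change ζ • T (V v) - A ⟨T (V v), hv⟩ = v
    have h3 : V v - (ζ₀ - ζ) • T (V v) = v := congrArg (fun f : X →L[ℂ] X => f v) h1
    calc ζ • T (V v) - A ⟨T (V v), hv⟩
        = ζ₀ • T (V v) - A ⟨T (V v), hv⟩ - (ζ₀ - ζ) • T (V v) := by module
      _ = v := by rw [e, h3]
  · intro x
    rw [hc]
    change V (T (ζ • (x : X) - A x)) = x
    have h3 : V ((x : X) - (ζ₀ - ζ) • T (x : X)) = x :=
      congrArg (fun f : X →L[ℂ] X => f x) h2
    have h4 : T (ζ • (x : X) - A x) = x - (ζ₀ - ζ) • T (x : X) := by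
      calc T (ζ • (x : X) - A x) = T (ζ₀ • (x : X) - A x - (ζ₀ - ζ) • (x : X)) := by
            congr 1
            module
        _ = x - (ζ₀ - ζ) • T (x : X) := by rw [map_sub, hT.2 x, map_smul]
    rw [h4, h3]

/-- By the resolvent identity all resolvents are compact if one is. -/
theorem IsResolventAt.isCompactOperator {ζ₀ ζ : ℂ} {T R : X →L[ℂ] X}
    (hT : IsResolventAt A ζ₀ T) (hR : IsResolventAt A ζ R) (hc : IsCompactOperator T) :
    IsCompactOperator R := by
  have e : R = T + (ζ₀ - ζ) • T * R := by
    ext v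
    change R v = T v + (ζ₀ - ζ) • T (R v)
    rw [← hT.resolvent_identity hR v]
    abel
  rw [e]
  exact hc.add ((hc.smul (ζ₀ - ζ)).comp_clm R)

variable [CompleteSpace X]

/-- A spectral point is an eigenvalue if some resolvent is compact: this is the Fredholm
alternative for `1 - (ζ₀ - lam) (ζ₀ - A)⁻¹`. -/
theorem isEigenvalue_of_mem_spectrum {ζ₀ lam : ℂ} {T : X →L[ℂ] X} (hT : IsResolventAt A ζ₀ T)
    (hc : IsCompactOperator T) (h : lam ∈ spectrum A) : IsEigenvalue A lam := by
  by_contra hcon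
  apply h
  have hu : IsUnit (1 - (ζ₀ - lam) • T) := by
    refine isUnit_one_sub_of_compact (hc.smul (ζ₀ - lam)) fun x hx => ?_
    by_contra hx0
    change (ζ₀ - lam) • T x = x at hx
    obtain ⟨hv, e⟩ := hT.1 ((ζ₀ - lam) • x)
    have hTx : T ((ζ₀ - lam) • x) = x := by rw [map_smul, hx]
    refine hcon ⟨⟨T ((ζ₀ - lam) • x), hv⟩, ?_, ?_⟩
    · change T ((ζ₀ - lam) • x) ≠ 0
      rwa [hTx]
    · change _ = lam • T ((ζ₀ - lam) • x)
      have h1 : (ζ₀ - lam) • T ((ζ₀ - lam) • x) = (ζ₀ - lam) • x := by rw [hTx]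
      calc A ⟨T ((ζ₀ - lam) • x), hv⟩
          = lam • T ((ζ₀ - lam) • x) + (ζ₀ - lam) • T ((ζ₀ - lam) • x)
            - (ζ₀ • T ((ζ₀ - lam) • x) - A ⟨T ((ζ₀ - lam) • x), hv⟩) := by module
        _ = lam • T ((ζ₀ - lam) • x) := by rw [e, h1, add_sub_cancel_right]
  obtain ⟨U, hU⟩ := hu
  refine ⟨T * ((U⁻¹ : (X →L[ℂ] X)ˣ) : X →L[ℂ] X), hT.mul_inverse ?_ ?_⟩
  · rw [← hU]
    exact U.mul_inv
  · rw [← hU]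
    exact U.inv_mul

/-- Near `ζ₀` the resolvent is `T (1 - (ζ₀ - ζ) T)⁻¹` with `T = (ζ₀ - A)⁻¹`. -/
theorem differentiableAt_resolvent {ζ₀ : ℂ} (h : ζ₀ ∈ resolventSet A) :
    DifferentiableAt ℂ (resolvent A) ζ₀ := by
  have hT := isResolventAt_resolvent h
  set T := resolvent A ζ₀ with hTdef
  have hd : DifferentiableAt ℂ (fun ζ : ℂ => 1 - (ζ₀ - ζ) • T) ζ₀ := by fun_prop
  have hu : IsUnit (1 - (ζ₀ - ζ₀) • T) := by simp
  have hd' : DifferentiableAt ℂ (fun ζ : ℂ => T * Ring.inverse (1 - (ζ₀ - ζ) • T)) ζ₀ :=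
    (differentiableAt_const T).mul (hd.inverse hu)
  refine hd'.congr_of_eventuallyEq ?_
  filter_upwards [hd.continuousAt.eventually_mem (Units.isOpen.mem_nhds hu)] with ζ hζ
  have hζ' : IsUnit (1 - (ζ₀ - ζ) • T) := hζ
  have hR := hT.mul_inverse (Ring.mul_inverse_cancel _ hζ') (Ring.inverse_mul_cancel _ hζ')
  exact (isResolventAt_resolvent ⟨_, hR⟩).unique hR

/-- Every spectral point of an operator with a compact resolvent is an isolated eigenvalue of
finite algebraic multiplicity. -/
theorem isIsolatedEigenvalue_of_compact_resolvent {ζ₀ lam : ℂ} {T : X →L[ℂ] X}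
    (hT : IsResolventAt A ζ₀ T) (hc : IsCompactOperator T) (h : lam ∈ spectrum A) :
    IsIsolatedEigenvalueOfFiniteMultiplicity A lam := by
  set κ := ζ₀ - lam with hκ
  have hκ0 : κ ≠ 0 := by
    intro h0
    rw [hκ, sub_eq_zero] at h0
    exact h (h0 ▸ ⟨T, hT⟩)
  obtain ⟨n, Q, B, hfin, hQQ, hcomm, hnil, hBL, hBQ⟩ :=
    exists_riesz_decomposition (K := κ • T) (hc.smul κ)
  have hTQ : Commute T Q := hcomm T ((Commute.refl T).smul_right κ)
  refine ⟨isEigenvalue_of_mem_spectrum hT hc h, ?_, ?_⟩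
  · -- an eigenvector for `ζ` near `lam` has no component in the kernel of `Q`, and on the range
    -- of `Q` the operator `1 - κ T` is nilpotent
    set b : ℝ := ‖B * T‖ + 1 with hb
    have hb0 : 0 < b := by positivity
    refine ⟨(2 * b)⁻¹, by positivity, ?_⟩
    refine Subset.antisymm ?_ (singleton_subset_iff.2 ⟨?_, h⟩)
    swap
    · exact Metric.mem_closedBall_self (by positivity)
    rintro ζ ⟨hζ, hζs⟩
    by_contra hne
    rw [mem_singleton_iff, ← sub_eq_zero] at hne
    obtain ⟨⟨x, hxD⟩, hx0, hxe⟩ := isEigenvalue_of_mem_spectrum hT hc hζs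
    change x ≠ 0 at hx0
    change A ⟨x, hxD⟩ = ζ • x at hxe
    have hTx : (ζ₀ - ζ) • T x = x := by
      have h1 := hT.2 ⟨x, hxD⟩
      rwa [hxe, ← sub_smul, map_smul] at h1
    set δ := ζ - lam with hδ
    have hδκ : ζ₀ - ζ = κ - δ := by rw [hκ, hδ]; ring
    have hδκ0 : κ - δ ≠ 0 := by
      intro h0
      rw [hδκ, h0, zero_smul] at hTx
      exact hx0 hTx.symm
    rw [hδκ] at hTx
    have hLx : ∀ w : X, (κ - δ) • T w = w → (1 - κ • T) w = -(δ • T w) := by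
      intro w hw
      change w - κ • T w = _
      nth_rewrite 1 [← hw]
      module
    have hv : x - Q x = 0 := by
      set v := x - Q x with hv
      have hTv : (κ - δ) • T v = v := by
        rw [hv, map_sub, smul_sub, hTx]
        congr 1
        have : T (Q x) = Q (T x) := congrArg (fun f : X →L[ℂ] X => f x) hTQ.eq
        rw [this, ← map_smul, hTx]
      have h1 : B ((1 - κ • T) v) = v - Q v :=
        congrArg (fun f : X →L[ℂ] X => f v) hBL
      have h2 : Q v = 0 := by
        have : Q (Q x) = Q x := congrArg (fun f : X →L[ℂ] X => f x) hQQ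
        rw [hv, map_sub, this, sub_self]
      rw [hLx v hTv, h2, sub_zero, map_neg, map_smul] at h1
      by_contra hv0
      have h3 : ‖v‖ ≤ (2 * b)⁻¹ * (b * ‖v‖) := by
        calc ‖v‖ = ‖δ‖ * ‖(B * T) v‖ := by
              nth_rewrite 1 [← h1]
              rw [norm_neg, norm_smul]
              rfl
          _ ≤ (2 * b)⁻¹ * (b * ‖v‖) := by
              refine mul_le_mul ?_ ?_ (norm_nonneg _) (by positivity)
              · rwa [mem_closedBall_iff_norm] at hζ
              · exact ((B * T).le_opNorm v).trans
                  (mul_le_mul_of_nonneg_right (by rw [hb]; linarith) (norm_nonneg _))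
      have h4 : (2 * b)⁻¹ * (b * ‖v‖) = ‖v‖ / 2 := by field_simp
      have h5 : 0 < ‖v‖ := norm_pos_iff.2 hv0
      linarith
    have hpow : ∀ k : ℕ, ((1 - κ • T) ^ k) x = (-(δ / (κ - δ))) ^ k • x := by
      intro k
      induction k with
      | zero => simp
      | succ k ih =>
        have h1 : (1 - κ • T) x = (-(δ / (κ - δ))) • x := by
          rw [hLx x hTx]
          nth_rewrite 2 [← hTx]
          rw [smul_smul, neg_mul, div_mul_cancel₀ _ hδκ0, neg_smul]
        rw [pow_succ, mul_apply_eq_comp, h1, map_smul, ih, smul_smul, pow_succ, mul_comm]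
    have h1 : ((1 - κ • T) ^ n) x = 0 := by
      rw [sub_eq_zero.1 hv]
      exact congrArg (fun f : X →L[ℂ] X => f x) hnil
    rw [hpow, smul_eq_zero] at h1
    rcases h1 with h1 | h1
    · exact (pow_ne_zero n (neg_ne_zero.2 (div_ne_zero hne hδκ0))) h1
    · exact hx0 h1
  · rintro r ⟨hr, hiso⟩
    have hres : ∀ ζ ∈ Metric.closedBall lam r, ζ ≠ lam → ζ ∈ resolventSet A := by
      intro ζ hζ hne
      by_contra hcon
      have : ζ ∈ Metric.closedBall lam r ∩ spectrum A := ⟨hζ, hcon⟩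
      rw [hiso] at this
      exact hne this
    set S := B * T with hS
    -- `(1 - Q) (ζ - A)⁻¹` extends holomorphically to `lam`, with the value `S`
    have hident : ∀ ζ ∈ resolventSet A,
        (1 + (ζ - lam) • S) * ((1 - Q) * resolvent A ζ) = S := by
      intro ζ hζ
      have hR := isResolventAt_resolvent hζ
      set R := resolvent A ζ
      have hLR : (1 - κ • T) * R = T - (ζ - lam) • (T * R) := by
        ext v
        change R v - κ • T (R v) = T v - (ζ - lam) • T (R v)
        have := hT.resolvent_identity hR v
        rw [sub_eq_iff_eq_add] at this
        nth_rewrite 1 [this]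
        rw [hκ]
        module
      have h1 : (1 - Q) * R = S - (ζ - lam) • (S * R) := by
        rw [← hBL, mul_assoc, hLR, mul_sub, mul_smul_comm, hS, mul_assoc]
      have h2 : S * ((1 - Q) * R) = S * R := by
        have h3 : S * Q = 0 := by rw [hS, mul_assoc, hTQ.eq, ← mul_assoc, hBQ, zero_mul]
        rw [← mul_assoc, mul_sub, h3, mul_one, sub_zero]
      rw [add_mul, one_mul, smul_mul_assoc, h2, h1, sub_add_cancel]
    let G : ℂ → X →L[ℂ] X := Function.update (fun ζ => (1 - Q) * resolvent A ζ) lam S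
    have hGne : ∀ ζ, ζ ≠ lam → G ζ = (1 - Q) * resolvent A ζ := fun ζ hζ =>
      Function.update_of_ne hζ _ _
    have hGev : ∀ ζ, ζ ≠ lam → G =ᶠ[𝓝 ζ] fun ζ => (1 - Q) * resolvent A ζ := by
      intro ζ hζ
      filter_upwards [isOpen_ne.mem_nhds hζ] with w hw using hGne w hw
    have hGd : ∀ ζ ∈ Metric.closedBall lam r, ζ ≠ lam → DifferentiableAt ℂ G ζ := by
      intro ζ hζ hne
      exact ((differentiableAt_const (1 - Q)).mul
        (differentiableAt_resolvent (hres ζ hζ hne))).congr_of_eventuallyEq (hGev ζ hne)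
    have hGc : ContinuousAt G lam := by
      have hd : DifferentiableAt ℂ (fun ζ : ℂ => 1 + (ζ - lam) • S) lam := by fun_prop
      have hu : IsUnit (1 + (lam - lam) • S) := by simp
      have hd' : DifferentiableAt ℂ (fun ζ : ℂ => Ring.inverse (1 + (ζ - lam) • S) * S) lam :=
        (hd.inverse hu).mul (differentiableAt_const S)
      refine hd'.continuousAt.congr ?_
      filter_upwards [hd.continuousAt.eventually_mem (Units.isOpen.mem_nhds hu),
        Metric.closedBall_mem_nhds lam hr] with ζ hζ hζr
      have hζ' : IsUnit (1 + (ζ - lam) • S) := hζ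
      rcases eq_or_ne ζ lam with rfl | hne
      · simp [G]
      · rw [hGne ζ hne]
        nth_rewrite 2 [← hident ζ (hres ζ hζr hne)]
        rw [← mul_assoc, Ring.inverse_mul_cancel _ hζ', one_mul]
    have hG0 : (∮ ζ in C(lam, r), G ζ) = 0 := by
      refine Complex.circleIntegral_eq_zero_of_differentiable_on_off_countable hr.le
        (countable_singleton lam) (fun ζ hζ => ?_) fun ζ hζ => ?_
      · rcases eq_or_ne ζ lam with rfl | hne
        · exact hGc.continuousWithinAt
        · exact (hGd ζ hζ hne).continuousAt.continuousWithinAt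
      · exact hGd ζ (Metric.ball_subset_closedBall hζ.1) hζ.2
    have hcont : ContinuousOn (resolvent A) (Metric.sphere lam r) := fun ζ hζ =>
      (differentiableAt_resolvent (hres ζ (Metric.sphere_subset_closedBall hζ)
        (Metric.ne_of_mem_sphere hζ hr.ne'))).continuousAt.continuousWithinAt
    have hint : (∮ ζ in C(lam, r), G ζ) = (1 - Q) * ∮ ζ in C(lam, r), resolvent A ζ := by
      rw [circleIntegral.integral_congr hr.le (g := fun ζ => (1 - Q) * resolvent A ζ)
        fun ζ hζ => hGne ζ (Metric.ne_of_mem_sphere hζ hr.ne')]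
      have h1 := ContinuousLinearMap.intervalIntegral_comp_comm
        (ContinuousLinearMap.mul ℂ (X →L[ℂ] X) (1 - Q))
        (hcont.circleIntegrable hr.le).out
      simp only [ContinuousLinearMap.mul_apply', mul_smul_comm] at h1
      exact h1
    -- hence the Riesz projection has its range in the finite-dimensional range of `Q`
    have hP : (1 - Q) * rieszProjection A lam r = 0 := by
      rw [rieszProjection, mul_smul_comm, ← hint, hG0, smul_zero]
    have hle : LinearMap.range (rieszProjection A lam r).toLinearMap
        ≤ LinearMap.range Q.toLinearMap := by
      rintro _ ⟨x, rfl⟩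
      have h1 : rieszProjection A lam r x - Q (rieszProjection A lam r x) = 0 :=
        congrArg (fun f : X →L[ℂ] X => f x) hP
      exact ⟨_, (sub_eq_zero.1 h1).symm⟩
    exact Submodule.finiteDimensional_of_le hle

end CompactResolvent

/-! ### Exponentials of bounded dissipative operators -/

section BoundedDissipative

variable {H : Type*} [NormedAddCommGroup H] [InnerProductSpace ℝ H]

theorem norm_le_norm_zero_of_inner_deriv_nonpos {f f' : ℝ → H}
    (hf : ∀ t, 0 ≤ t → HasDerivWithinAt f (f' t) (Ici 0) t)
    (h : ∀ t, 0 ≤ t → inner ℝ (f' t) (f t) ≤ 0) {t : ℝ} (ht : 0 ≤ t) : ‖f t‖ ≤ ‖f 0‖ := by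
  have hd : ∀ t, 0 ≤ t →
      HasDerivWithinAt (fun s => ‖f s‖ ^ 2) (2 * inner ℝ (f t) (f' t)) (Ici 0) t :=
    fun t ht => (hf t ht).norm_sq
  have hanti : AntitoneOn (fun s => ‖f s‖ ^ 2) (Ici 0) := by
    refine antitoneOn_of_deriv_nonpos (convex_Ici 0)
      (fun t ht => (hd t ht).continuousWithinAt) ?_ ?_
    · intro t ht
      rw [interior_Ici] at ht
      exact ((hd t (le_of_lt ht)).hasDerivAt
        (Ici_mem_nhds ht)).differentiableAt.differentiableWithinAt
    · intro t ht
      rw [interior_Ici] at ht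
      rw [((hd t (le_of_lt ht)).hasDerivAt (Ici_mem_nhds ht)).deriv, real_inner_comm]
      linarith [h t (le_of_lt ht)]
  exact le_of_sq_le_sq (hanti (mem_Ici.2 le_rfl) ht ht) (norm_nonneg _)

/-- The uniformly continuous semigroup `exp (t B)`. -/
def expSemigroup (B : H →L[ℝ] H) (t : ℝ) : H →L[ℝ] H := NormedSpace.exp (t • B)

theorem expSemigroup_zero (B : H →L[ℝ] H) : expSemigroup B 0 = 1 := by
  simp [expSemigroup]

theorem commute_expSemigroup {B C : H →L[ℝ] H} (h : Commute B C) (t : ℝ) :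
    Commute B (expSemigroup C t) :=
  (h.smul_right t).exp_right

variable [CompleteSpace H]

theorem hasDerivAt_expSemigroup (B : H →L[ℝ] H) (t : ℝ) :
    HasDerivAt (expSemigroup B) (B * expSemigroup B t) t :=
  hasDerivAt_exp_smul_const' B t

theorem hasDerivAt_expSemigroup_apply (B : H →L[ℝ] H) (x : H) (t : ℝ) :
    HasDerivAt (fun s => expSemigroup B s x) (B (expSemigroup B t x)) t := by
  have := (hasDerivAt_expSemigroup B t).clm_apply (hasDerivAt_const t x)
  simpa using this

theorem expSemigroup_add (B : H →L[ℝ] H) (s t : ℝ) :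
    expSemigroup B (s + t) = expSemigroup B s * expSemigroup B t := by
  let _ : NormedAlgebra ℚ (H →L[ℝ] H) := NormedAlgebra.restrictScalars ℚ ℝ _
  rw [expSemigroup, add_smul]
  exact NormedSpace.exp_add_of_commute (((Commute.refl B).smul_left s).smul_right t)

theorem norm_expSemigroup_apply_le {B : H →L[ℝ] H} (hB : ∀ x, inner ℝ (B x) x ≤ 0) {t : ℝ}
    (ht : 0 ≤ t) (x : H) : ‖expSemigroup B t x‖ ≤ ‖x‖ := by
  have h := norm_le_norm_zero_of_inner_deriv_nonpos
    (fun t _ => (hasDerivAt_expSemigroup_apply B x t).hasDerivWithinAt (s := Ici 0))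
    (fun t _ => hB _) ht
  rwa [expSemigroup_zero, one_apply_eq_self] at h

/-- The comparison estimate that makes the exponentials of the Yosida approximations converge. -/
theorem norm_expSemigroup_sub_le {B C : H →L[ℝ] H} (hB : ∀ x, inner ℝ (B x) x ≤ 0)
    (hC : ∀ x, inner ℝ (C x) x ≤ 0) (h : Commute B C) {t : ℝ} (ht : 0 ≤ t) (x : H) :
    ‖expSemigroup B t x - expSemigroup C t x‖ ≤ t * ‖B x - C x‖ := by
  -- interpolate by `exp (s B) exp ((t - s) C) x`
  let g : ℝ → H := fun s => expSemigroup B s (expSemigroup C (t - s) x)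
  have hg : ∀ s, HasDerivAt g (expSemigroup B s (expSemigroup C (t - s) (B x - C x))) s := by
    intro s
    have h1 : HasDerivAt (fun s => expSemigroup C (t - s) x)
        (-(C (expSemigroup C (t - s) x))) s := by
      have := (hasDerivAt_expSemigroup_apply C x (t - s)).scomp s
        ((hasDerivAt_id s).const_sub t)
      simpa [Function.comp_def] using this
    have h2 := (hasDerivAt_expSemigroup B s).clm_apply h1
    refine h2.congr_deriv ?_
    have c1 : ∀ y, B (expSemigroup B s y) = expSemigroup B s (B y) := fun y =>
      congrArg (fun f : H →L[ℝ] H => f y) (commute_expSemigroup (Commute.refl B) s).eq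
    have c2 : ∀ y, B (expSemigroup C (t - s) y) = expSemigroup C (t - s) (B y) := fun y =>
      congrArg (fun f : H →L[ℝ] H => f y) (commute_expSemigroup h (t - s)).eq
    have c3 : ∀ y, C (expSemigroup C (t - s) y) = expSemigroup C (t - s) (C y) := fun y =>
      congrArg (fun f : H →L[ℝ] H => f y) (commute_expSemigroup (Commute.refl C) (t - s)).eq
    rw [mul_apply_eq_comp, c1, c2, c3, map_neg, map_sub, map_sub, ← sub_eq_add_neg]
  have h1 := (convex_Icc 0 t).norm_image_sub_le_of_norm_hasDerivWithin_le (C := ‖B x - C x‖)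
    (fun s _ => (hg s).hasDerivWithinAt)
    (fun s hs => (norm_expSemigroup_apply_le hB hs.1 _).trans
      (norm_expSemigroup_apply_le hC (by linarith [hs.2]) _))
    (left_mem_Icc.2 ht) (right_mem_Icc.2 ht)
  simp only [g, sub_self, sub_zero, expSemigroup_zero, one_apply_eq_self] at h1
  rwa [Real.norm_of_nonneg ht, mul_comm] at h1

theorem norm_expSemigroup_sub_self_le {B : H →L[ℝ] H} (hB : ∀ x, inner ℝ (B x) x ≤ 0) {t : ℝ}
    (ht : 0 ≤ t) (x : H) : ‖expSemigroup B t x - x‖ ≤ t * ‖B x‖ := by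
  have h := norm_expSemigroup_sub_le (C := 0) hB (by simp) (Commute.zero_right B) ht x
  simpa [expSemigroup] using h

/-- A first-order Taylor bound for `exp (t B)`. For `d` close to `B x` it is of order `o(t)`, as long
as `‖B d‖` stays bounded; this makes it uniform over Yosida approximations. -/
theorem norm_expSemigroup_taylor_le {B : H →L[ℝ] H} (hB : ∀ x, inner ℝ (B x) x ≤ 0) {t : ℝ}
    (ht : 0 ≤ t) (x d : H) :
    ‖expSemigroup B t x - x - t • B x‖ ≤ t * (2 * ‖B x - d‖ + t * ‖B d‖) := by
  have hg : ∀ s, HasDerivAt (fun s => expSemigroup B s x - s • B x)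
      (expSemigroup B s (B x) - B x) s := by
    intro s
    have h1 := (hasDerivAt_expSemigroup_apply B x s).sub
      ((hasDerivAt_id s).smul_const (B x))
    have c1 : B (expSemigroup B s x) = expSemigroup B s (B x) :=
      congrArg (fun f : H →L[ℝ] H => f x) (commute_expSemigroup (Commute.refl B) s).eq
    rw [c1, one_smul] at h1
    exact h1
  have h1 := (convex_Icc 0 t).norm_image_sub_le_of_norm_hasDerivWithin_le
    (C := 2 * ‖B x - d‖ + t * ‖B d‖)
    (fun s _ => (hg s).hasDerivWithinAt)
    (fun s hs => by
      have e : expSemigroup B s (B x) - B x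
          = expSemigroup B s (B x - d) + (expSemigroup B s d - d) - (B x - d) := by
        rw [map_sub]
        abel
      rw [e]
      have k1 := norm_expSemigroup_apply_le hB hs.1 (B x - d)
      have k2 := (norm_expSemigroup_sub_self_le hB hs.1 d).trans
        (mul_le_mul_of_nonneg_right hs.2 (norm_nonneg (B d)))
      refine (norm_sub_le _ _).trans ?_
      linarith [norm_add_le (expSemigroup B s (B x - d)) (expSemigroup B s d - d)])
    (left_mem_Icc.2 ht) (right_mem_Icc.2 ht)
  simp only [zero_smul, sub_zero, expSemigroup_zero, one_apply_eq_self] at h1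
  rw [Real.norm_of_nonneg ht, mul_comm, sub_right_comm] at h1
  exact h1

end BoundedDissipative

/-! ### Maximal dissipative operators -/

section HilleYosida

variable {H : Type} [NormedAddCommGroup H] [InnerProductSpace ℝ H] {A : H →ₗ.[ℝ] H}

/-- `A` is dissipative and `l - A` maps onto the whole space for every `l > 0`. -/
structure IsMaxDissipative (A : H →ₗ.[ℝ] H) : Prop where
  inner_nonpos : ∀ x : A.domain, inner ℝ (A x) (x : H) ≤ 0
  surj : ∀ l : ℝ, 0 < l → ∀ v : H, ∃ x : A.domain, l • (x : H) - A x = v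

namespace IsMaxDissipative

/-- Dissipativity bounds the resolvent. -/
theorem norm_le (hA : IsMaxDissipative A) (l : ℝ) (x : A.domain) :
    l * ‖(x : H)‖ ≤ ‖l • (x : H) - A x‖ := by
  rcases eq_or_ne (x : H) 0 with h0 | h0
  · rw [h0, norm_zero, mul_zero]
    exact norm_nonneg _
  · have h1 : l * ‖(x : H)‖ * ‖(x : H)‖ ≤ ‖l • (x : H) - A x‖ * ‖(x : H)‖ := by
      calc l * ‖(x : H)‖ * ‖(x : H)‖ = inner ℝ (l • (x : H)) (x : H) := by
            rw [real_inner_smul_left, real_inner_self_eq_norm_sq]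
            ring
        _ ≤ inner ℝ (l • (x : H) - A x) (x : H) := by
            rw [inner_sub_left]
            linarith [hA.inner_nonpos x]
        _ ≤ _ := real_inner_le_norm _ _
    exact le_of_mul_le_mul_right h1 (norm_pos_iff.2 h0)

/-- The resolvent `(l - A)⁻¹` for `l > 0`. -/
theorem exists_resolvent (hA : IsMaxDissipative A) {l : ℝ} (hl : 0 < l) :
    ∃ R : H →L[ℝ] H, (∀ v, ∃ h : R v ∈ A.domain, l • R v - A ⟨R v, h⟩ = v) ∧
      (∀ x : A.domain, R (l • (x : H) - A x) = x) ∧ ∀ v, l * ‖R v‖ ≤ ‖v‖ := by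
  choose r hr using hA.surj l hl
  have hinj : ∀ x y : A.domain, l • (x : H) - A x = l • (y : H) - A y → x = y := by
    intro x y h
    have h1 := hA.norm_le l (x - y)
    have h2 : l • ((x - y : A.domain) : H) - A (x - y) = 0 := by
      rw [A.map_sub, Submodule.coe_sub, smul_sub]
      rw [← sub_eq_zero] at h
      rw [← h]
      abel
    rw [h2, norm_zero] at h1
    have h3 : ‖((x - y : A.domain) : H)‖ ≤ 0 := nonpos_of_mul_nonpos_right h1 hl
    rw [norm_le_zero_iff] at h3
    exact Subtype.ext (sub_eq_zero.1 h3)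
  let f : H →ₗ[ℝ] H :=
    { toFun := fun v => r v
      map_add' := by
        intro v w
        have : r (v + w) = r v + r w := by
          apply hinj
          rw [hr, A.map_add, Submodule.coe_add, smul_add]
          nth_rewrite 1 [← hr v, ← hr w]
          abel
        rw [this]
        rfl
      map_smul' := by
        intro c v
        have : r (c • v) = c • r v := by
          apply hinj
          rw [hr, A.map_smul, Submodule.coe_smul]
          nth_rewrite 1 [← hr v]
          module
        rw [this]
        rfl }
  have hb : ∀ v, l * ‖f v‖ ≤ ‖v‖ := by
    intro v
    have := hA.norm_le l (r v)
    rwa [hr] at this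
  refine ⟨f.mkContinuous l⁻¹ fun v => ?_, fun v => ⟨(r v).2, hr v⟩, fun x => ?_, hb⟩
  · rw [← div_eq_inv_mul, le_div_iff₀ hl, mul_comm]
    exact hb v
  · exact congrArg Subtype.val (hinj _ _ (hr (l • (x : H) - A x)))

/-- In a Hilbert space a maximal dissipative operator is densely defined: for `v ⊥ D(A)`,
`v = x - A x`, one has `‖x‖² ≤ ⟨x - A x, x⟩ = 0`. -/
theorem dense_domain [CompleteSpace H] (hA : IsMaxDissipative A) : Dense (A.domain : Set H) := by
  rw [Submodule.dense_iff_topologicalClosure_eq_top, Submodule.topologicalClosure_eq_top_iff,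
    Submodule.eq_bot_iff]
  intro v hv
  obtain ⟨x, hx⟩ := hA.surj 1 one_pos v
  have h1 : inner ℝ v (x : H) = 0 := Submodule.inner_left_of_mem_orthogonal x.2 hv
  have h2 : ‖(x : H)‖ ^ 2 ≤ 0 := by
    rw [← hx, inner_sub_left, one_smul, real_inner_self_eq_norm_sq] at h1
    linarith [hA.inner_nonpos x]
  have h3 : (x : H) = 0 := by
    have := sq_nonneg ‖(x : H)‖
    exact norm_eq_zero.1 (pow_eq_zero_iff two_ne_zero |>.1 (le_antisymm h2 this))
  have h4 : x = 0 := Subtype.ext h3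
  rw [← hx, h4, A.map_zero, Submodule.coe_zero, smul_zero, sub_zero]

/-- Yosida approximation: bounded dissipative commuting operators `B n` with `‖B n x‖ ≤ ‖A x‖` and
`B n x → A x` on `D(A)`. -/
theorem exists_yosida [CompleteSpace H] (hA : IsMaxDissipative A) :
    ∃ B : ℕ → H →L[ℝ] H, (∀ n x, inner ℝ (B n x) x ≤ 0) ∧ (∀ m n, Commute (B m) (B n)) ∧
      (∀ n (x : A.domain), ‖B n x‖ ≤ ‖A x‖) ∧
      ∀ x : A.domain, Tendsto (fun n => B n x) atTop (𝓝 (A x)) := by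
  let l : ℕ → ℝ := fun n => n + 1
  have hl : ∀ n, 0 < l n := fun n => by positivity
  choose R hR1 hR2 hR3 using fun n => hA.exists_resolvent (hl n)
  have hident : ∀ m n v, R m v - R n v = (l n - l m) • R n (R m v) := by
    intro m n v
    obtain ⟨hv, e⟩ := hR1 m v
    have h1 := hR2 n ⟨R m v, hv⟩
    change R n (l n • R m v - A ⟨R m v, hv⟩) = R m v at h1
    calc R m v - R n v = R n (l n • R m v - A ⟨R m v, hv⟩ - (l m • R m v - A ⟨R m v, hv⟩)) := by
          rw [map_sub, h1, e]
      _ = (l n - l m) • R n (R m v) := by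
          rw [← map_smul (R n)]
          congr 1
          module
  have hcomm : ∀ m n, Commute (R m) (R n) := by
    intro m n
    rcases eq_or_ne m n with rfl | hne
    · exact Commute.refl _
    · ext v
      change R m (R n v) = R n (R m v)
      have hne' : l n - l m ≠ 0 := by
        simp only [l, ne_eq, sub_eq_zero, add_left_inj, Nat.cast_inj]
        exact fun h => hne h.symm
      apply smul_right_injective H hne'
      change (l n - l m) • R m (R n v) = (l n - l m) • R n (R m v)
      rw [← hident m n v, ← neg_sub (l m), neg_smul, ← hident n m v, neg_sub]
  let B : ℕ → H →L[ℝ] H := fun n => l n • (l n • R n - 1)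
  have hBA : ∀ n (x : A.domain), B n x = l n • R n (A x) := by
    intro n x
    change l n • (l n • R n x - (x : H)) = _
    congr 1
    nth_rewrite 2 [← hR2 n x]
    rw [map_sub, map_smul]
    abel
  have hlR : ∀ n v, ‖l n • R n v‖ ≤ ‖v‖ := fun n v => by
    rw [norm_smul, Real.norm_of_nonneg (hl n).le]
    exact hR3 n v
  have hlim0 : ∀ x : A.domain, Tendsto (fun n => l n • R n x) atTop (𝓝 (x : H)) := by
    intro x
    rw [tendsto_iff_norm_sub_tendsto_zero]
    have h1 : ∀ n, ‖l n • R n x - (x : H)‖ ≤ ‖A x‖ * (1 / ((n : ℝ) + 1)) := by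
      intro n
      have e : l n • R n x - (x : H) = R n (A x) := by
        nth_rewrite 2 [← hR2 n x]
        rw [map_sub, map_smul]
        abel
      rw [e, mul_one_div, le_div_iff₀ (hl n), mul_comm]
      exact hR3 n _
    refine squeeze_zero (fun n => norm_nonneg _) h1 ?_
    have := (tendsto_one_div_add_atTop_nhds_zero_nat (𝕜 := ℝ)).const_mul ‖A x‖
    rwa [mul_zero] at this
  have hlim : ∀ v : H, Tendsto (fun n => l n • R n v) atTop (𝓝 v) := by
    intro v
    rw [Metric.tendsto_atTop]
    intro ε hε
    obtain ⟨d, hd, hdv⟩ := hA.dense_domain.exists_dist_lt v (by positivity : 0 < ε / 3)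
    obtain ⟨N, hN⟩ := Metric.tendsto_atTop.1 (hlim0 ⟨d, hd⟩) (ε / 3) (by positivity)
    refine ⟨N, fun n hn => ?_⟩
    have h1 := hN n hn
    change dist (l n • R n d) d < ε / 3 at h1
    have h2 : dist (l n • R n v) (l n • R n d) ≤ dist v d := by
      rw [dist_eq_norm, dist_eq_norm, ← smul_sub, ← map_sub]
      exact hlR n _
    have h3 := dist_triangle4 (l n • R n v) (l n • R n d) d v
    rw [dist_comm d v] at h3
    linarith
  refine ⟨B, ?_, ?_, ?_, ?_⟩
  · intro n x
    change inner ℝ (l n • (l n • R n x - x)) x ≤ 0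
    rw [real_inner_smul_left, inner_sub_left, real_inner_self_eq_norm_sq]
    refine mul_nonpos_of_nonneg_of_nonpos (hl n).le ?_
    have h1 := real_inner_le_norm (l n • R n x) x
    nlinarith [hlR n x, norm_nonneg x]
  · intro m n
    have h1 : Commute (l m • R m - 1) (l n • R n - 1) :=
      (((((hcomm m n).smul_left (l m)).smul_right (l n)).sub_left
        (Commute.one_left _)).sub_right (Commute.one_right _))
    exact (h1.smul_left (l m)).smul_right (l n)
  · intro n x
    rw [hBA]
    exact hlR n _
  · intro x
    simp only [hBA]
    exact hlim _

end IsMaxDissipative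

end HilleYosida

/-! ### The Hille–Yosida theorem -/

section HilleYosida

variable {H : Type} [NormedAddCommGroup H] [InnerProductSpace ℝ H] {A : H →ₗ.[ℝ] H}

/-- The semigroup generated by a maximal dissipative operator, as the strong limit of the
exponentials of its Yosida approximations. The last two bounds are what survives of the bounds for
the approximations. -/
theorem IsMaxDissipative.exists_limit_semigroup [CompleteSpace H] (hA : IsMaxDissipative A) :
    ∃ S : ℝ → H →L[ℝ] H, S 0 = ContinuousLinearMap.id ℝ H ∧
      (∀ s t : ℝ, 0 ≤ s → 0 ≤ t → S (s + t) = (S s).comp (S t)) ∧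
      (∀ t, 0 ≤ t → ∀ x, ‖S t x‖ ≤ ‖x‖) ∧
      (∀ t, 0 ≤ t → ∀ x : A.domain, ‖S t x - x‖ ≤ t * ‖A x‖) ∧
      ∀ t, 0 ≤ t → ∀ x d : A.domain,
        ‖S t x - x - t • A x‖ ≤ t * (2 * ‖A x - d‖ + t * ‖A d‖) := by
  obtain ⟨B, hB, hcomm, hBA, hlim⟩ := hA.exists_yosida
  have hcauchy : ∀ t, 0 ≤ t → ∀ x, CauchySeq fun n => expSemigroup (B n) t x := by
    intro t ht x
    rw [Metric.cauchySeq_iff]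
    intro ε hε
    obtain ⟨d, hd, hdx⟩ := hA.dense_domain.exists_dist_lt x (by positivity : 0 < ε / 4)
    obtain ⟨N, hN⟩ := Metric.cauchySeq_iff.1 (hlim ⟨d, hd⟩).cauchySeq (ε / (2 * (t + 1)))
      (by positivity)
    refine ⟨N, fun m hm n hn => ?_⟩
    have h1 := hN m hm n hn
    have h2 := norm_expSemigroup_sub_le (hB m) (hB n) (hcomm m n) ht d
    rw [← dist_eq_norm, ← dist_eq_norm] at h2
    have h3 : ∀ n, dist (expSemigroup (B n) t x) (expSemigroup (B n) t d) ≤ dist x d := by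
      intro n
      rw [dist_eq_norm, dist_eq_norm, ← map_sub]
      exact norm_expSemigroup_apply_le (hB n) ht _
    have h4 : t * dist (B m d) (B n d) ≤ ε / 2 := by
      calc t * dist (B m d) (B n d) ≤ (t + 1) * (ε / (2 * (t + 1))) := by
            gcongr
            · linarith
        _ = ε / 2 := by field_simp
    have h5 := dist_triangle4 (expSemigroup (B m) t x) (expSemigroup (B m) t d)
      (expSemigroup (B n) t d) (expSemigroup (B n) t x)
    have h6 := h3 n
    rw [dist_comm] at h6
    linarith [h3 m]
  have hex : ∀ t, ∃ T : H →L[ℝ] H, 0 ≤ t →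
      ∀ x, Tendsto (fun n => expSemigroup (B n) t x) atTop (𝓝 (T x)) := by
    intro t
    by_cases ht : 0 ≤ t
    · choose f hf using fun x => cauchySeq_tendsto_of_complete (hcauchy t ht x)
      let F : H →ₗ[ℝ] H := linearMapOfTendsto (l := atTop) f
        (fun n => (expSemigroup (B n) t).toLinearMap) (tendsto_pi_nhds.2 hf)
      refine ⟨F.mkContinuous 1 fun x => ?_, fun _ => hf⟩
      rw [one_mul]
      exact le_of_tendsto (hf x).norm
        (Eventually.of_forall fun n => norm_expSemigroup_apply_le (hB n) ht x)
    · exact ⟨0, fun h => absurd h ht⟩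
  choose S hS using hex
  refine ⟨S, ?_, ?_, ?_, ?_, ?_⟩
  · ext x
    refine tendsto_nhds_unique (hS 0 le_rfl x) ?_
    simp [expSemigroup_zero]
  · intro s t hs ht
    ext x
    refine tendsto_nhds_unique (hS (s + t) (add_nonneg hs ht) x) ?_
    change Tendsto _ _ (𝓝 (S s (S t x)))
    have h1 : Tendsto (fun n => expSemigroup (B n) s (expSemigroup (B n) t x - S t x)) atTop
        (𝓝 0) := by
      refine squeeze_zero_norm (fun n => norm_expSemigroup_apply_le (hB n) hs _) ?_
      have := ((hS t ht x).sub_const (S t x)).norm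
      rwa [sub_self, norm_zero] at this
    have h2 := h1.add (hS s hs (S t x))
    rw [zero_add] at h2
    refine h2.congr fun n => ?_
    rw [map_sub, sub_add_cancel, expSemigroup_add, mul_apply_eq_comp]
  · exact fun t ht x => le_of_tendsto (hS t ht x).norm
        (Eventually.of_forall fun n => norm_expSemigroup_apply_le (hB n) ht x)
  · intro t ht x
    refine le_of_tendsto ((hS t ht x).sub_const (x : H)).norm (Eventually.of_forall fun n => ?_)
    exact (norm_expSemigroup_sub_self_le (hB n) ht x).trans
      (mul_le_mul_of_nonneg_left (hBA n x) ht)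
  · intro t ht x d
    refine le_of_tendsto_of_tendsto
      (((hS t ht x).sub_const (x : H)).sub ((hlim x).const_smul t)).norm
      ((((((hlim x).sub_const (d : H)).norm).const_mul 2).add
        (((hlim d).norm).const_mul t)).const_mul t)
      (Eventually.of_forall fun n => ?_)
    exact norm_expSemigroup_taylor_le (hB n) ht x d

/-- The Hille–Yosida (Lumer–Phillips) theorem in a Hilbert space. -/
theorem IsMaxDissipative.exists_semigroup [CompleteSpace H] (hA : IsMaxDissipative A) :
    ∃ S : ℝ → H →L[ℝ] H, IsC0Semigroup S ∧ IsGenerator A S ∧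
      ∀ t, 0 ≤ t → ∀ x, ‖S t x‖ ≤ ‖x‖ := by
  obtain ⟨S, hS0, hSadd, hSc, hSL, hST⟩ := hA.exists_limit_semigroup
  have hgen : ∀ x : A.domain, Tendsto (fun t : ℝ => t⁻¹ • (S t x - x)) (𝓝[>] 0) (𝓝 (A x)) := by
    intro x
    rw [Metric.tendsto_nhds]
    intro ε hε
    obtain ⟨d, hd, hdx⟩ := hA.dense_domain.exists_dist_lt (A x) (by positivity : 0 < ε / 4)
    set c : ℝ := ‖A ⟨d, hd⟩‖ + 1 with hc
    have hc0 : 0 < c := by positivity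
    have hmem : Ioo 0 (ε / (2 * c)) ∈ 𝓝[>] (0 : ℝ) := Ioo_mem_nhdsGT (by positivity)
    filter_upwards [hmem] with t ht
    have h1 := hST t ht.1.le x ⟨d, hd⟩
    have e : t⁻¹ • (S t x - x) - A x = t⁻¹ • (S t x - x - t • A x) := by
      rw [smul_sub t⁻¹ _ (t • A x), inv_smul_smul₀ ht.1.ne']
    rw [dist_eq_norm, e, norm_smul, norm_inv, Real.norm_of_nonneg ht.1.le,
      inv_mul_lt_iff₀ ht.1]
    refine h1.trans_lt (mul_lt_mul_of_pos_left ?_ ht.1)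
    rw [dist_eq_norm] at hdx
    have h2 : t * ‖A ⟨d, hd⟩‖ ≤ ε / 2 := by
      calc t * ‖A ⟨d, hd⟩‖ ≤ ε / (2 * c) * c := by
            gcongr
            · exact ht.2.le
            · rw [hc]; linarith
        _ = ε / 2 := by field_simp
    change 2 * ‖A x - d‖ + t * ‖A ⟨d, hd⟩‖ < ε
    linarith
  refine ⟨S, ⟨hS0, hSadd, ?_⟩, ?_, hSc⟩
  · intro x
    rw [Metric.tendsto_nhds]
    intro ε hε
    obtain ⟨d, hd, hdx⟩ := hA.dense_domain.exists_dist_lt x (by positivity : 0 < ε / 4)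
    set c : ℝ := ‖A ⟨d, hd⟩‖ + 1 with hc
    have hc0 : 0 < c := by positivity
    have hmem : Ioo 0 (ε / (2 * c)) ∈ 𝓝[>] (0 : ℝ) := Ioo_mem_nhdsGT (by positivity)
    filter_upwards [hmem] with t ht
    have h1 : dist (S t x) (S t d) ≤ dist x d := by
      rw [dist_eq_norm, dist_eq_norm, ← map_sub]
      exact hSc t ht.1.le _
    have h2 := hSL t ht.1.le ⟨d, hd⟩
    change ‖S t d - d‖ ≤ _ at h2
    rw [← dist_eq_norm] at h2
    have h3 : t * ‖A ⟨d, hd⟩‖ ≤ ε / 2 := by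
      calc t * ‖A ⟨d, hd⟩‖ ≤ ε / (2 * c) * c := by
            gcongr
            · exact ht.2.le
            · rw [hc]; linarith
        _ = ε / 2 := by field_simp
    have h4 := dist_triangle4 (S t x) (S t d) d x
    rw [dist_comm d x] at h4
    linarith
  · intro x v
    constructor
    · intro h
      obtain ⟨y, hy1, hy2⟩ := (A.mem_graph_iff).1 h
      dsimp only at hy1 hy2
      rw [← hy1, ← hy2]
      exact hgen y
    · -- the generator extends `A` and is dissipative, so that it has no proper extension of `A`
      intro h
      obtain ⟨d, hd⟩ := hA.surj 1 one_pos (x - v)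
      have h1 := h.sub (hgen d)
      have e : v - A d = x - d := by
        rw [one_smul] at hd
        have : v = x - (d - A d) := by rw [hd]; abel
        nth_rewrite 1 [this]
        abel
      rw [e] at h1
      have h2 : inner ℝ (x - d) (x - d) ≤ 0 := by
        refine le_of_tendsto (h1.inner (tendsto_const_nhds (x := x - (d : H)))) ?_
        filter_upwards [self_mem_nhdsWithin] with t ht
        have ht0 : (0 : ℝ) < t := ht
        have e2 : t⁻¹ • (S t x - x) - t⁻¹ • (S t d - d)
            = t⁻¹ • (S t (x - d) - (x - d)) := by
          rw [map_sub, ← smul_sub]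
          congr 1
          abel
        rw [e2, real_inner_smul_left, inner_sub_left, real_inner_self_eq_norm_sq]
        refine mul_nonpos_of_nonneg_of_nonpos (inv_nonneg.2 ht0.le) ?_
        have h3 := real_inner_le_norm (S t (x - d)) (x - d)
        nlinarith [hSc t ht0.le (x - d), norm_nonneg (x - (d : H))]
      have h3 : x - (d : H) = 0 := by
        rw [real_inner_self_nonpos] at h2
        exact h2
      rw [h3, sub_eq_zero] at e
      exact (A.mem_graph_iff).2 ⟨d, (sub_eq_zero.1 h3).symm, e.symm⟩

end HilleYosida

/-! ### The abstract Cauchy problem -/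

section CauchyProblem

variable {H : Type} [NormedAddCommGroup H] [InnerProductSpace ℝ H] {A : H →ₗ.[ℝ] H}
  {S : ℝ → H →L[ℝ] H}

/-- Orbits of a contraction semigroup are continuous. Since the values of `S` at negative times are
unspecified, the orbit is extended by its initial value to get a function on the whole line. -/
theorem IsC0Semigroup.continuous_orbit (hS : IsC0Semigroup S)
    (hc : ∀ t, 0 ≤ t → ∀ x, ‖S t x‖ ≤ ‖x‖) (x : H) : Continuous fun t => S (max t 0) x := by
  have hle : ∀ s t, 0 ≤ s → 0 ≤ t → ‖S s x - S t x‖ ≤ ‖S |s - t| x - x‖ := by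
    intro s t hs ht
    wlog hst : t ≤ s generalizing s t
    · rw [norm_sub_rev, abs_sub_comm]
      exact this t s ht hs (le_of_not_ge hst)
    · rw [abs_of_nonneg (sub_nonneg.2 hst)]
      have e : S s x = S t (S (s - t) x) := by
        have := hS.add t (s - t) ht (sub_nonneg.2 hst)
        rw [add_sub_cancel] at this
        rw [this]
        rfl
      rw [e, ← map_sub]
      exact hc t ht _
  have h0 : ContinuousWithinAt (fun t => S t x) (Ici 0) 0 := by
    rw [← continuousWithinAt_Ioi_iff_Ici]
    have := hS.continuous x
    have e : S 0 x = x := by rw [hS.zero]; rfl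
    change Tendsto (fun t => S t x) (𝓝[>] 0) (𝓝 (S 0 x))
    rwa [e]
  rw [continuous_iff_continuousAt]
  intro t₀
  rw [ContinuousAt, tendsto_iff_norm_sub_tendsto_zero]
  refine squeeze_zero (fun _ => norm_nonneg _)
    (fun t => hle _ _ (le_max_right t 0) (le_max_right t₀ 0)) ?_
  have h1 : Tendsto (fun t : ℝ => |max t 0 - max t₀ 0|) (𝓝 t₀) (𝓝[≥] 0) := by
    refine tendsto_nhdsWithin_iff.2 ⟨?_, Eventually.of_forall fun t => mem_Ici.2 (abs_nonneg _)⟩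
    have : Continuous fun t : ℝ => |max t 0 - max t₀ 0| := by fun_prop
    simpa using this.tendsto t₀
  have h2 : Tendsto (fun t => ‖S t x - x‖) (𝓝[≥] 0) (𝓝 0) := by
    have h3 : Tendsto (fun t => S t x) (𝓝[≥] 0) (𝓝 (S 0 x)) := h0
    have e : S 0 x = x := by rw [hS.zero]; rfl
    rw [e] at h3
    exact tendsto_iff_norm_sub_tendsto_zero.1 h3
  exact h2.comp h1

theorem IsC0Semigroup.continuousOn_orbit (hS : IsC0Semigroup S)
    (hc : ∀ t, 0 ≤ t → ∀ x, ‖S t x‖ ≤ ‖x‖) (x : H) :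
    ContinuousOn (fun t => S t x) (Ici 0) :=
  (hS.continuous_orbit hc x).continuousOn.congr fun t ht => by
    simp only [max_eq_left (mem_Ici.1 ht)]

theorem IsGenerator.graph_orbit (hS : IsC0Semigroup S) (hg : IsGenerator A S) {x v : H}
    (h : (x, v) ∈ A.graph) {t : ℝ} (ht : 0 ≤ t) : (S t x, S t v) ∈ A.graph := by
  rw [hg] at h ⊢
  refine (((S t).continuous.tendsto v).comp h).congr' ?_
  filter_upwards [self_mem_nhdsWithin] with s hs
  have hs0 : (0 : ℝ) ≤ s := le_of_lt hs
  have e : S t (S s x) = S s (S t x) := by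
    have h1 := hS.add t s ht hs0
    rw [add_comm, hS.add s t hs0 ht] at h1
    exact (congrArg (fun f : H →L[ℝ] H => f x) h1).symm
  simp only [Function.comp_apply, map_smul, map_sub, e]

theorem hasDerivWithinAt_Ici_primitive [CompleteSpace H] {g : ℝ → H} (hg : Continuous g)
    {f : ℝ → H} (hf : ∀ t, 0 ≤ t → f t = f 0 + ∫ s in (0 : ℝ)..t, g s) {t : ℝ} (ht : 0 ≤ t) :
    HasDerivWithinAt f (g t) (Ici 0) t := by
  have h1 : HasDerivAt (fun t => f 0 + ∫ s in (0 : ℝ)..t, g s) (g t) t :=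
    (intervalIntegral.integral_hasDerivAt_right (hg.intervalIntegrable _ _)
      (hg.stronglyMeasurableAtFilter _ _) hg.continuousAt).const_add _
  exact h1.hasDerivWithinAt.congr (fun s hs => hf s hs) (hf t ht)

/-- The generator gives the right derivative of an orbit; this derivative is continuous, so that the
orbit is its primitive and is differentiable from both sides. -/
theorem isStrongSolution_orbit [CompleteSpace H] (hS : IsC0Semigroup S)
    (hc : ∀ t, 0 ≤ t → ∀ x, ‖S t x‖ ≤ ‖x‖) (hg : IsGenerator A S) {x v : H}
    (h : (x, v) ∈ A.graph) : IsStrongSolution A x fun t => S t x := by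
  refine ⟨congrArg (fun f : H →L[ℝ] H => f x) hS.zero, fun t => S t v,
    fun t ht => hg.graph_orbit hS h ht, hS.continuousOn_orbit hc x, hS.continuousOn_orbit hc v,
    fun t ht => ?_⟩
  have hcont := hS.continuous_orbit hc v
  have hder : ∀ t, 0 ≤ t → HasDerivWithinAt (fun t => S t x) (S (max t 0) v) (Ioi t) t := by
    intro t ht
    rw [hasDerivWithinAt_iff_tendsto_slope' (notMem_Ioi.2 le_rfl), max_eq_left ht]
    have h1 := (hg _ _).1 (hg.graph_orbit hS h ht)
    have h2 : Tendsto (fun s => s - t) (𝓝[>] t) (𝓝[>] 0) := by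
      refine tendsto_nhdsWithin_iff.2 ⟨?_, ?_⟩
      · have : Continuous fun s : ℝ => s - t := by fun_prop
        simpa using (this.tendsto t).mono_left nhdsWithin_le_nhds
      · filter_upwards [self_mem_nhdsWithin] with s hs using mem_Ioi.2 (sub_pos.2 (mem_Ioi.1 hs))
    refine (h1.comp h2).congr' ?_
    filter_upwards [self_mem_nhdsWithin] with s hs
    have hs' : 0 ≤ s - t := sub_nonneg.2 (le_of_lt hs)
    have e : S (s - t) (S t x) = S s x := by
      have := hS.add (s - t) t hs' ht
      rw [sub_add_cancel] at this
      rw [this]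
      rfl
    simp only [Function.comp_apply, slope, e, vsub_eq_sub]
  have hprim : ∀ t, 0 ≤ t → S t x = S 0 x + ∫ s in (0 : ℝ)..t, S (max s 0) v := by
    intro t ht
    rw [intervalIntegral.integral_eq_sub_of_hasDeriv_right_of_le ht
      ((hS.continuousOn_orbit hc x).mono Icc_subset_Ici_self)
      (fun s hs => hder s hs.1.le) (hcont.intervalIntegrable _ _)]
    abel
  have := hasDerivWithinAt_Ici_primitive hcont hprim ht
  rwa [max_eq_left ht] at this

theorem IsStrongSolution.eq_of_dissipative (hA : ∀ x : A.domain, inner ℝ (A x) (x : H) ≤ 0)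
    {x : H} {Φ Ψ : ℝ → H} (hΦ : IsStrongSolution A x Φ) (hΨ : IsStrongSolution A x Ψ) {t : ℝ}
    (ht : 0 ≤ t) : Φ t = Ψ t := by
  obtain ⟨h0, AΦ, hgr, -, -, hd⟩ := hΦ
  obtain ⟨k0, AΨ, kgr, -, -, kd⟩ := hΨ
  have h1 := norm_le_norm_zero_of_inner_deriv_nonpos (f := fun t => Φ t - Ψ t)
    (fun t ht => (hd t ht).sub (kd t ht)) (fun t ht => by
      obtain ⟨y, hy1, hy2⟩ := (A.mem_graph_iff).1 (A.graph.sub_mem (hgr t ht) (kgr t ht))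
      simp only [Prod.fst_sub, Prod.snd_sub] at hy1 hy2
      rw [← hy1, ← hy2]
      exact hA y) ht
  simp only [h0, k0, sub_self, norm_zero] at h1
  exact sub_eq_zero.1 (norm_le_zero_iff.1 h1)

theorem intervalIntegral_max_zero (Φ : ℝ → H) {t : ℝ} (ht : 0 ≤ t) :
    ∫ s in (0 : ℝ)..t, Φ (max s 0) = ∫ s in (0 : ℝ)..t, Φ s := by
  refine intervalIntegral.integral_congr fun s hs => ?_
  rw [uIcc_of_le ht] at hs
  simp only [max_eq_left hs.1]

/-- The difference quotients of `s ↦ S s (∫₀ᵗ S r x dr)` are those of `∫ₛ^{t+s} S r x dr`, which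
converge to `S t x - x`. -/
theorem isMildSolution_orbit [CompleteSpace H] (hS : IsC0Semigroup S)
    (hc : ∀ t, 0 ≤ t → ∀ x, ‖S t x‖ ≤ ‖x‖) (hg : IsGenerator A S) (x : H) :
    IsMildSolution A x fun t => S t x := by
  refine ⟨hS.continuousOn_orbit hc x, fun t ht => ?_⟩
  have hcont := hS.continuous_orbit hc x
  let g : ℝ → H := fun t => S (max t 0) x
  let G : ℝ → H := fun t => ∫ s in (0 : ℝ)..t, g s
  have hG : ∀ t, HasDerivAt G (g t) t := fun t =>
    intervalIntegral.integral_hasDerivAt_right (hcont.intervalIntegrable _ _)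
      (hcont.stronglyMeasurableAtFilter _ _) hcont.continuousAt
  have hgr : (G t, S t x - x) ∈ A.graph := by
    rw [hg]
    have h1 := (hG t).tendsto_slope_zero_right.sub (hG 0).tendsto_slope_zero_right
    have e0 : g t - g 0 = S t x - x := by
      simp only [g, max_eq_left ht, max_self, hS.zero]
      rfl
    rw [e0] at h1
    refine h1.congr' ?_
    filter_upwards [self_mem_nhdsWithin] with h hh
    have hh0 : (0 : ℝ) ≤ h := le_of_lt hh
    have e1 : S h (G t) = G (t + h) - G h := by
      have e2 : S h (G t) = ∫ s in (0 : ℝ)..t, g (s + h) := by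
        rw [← (S h).intervalIntegral_comp_comm (hcont.intervalIntegrable _ _)]
        refine intervalIntegral.integral_congr fun s hs => ?_
        rw [uIcc_of_le ht] at hs
        simp only [g, max_eq_left hs.1, max_eq_left (add_nonneg hs.1 hh0)]
        rw [add_comm, hS.add h s hh0 hs.1]
        rfl
      rw [e2, intervalIntegral.integral_comp_add_right, zero_add,
        intervalIntegral.integral_interval_sub_left (hcont.intervalIntegrable _ _)
          (hcont.intervalIntegrable _ _)]
    have e3 : G 0 = 0 := intervalIntegral.integral_same
    rw [e1, ← smul_sub, zero_add, e3, sub_zero]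
    congr 1
    abel
  obtain ⟨y, hy1, hy2⟩ := (A.mem_graph_iff).1 hgr
  have e : G t = ∫ s in (0 : ℝ)..t, S s x := intervalIntegral_max_zero (fun s => S s x) ht
  have hy : (y : H) = ∫ s in (0 : ℝ)..t, S s x := hy1.trans e
  refine ⟨hy ▸ y.2, ?_⟩
  have : A ⟨∫ s in (0 : ℝ)..t, S s x, hy ▸ y.2⟩ = A y := by
    congr 1
    exact Subtype.ext hy.symm
  rw [this, hy2]
  exact (add_sub_cancel x (S t x)).symm

/-- The primitive of the difference of two mild solutions is a strong solution with initial
value `0`. -/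
theorem IsMildSolution.eq_of_dissipative [CompleteSpace H]
    (hA : ∀ x : A.domain, inner ℝ (A x) (x : H) ≤ 0)
    {x : H} {Φ Ψ : ℝ → H} (hΦ : IsMildSolution A x Φ) (hΨ : IsMildSolution A x Ψ) {t : ℝ}
    (ht : 0 ≤ t) : Φ t = Ψ t := by
  let g : ℝ → H := fun t => Φ (max t 0) - Ψ (max t 0)
  let W : ℝ → H := fun t => ∫ s in (0 : ℝ)..t, g s
  have hmax : ∀ {f : ℝ → H}, ContinuousOn f (Ici 0) → Continuous fun t => f (max t 0) := by
    intro f hf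
    exact hf.comp_continuous (by fun_prop) fun t => le_max_right t 0
  have hcΦ := hmax hΦ.1
  have hcΨ := hmax hΨ.1
  have hcont : Continuous g := hcΦ.sub hcΨ
  have hgr : ∀ t, 0 ≤ t → (W t, g t) ∈ A.graph := by
    intro t ht
    obtain ⟨h1, h2⟩ := hΦ.2 t ht
    obtain ⟨k1, k2⟩ := hΨ.2 t ht
    have e1 : W t = (∫ s in (0 : ℝ)..t, Φ s) - ∫ s in (0 : ℝ)..t, Ψ s := by
      rw [← intervalIntegral_max_zero Φ ht, ← intervalIntegral_max_zero Ψ ht]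
      exact intervalIntegral.integral_sub (hcΦ.intervalIntegrable _ _)
        (hcΨ.intervalIntegrable _ _)
    have e2 : g t = A ⟨_, h1⟩ - A ⟨_, k1⟩ := by
      simp only [g, max_eq_left ht]
      rw [h2, k2]
      abel
    rw [e1, e2]
    exact A.graph.sub_mem (A.mem_graph ⟨_, h1⟩) (A.mem_graph ⟨_, k1⟩)
  have hd : ∀ t, HasDerivAt W (g t) t := fun t =>
    intervalIntegral.integral_hasDerivAt_right (hcont.intervalIntegrable _ _)
      (hcont.stronglyMeasurableAtFilter _ _) hcont.continuousAt
  have hW0 : W 0 = 0 := intervalIntegral.integral_same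
  have hW : IsStrongSolution A 0 W :=
    ⟨hW0, g, hgr, fun t _ => (hd t).continuousAt.continuousWithinAt, hcont.continuousOn,
      fun t _ => (hd t).hasDerivWithinAt⟩
  have h0 : IsStrongSolution A 0 fun _ => 0 :=
    ⟨rfl, fun _ => 0, fun _ _ => A.graph.zero_mem, continuousOn_const, continuousOn_const,
      fun _ _ => hasDerivWithinAt_const _ _ _⟩
  have h1 := hgr t ht
  rw [hW.eq_of_dissipative hA h0 ht] at h1
  have h2 : g t = 0 := A.graph_fst_eq_zero_snd h1 rfl
  simp only [g, max_eq_left ht] at h2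
  exact sub_eq_zero.1 h2

end CauchyProblem

/-! ### Change of the norm -/

section Transport

variable {X Y : Type} [NormedAddCommGroup X] [NormedSpace ℝ X] [NormedAddCommGroup Y]
  [NormedSpace ℝ Y] {A : X →ₗ.[ℝ] X} {A' : Y →ₗ.[ℝ] Y} (e : X ≃L[ℝ] Y)

theorem isMildSolution_iff_graph {x : X} {Φ : ℝ → X} : IsMildSolution A x Φ ↔
    ContinuousOn Φ (Ici 0) ∧ ∀ t, 0 ≤ t → (∫ s in (0 : ℝ)..t, Φ s, Φ t - x) ∈ A.graph := by
  refine and_congr_right fun _ => forall₂_congr fun t _ => ?_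
  rw [A.mem_graph_iff]
  constructor
  · rintro ⟨h1, h2⟩
    exact ⟨⟨_, h1⟩, rfl, by rw [h2, add_sub_cancel_left]⟩
  · rintro ⟨y, h1, h2⟩
    dsimp only at h1 h2
    refine ⟨h1 ▸ y.2, ?_⟩
    have : A ⟨∫ s in (0 : ℝ)..t, Φ s, h1 ▸ y.2⟩ = A y := by
      congr 1
      exact Subtype.ext h1.symm
    rw [this, h2, add_sub_cancel]

theorem IsStrongSolution.map (h : ∀ x v, (x, v) ∈ A.graph → (e x, e v) ∈ A'.graph) {x : X}
    {Φ : ℝ → X} (hΦ : IsStrongSolution A x Φ) : IsStrongSolution A' (e x) fun t => e (Φ t) := by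
  obtain ⟨h0, AΦ, hgr, hc, hc', hd⟩ := hΦ
  exact ⟨congrArg e h0, fun t => e (AΦ t), fun t ht => h _ _ (hgr t ht),
    e.continuous.comp_continuousOn hc, e.continuous.comp_continuousOn hc',
    fun t ht => e.toContinuousLinearMap.hasFDerivAt.comp_hasDerivWithinAt t (hd t ht)⟩

theorem IsMildSolution.map [CompleteSpace X] [CompleteSpace Y]
    (h : ∀ x v, (x, v) ∈ A.graph → (e x, e v) ∈ A'.graph) {x : X}
    {Φ : ℝ → X} (hΦ : IsMildSolution A x Φ) : IsMildSolution A' (e x) fun t => e (Φ t) := by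
  rw [isMildSolution_iff_graph] at hΦ ⊢
  refine ⟨e.continuous.comp_continuousOn hΦ.1, fun t ht => ?_⟩
  have h1 : IntervalIntegrable Φ volume 0 t :=
    (hΦ.1.mono (by rw [uIcc_of_le ht]; exact Icc_subset_Ici_self)).intervalIntegrable
  have h2 := e.toContinuousLinearMap.intervalIntegral_comp_comm h1
  have h3 := h _ _ (hΦ.2 t ht)
  rw [map_sub] at h3
  exact h2.symm ▸ h3

end Transport

section Renorming

/-- A real vector space with the norm of an inner product on it. -/
def Renormed {X : Type} [AddCommGroup X] [Module ℝ X] (_ : InnerProductSpace.Core ℝ X) : Type := X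

variable {X : Type}

instance Renormed.instNormedAddCommGroup [AddCommGroup X] [Module ℝ X]
    (core : InnerProductSpace.Core ℝ X) : NormedAddCommGroup (Renormed core) :=
  core.toNormedAddCommGroup

instance Renormed.instInnerProductSpace [AddCommGroup X] [Module ℝ X]
    (core : InnerProductSpace.Core ℝ X) : InnerProductSpace ℝ (Renormed core) :=
  InnerProductSpace.ofCore core.toCore

variable [NormedAddCommGroup X] [NormedSpace ℝ X]

/-- The identity as a topological isomorphism onto the renormed space. -/
def Renormed.equiv (core : InnerProductSpace.Core ℝ X) {k C : ℝ} (hk : 0 < k)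
    (h1 : ∀ x, k * ‖x‖ ≤ √(core.inner x x)) (h2 : ∀ x, √(core.inner x x) ≤ C * ‖x‖) :
    X ≃L[ℝ] Renormed core :=
  let f : X ≃ₗ[ℝ] Renormed core := LinearEquiv.refl ℝ X
  f.toContinuousLinearEquivOfBounds C k⁻¹ h2 fun x => by
    rw [← div_eq_inv_mul, le_div_iff₀ hk, mul_comm]
    exact h1 x

/-- Generation of a contraction semigroup, with the strong and mild solutions, for an operator which
is maximal dissipative with respect to an equivalent inner product. -/
theorem exists_contraction_semigroup [CompleteSpace X] (core : InnerProductSpace.Core ℝ X)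
    {k C : ℝ} (hk : 0 < k) (h1 : ∀ x, k * ‖x‖ ≤ √(core.inner x x))
    (h2 : ∀ x, √(core.inner x x) ≤ C * ‖x‖) (A : X →ₗ.[ℝ] X)
    (hd : ∀ x : A.domain, core.inner (A x) (x : X) ≤ 0)
    (hs : ∀ l : ℝ, 0 < l → ∀ v : X, ∃ x : A.domain, l • (x : X) - A x = v) :
    Dense (A.domain : Set X) ∧ ∃ S : ℝ → X →L[ℝ] X, IsC0Semigroup S ∧ IsGenerator A S ∧
      (∀ t, 0 ≤ t → ∀ x, √(core.inner (S t x) (S t x)) ≤ √(core.inner x x)) ∧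
      (∀ x ∈ A.domain, IsStrongSolution A x (fun t => S t x) ∧
        ∀ Φ : ℝ → X, IsStrongSolution A x Φ → ∀ t, 0 ≤ t → Φ t = S t x) ∧
      ∀ x, IsMildSolution A x (fun t => S t x) ∧
        ∀ Φ : ℝ → X, IsMildSolution A x Φ → ∀ t, 0 ≤ t → Φ t = S t x := by
  let e := Renormed.equiv core hk h1 h2
  let A' : Renormed core →ₗ.[ℝ] Renormed core := A
  have hA' : IsMaxDissipative A' := ⟨hd, hs⟩
  have hgr : ∀ x v, (x, v) ∈ A.graph → (e x, e v) ∈ A'.graph := fun x v h => h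
  have hgr' : ∀ x v, (x, v) ∈ A'.graph → (e.symm x, e.symm v) ∈ A.graph := fun x v h => h
  have : CompleteSpace (Renormed core) :=
    (completeSpace_congr (e := e.toLinearEquiv.toEquiv) e.isUniformEmbedding).1 inferInstance
  obtain ⟨S', hS', hg', hc'⟩ := hA'.exists_semigroup
  let S : ℝ → X →L[ℝ] X := fun t =>
    e.symm.toContinuousLinearMap.comp ((S' t).comp e.toContinuousLinearMap)
  have hSe : ∀ t x, S t x = e.symm (S' t (e x)) := fun _ _ => rfl
  have hdom : ∀ x ∈ A.domain, ∃ v, (x, v) ∈ A.graph := fun x hx =>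
    ⟨A ⟨x, hx⟩, A.mem_graph ⟨x, hx⟩⟩
  refine ⟨?_, S, ⟨?_, ?_, ?_⟩, ?_, hc', ?_, ?_⟩
  · have h3 := e.symm.surjective.denseRange.dense_image e.symm.continuous hA'.dense_domain
    refine h3.mono ?_
    rintro _ ⟨y, hy, rfl⟩
    exact hy
  · ext x
    rw [hSe, hS'.zero]
    exact e.symm_apply_apply x
  · intro s t hs ht
    ext x
    rw [hSe, hS'.add s t hs ht]
    rfl
  · intro x
    have := (e.symm.continuous.tendsto _).comp (hS'.continuous (e x))
    rwa [e.symm_apply_apply] at this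
  · intro x v
    constructor
    · intro h
      have := (e.symm.continuous.tendsto _).comp ((hg' (e x) (e v)).1 (hgr x v h))
      rwa [e.symm_apply_apply] at this
    · intro h
      refine (hg' (e x) (e v)).2 ?_
      exact (e.continuous.tendsto _).comp h
  · intro x hx
    obtain ⟨v, hv⟩ := hdom x hx
    refine ⟨(isStrongSolution_orbit hS' hc' hg' (hgr x v hv)).map e.symm hgr', ?_⟩
    intro Φ hΦ t ht
    have := IsStrongSolution.eq_of_dissipative hd (hΦ.map e hgr)
      (isStrongSolution_orbit hS' hc' hg' (hgr x v hv)) ht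
    rw [hSe, ← this, e.symm_apply_apply]
  · intro x
    refine ⟨(isMildSolution_orbit hS' hc' hg' (e x)).map e.symm hgr', ?_⟩
    intro Φ hΦ t ht
    have := IsMildSolution.eq_of_dissipative hA'.inner_nonpos (hΦ.map e hgr)
      (isMildSolution_orbit hS' hc' hg' (e x)) ht
    rw [hSe, ← this, e.symm_apply_apply]

end Renorming

/-! ### Sobolev functions on the interval -/

section Sobolev

variable {𝕜 : Type} [RCLike 𝕜]

theorem L2.intervalIntegrable (w : L2 𝕜) : IntervalIntegrable w volume 0 1 :=
  intervalIntegrable_of_vol01 (L2.integrable w)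

theorem L2.intervalIntegrable_sub (w : L2 𝕜) (x y : unitInterval) :
    IntervalIntegrable w volume x y :=
  w.intervalIntegrable.mono_set (uIcc_subset_uIcc (by simp) (by simp))

/-- Cauchy–Schwarz against the indicator function of an interval. -/
theorem L2.norm_integral_le (w : L2 𝕜) (x y : unitInterval) :
    ‖∫ t in (x : ℝ)..y, w t‖ ≤ √|(y : ℝ) - x| * ‖w‖ := by
  wlog hxy : x ≤ y generalizing x y
  · rw [intervalIntegral.integral_symm, norm_neg, abs_sub_comm]
    exact this y x (le_of_not_ge hxy)
  have hxy' : (x : ℝ) ≤ y := hxy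
  have hμ : vol01 (Ioo (x : ℝ) y) ≠ ⊤ := measure_ne_top _ _
  have h1 := L2.inner_indicatorConstLp_one (𝕜 := 𝕜) (μ := vol01) measurableSet_Ioo hμ w
  have hsub : Ioo (x : ℝ) y ⊆ Ioo 0 1 := Ioo_subset_Ioo x.2.1 y.2.2
  have h2 : (vol01.restrict (Ioo (x : ℝ) y)) = volume.restrict (Ioo (x : ℝ) y) := by
    rw [Measure.restrict_restrict measurableSet_Ioo, inter_eq_left.2 hsub]
  rw [h2] at h1
  rw [intervalIntegral.integral_of_le hxy', integral_Ioc_eq_integral_Ioo, ← h1]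
  refine (norm_inner_le_norm _ _).trans (mul_le_mul_of_nonneg_right ?_ (norm_nonneg _))
  rw [norm_indicatorConstLp (by norm_num) (by norm_num), norm_one, one_mul, Measure.real,
    Measure.restrict_apply measurableSet_Ioo, inter_eq_left.2 hsub, Real.volume_Ioo,
    ENNReal.toReal_ofReal (sub_nonneg.2 hxy'), abs_of_nonneg (sub_nonneg.2 hxy'),
    Real.sqrt_eq_rpow]
  simp

theorem H1.rep_eq_add_integral (f : H1 𝕜) (x : unitInterval) :
    H1.rep f x = H1.rep f 0 + ∫ t in (0 : ℝ)..x, H1.dx f t := by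
  obtain ⟨c, hc⟩ := H1.exists_primitive f
  have hcont := (absCont_primitive c (L2.intervalIntegrable (H1.dx f))).continuousOn
  rw [uIcc_of_le zero_le_one] at hcont
  have h : H1.rep f = ⟨_, continuousOn_iff_continuous_domRestrict.1 hcont⟩ := by
    apply H1.rep_unique
    filter_upwards [hc, ae_restrict_mem measurableSet_Ioo] with x hx hxI
    rw [hx, IccExtend_of_mem _ _ (Ioo_subset_Icc_self hxI)]
    rfl
  have h1 : ∀ x : unitInterval, H1.rep f x = c + ∫ t in (0 : ℝ)..x, H1.dx f t := by
    intro x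
    rw [h]
    rfl
  have h0 := h1 0
  simp only [Icc.coe_zero, intervalIntegral.integral_same, add_zero] at h0
  rw [h1, h0]

theorem H1.rep_sub_rep (f : H1 𝕜) (x y : unitInterval) :
    H1.rep f y - H1.rep f x = ∫ t in (x : ℝ)..y, H1.dx f t := by
  rw [H1.rep_eq_add_integral f x, H1.rep_eq_add_integral f y, add_sub_add_left_eq_sub,
    intervalIntegral.integral_interval_sub_left]
  · exact L2.intervalIntegrable_sub (H1.dx f) 0 y
  · exact L2.intervalIntegrable_sub (H1.dx f) 0 x

/-- `H¹` functions are Hölder continuous with exponent `1/2`. -/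
theorem H1.norm_rep_sub_le (f : H1 𝕜) (x y : unitInterval) :
    ‖H1.rep f y - H1.rep f x‖ ≤ √|(y : ℝ) - x| * ‖H1.dx f‖ := by
  rw [H1.rep_sub_rep]
  exact L2.norm_integral_le _ x y

theorem H1.norm_rep_apply_le (f : H1 𝕜) (x : unitInterval) :
    ‖H1.rep f x‖ ≤ ‖H1.rep f 0‖ + ‖H1.dx f‖ := by
  have h1 := H1.norm_rep_sub_le f 0 x
  have h2 : √|(x : ℝ) - (0 : unitInterval)| ≤ 1 := by
    rw [Real.sqrt_le_one, Icc.coe_zero, sub_zero, abs_of_nonneg x.2.1]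
    exact x.2.2
  have h3 := norm_le_norm_add_norm_sub (H1.rep f 0) (H1.rep f x)
  rw [norm_sub_rev] at h3
  have h4 := mul_le_of_le_one_left (norm_nonneg (H1.dx f)) h2
  linarith

theorem H1.fn_ae (f : H1 𝕜) :
    ∀ᵐ x ∂vol01, ∃ hx : x ∈ unitInterval, (H1.fn f : ℝ → 𝕜) x = H1.rep f ⟨x, hx⟩ := by
  filter_upwards [H1.rep_ae f, ae_restrict_mem measurableSet_Ioo] with x hx hxI
  refine ⟨Ioo_subset_Icc_self hxI, ?_⟩
  rw [← hx, IccExtend_of_mem]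

theorem L2.norm_le_of_bound {f : L2 𝕜} {C : ℝ} (hC : 0 ≤ C)
    (h : ∀ᵐ x ∂vol01, ‖(f : ℝ → 𝕜) x‖ ≤ C) : ‖f‖ ≤ C := by
  have := Lp.norm_le_of_ae_bound hC h
  simpa [measureUnivNNReal] using this

theorem H1.norm_fn_le_of_rep {f : H1 𝕜} {C : ℝ} (hC : 0 ≤ C) (h : ∀ x, ‖H1.rep f x‖ ≤ C) :
    ‖H1.fn f‖ ≤ C := by
  apply L2.norm_le_of_bound hC
  filter_upwards [H1.fn_ae f] with x hx
  obtain ⟨hx, e⟩ := hx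
  rw [e]
  exact h _

theorem H1.norm_fn_le (f : H1 𝕜) : ‖H1.fn f‖ ≤ ‖H1.rep f 0‖ + ‖H1.dx f‖ :=
  H1.norm_fn_le_of_rep (by positivity) (H1.norm_rep_apply_le f)

theorem H1.norm_sq_eq (f : H1 𝕜) : ‖f‖ ^ 2 = ‖H1.fn f‖ ^ 2 + ‖H1.dx f‖ ^ 2 :=
  WithLp.prod_norm_sq_eq_of_L2 f.1

theorem H1.norm_fn_le_norm (f : H1 𝕜) : ‖H1.fn f‖ ≤ ‖f‖ := by
  refine le_of_sq_le_sq ?_ (norm_nonneg _)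
  rw [H1.norm_sq_eq]
  linarith [sq_nonneg ‖H1.dx f‖]

theorem H1.norm_dx_le_norm (f : H1 𝕜) : ‖H1.dx f‖ ≤ ‖f‖ := by
  refine le_of_sq_le_sq ?_ (norm_nonneg _)
  rw [H1.norm_sq_eq]
  linarith [sq_nonneg ‖H1.fn f‖]

theorem H1.norm_le_add (f : H1 𝕜) : ‖f‖ ≤ ‖H1.fn f‖ + ‖H1.dx f‖ := by
  refine le_of_sq_le_sq ?_ (by positivity)
  rw [H1.norm_sq_eq]
  nlinarith [norm_nonneg (H1.fn f), norm_nonneg (H1.dx f)]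

theorem H1.ext_rep {f g : H1 𝕜} (h : ∀ x, H1.rep f x = H1.rep g x) : f = g := by
  apply H1.fn_injective
  apply Lp.ext
  refine (H1.rep_ae f).symm.trans ?_
  rw [ContinuousMap.ext h]
  exact H1.rep_ae g

theorem H1.exists_of_primitive (c : 𝕜) (w : L2 𝕜) : ∃ f : H1 𝕜, H1.rep f 0 = c ∧ H1.dx f = w := by
  have hcont := (absCont_primitive c (L2.intervalIntegrable w)).continuousOn
  rw [uIcc_of_le zero_le_one] at hcont
  have hmem : MemLp (fun x => c + ∫ t in (0 : ℝ)..x, w t) 2 vol01 := by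
    obtain ⟨C, hC⟩ := isCompact_Icc.exists_bound_of_continuousOn hcont
    refine MemLp.of_bound ((hcont.mono Ioo_subset_Icc_self).aestronglyMeasurable
      measurableSet_Ioo) C ?_
    filter_upwards [ae_restrict_mem measurableSet_Ioo] with x hx
    exact hC x (Ioo_subset_Icc_self hx)
  have hwd : IsWeakDeriv (hmem.toLp _ : ℝ → 𝕜) (w : ℝ → 𝕜) := by
    rw [isWeakDeriv_iff (L2.integrable _) (L2.integrable _)]
    exact ⟨c, hmem.coeFn_toLp⟩
  refine ⟨⟨WithLp.toLp 2 (hmem.toLp _, w), hwd⟩, ?_, rfl⟩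
  have h : H1.rep ⟨WithLp.toLp 2 (hmem.toLp _, w), hwd⟩
      = ⟨_, continuousOn_iff_continuous_domRestrict.1 hcont⟩ := by
    apply H1.rep_unique
    change _ =ᵐ[vol01] (hmem.toLp _ : ℝ → 𝕜)
    filter_upwards [hmem.coeFn_toLp, ae_restrict_mem measurableSet_Ioo] with x hx hxI
    rw [hx, IccExtend_of_mem _ _ (Ioo_subset_Icc_self hxI)]
    rfl
  rw [h]
  simp

/-- `H¹(0,1) ≃ 𝕜 × L²(0,1)`, by `f ↦ (f(0), f')`. -/
def H1.coords : H1 𝕜 ≃L[𝕜] 𝕜 × L2 𝕜 :=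
  let f : H1 𝕜 →ₗ[𝕜] 𝕜 × L2 𝕜 :=
    { toFun := fun f => (H1.rep f 0, H1.dx f)
      map_add' := fun f g => by rw [H1.rep_add, map_add]; rfl
      map_smul' := fun c f => by rw [H1.rep_smul, map_smul]; rfl }
  have hf : Function.Bijective f := by
    constructor
    · intro g h hgh
      have h1 : H1.rep g 0 = H1.rep h 0 := congrArg Prod.fst hgh
      have h2 : H1.dx g = H1.dx h := congrArg (fun p : 𝕜 × L2 𝕜 => p.2) hgh
      apply H1.ext_rep
      intro x
      rw [H1.rep_eq_add_integral g, H1.rep_eq_add_integral h, h1, h2]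
    · rintro ⟨c, w⟩
      obtain ⟨g, h1, h2⟩ := H1.exists_of_primitive c w
      exact ⟨g, Prod.ext h1 h2⟩
  let e := LinearEquiv.ofBijective f hf
  have he : Continuous e.symm := by
    refine (e.symm.toLinearMap.mkContinuous 3 fun p => ?_).continuous
    obtain ⟨g, rfl⟩ := e.surjective p
    change ‖e.symm (e g)‖ ≤ _
    rw [e.symm_apply_apply]
    have h1 : ‖H1.rep g 0‖ ≤ ‖e g‖ := norm_fst_le (e g)
    have h2 : ‖H1.dx g‖ ≤ ‖e g‖ := norm_snd_le (e g)
    linarith [H1.norm_le_add g, H1.norm_fn_le g]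
  (e.symm.toContinuousLinearEquivOfContinuous he).symm

/-- The `H¹` function `x ↦ c + ∫₀ˣ w`. -/
def H1.prim (c : 𝕜) (w : L2 𝕜) : H1 𝕜 := H1.coords.symm (c, w)

theorem H1.rep_prim_zero (c : 𝕜) (w : L2 𝕜) : H1.rep (H1.prim c w) 0 = c :=
  congrArg Prod.fst (H1.coords.apply_symm_apply (c, w))

theorem H1.dx_prim (c : 𝕜) (w : L2 𝕜) : H1.dx (H1.prim c w) = w :=
  congrArg Prod.snd (H1.coords.apply_symm_apply (c, w))

theorem H1.rep_prim (c : 𝕜) (w : L2 𝕜) (x : unitInterval) :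
    H1.rep (H1.prim c w) x = c + ∫ t in (0 : ℝ)..x, w t := by
  rw [H1.rep_eq_add_integral, H1.rep_prim_zero, H1.dx_prim]

/-- `H1.fn` as a bounded operator. -/
def H1.fnL : H1 𝕜 →L[𝕜] L2 𝕜 := H1.fn.mkContinuous 1 fun f => by
  rw [one_mul]
  exact H1.norm_fn_le_norm f

/-- `H1.dx` as a bounded operator. -/
def H1.dxL : H1 𝕜 →L[𝕜] L2 𝕜 := H1.dx.mkContinuous 1 fun f => by
  rw [one_mul]
  exact H1.norm_dx_le_norm f

/-- The continuous representative, as a bounded operator. -/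
def H1.repL : H1 𝕜 →L[𝕜] C(unitInterval, 𝕜) :=
  let f : H1 𝕜 →ₗ[𝕜] C(unitInterval, 𝕜) :=
    { toFun := H1.rep
      map_add' := H1.rep_add
      map_smul' := H1.rep_smul }
  f.mkContinuous (2 * ‖(H1.coords : H1 𝕜 ≃L[𝕜] 𝕜 × L2 𝕜).toContinuousLinearMap‖) fun g => by
    rw [ContinuousMap.norm_le _ (by positivity)]
    intro x
    have h1 : ‖H1.rep g 0‖ ≤ ‖H1.coords g‖ := norm_fst_le (H1.coords g)
    have h2 : ‖H1.dx g‖ ≤ ‖H1.coords g‖ := norm_snd_le (H1.coords g)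
    have h3 := (H1.coords (𝕜 := 𝕜)).toContinuousLinearMap.le_opNorm g
    change ‖H1.coords g‖ ≤ _ at h3
    change ‖H1.rep g x‖ ≤ _
    linarith [H1.norm_rep_apply_le g x]

/-- Evaluation at a point, as a bounded functional. -/
def H1.evalL (x : unitInterval) : H1 𝕜 →L[𝕜] 𝕜 := (ContinuousMap.evalCLM 𝕜 x).comp H1.repL

theorem H1.evalL_apply (x : unitInterval) (f : H1 𝕜) : H1.evalL x f = H1.rep f x := rfl

/-- A function which is recovered by integrating `k` has the weak derivative `k`. -/
theorem H1.dx_ae_eq {f : H1 𝕜} {k : ℝ → 𝕜} (hk : MemLp k 2 vol01)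
    (h : ∀ x : unitInterval, H1.rep f x = H1.rep f 0 + ∫ t in (0 : ℝ)..x, k t) :
    (H1.dx f : ℝ → 𝕜) =ᵐ[vol01] k := by
  have e : f = H1.prim (H1.rep f 0) (hk.toLp k) := by
    apply H1.ext_rep
    intro x
    rw [H1.rep_prim, h x]
    congr 1
    apply intervalIntegral.integral_congr_ae
    have h4 := (ae_restrict_iff' measurableSet_Ioo).1 hk.coeFn_toLp
    -- the endpoint `1` is a null set
    have h5 : ∀ᵐ t : ℝ, t ≠ 1 := Measure.ae_ne volume 1
    filter_upwards [h4, h5] with t ht ht1 htx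
    rw [uIoc_of_le x.2.1] at htx
    exact (ht ⟨htx.1, lt_of_le_of_ne (htx.2.trans x.2.2) ht1⟩).symm
  rw [e, H1.dx_prim]
  exact hk.coeFn_toLp

/-- Product rule for primitives of functions with values in the scalar field. -/
theorem primitive_mul {v w : ℝ → 𝕜} (b c : 𝕜)
    (hv : IntervalIntegrable v volume 0 1) (hw : IntervalIntegrable w volume 0 1) :
    (b + ∫ t in (0 : ℝ)..1, v t) * (c + ∫ t in (0 : ℝ)..1, w t)
      = b * c + ∫ t in (0 : ℝ)..1, (v t * (c + ∫ s in (0 : ℝ)..t, w s)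
        + (b + ∫ s in (0 : ℝ)..t, v s) * w t) := by
  have aw := absCont_primitive c hw
  have av := absCont_primitive b hv
  have hint : IntervalIntegrable (fun t => v t * (c + ∫ s in (0 : ℝ)..t, w s)
        + (b + ∫ s in (0 : ℝ)..t, v s) * w t) volume 0 1 :=
    (hv.smul_continuousOn aw.continuousOn).add (hw.continuousOn_smul av.continuousOn)
  have aP := absCont_primitive (b * c) hint
  have aS := (av.smul aw).sub aP
  have hd : ∀ᵐ x, x ∈ uIcc (0 : ℝ) 1 → HasDerivAt
      ((fun x => b + ∫ t in (0 : ℝ)..x, v t) • (fun x => c + ∫ t in (0 : ℝ)..x, w t)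
        - fun x => b * c + ∫ t in (0 : ℝ)..x, (v t * (c + ∫ s in (0 : ℝ)..t, w s)
        + (b + ∫ s in (0 : ℝ)..t, v s) * w t)) 0 x := by
    filter_upwards [hasDerivAt_primitive c hw, hasDerivAt_primitive b hv,
      hasDerivAt_primitive (b * c) hint] with x h1 h2 h3 hx
    have := ((h2 hx).mul (h1 hx)).sub (h3 hx)
    rw [sub_self] at this
    exact this
  obtain ⟨C, hC⟩ := aS.const_of_ae_hasDerivAt_zero hd
  have h0 := hC 0 (by simp)
  have hx' := hC 1 (by simp)
  simp only [Pi.sub_apply, Pi.mul_apply, intervalIntegral.integral_same, add_zero,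
    sub_self, smul_eq_mul] at h0 hx'
  rw [← h0] at hx'
  exact sub_eq_zero.mp hx'

/-- Integration by parts. -/
theorem H1.inner_dx_add_inner_fn (f g : H1 𝕜) :
    inner 𝕜 (H1.dx f) (H1.fn g) + inner 𝕜 (H1.fn f) (H1.dx g)
      = inner 𝕜 (H1.rep f 1) (H1.rep g 1) - inner 𝕜 (H1.rep f 0) (H1.rep g 0) := by
  have hf := L2.intervalIntegrable (H1.dx f)
  have hg := L2.intervalIntegrable (H1.dx g)
  have hf' : IntervalIntegrable (fun t => starRingEnd 𝕜 (H1.dx f t)) volume 0 1 :=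
    ⟨(RCLike.conjCLE (K := 𝕜)).toContinuousLinearMap.integrable_comp hf.1,
      (RCLike.conjCLE (K := 𝕜)).toContinuousLinearMap.integrable_comp hf.2⟩
  have hconj : ∀ x : unitInterval, starRingEnd 𝕜 (H1.rep f x)
      = starRingEnd 𝕜 (H1.rep f 0) + ∫ t in (0 : ℝ)..x, starRingEnd 𝕜 (H1.dx f t) := by
    intro x
    rw [H1.rep_eq_add_integral f x, map_add]
    congr 1
    exact ((RCLike.conjCLE (K := 𝕜)).toContinuousLinearMap.intervalIntegral_comp_comm
      (L2.intervalIntegrable_sub (H1.dx f) 0 x)).symm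
  have key := primitive_mul (starRingEnd 𝕜 (H1.rep f 0)) (H1.rep g 0) hf' hg
  have e1 := hconj 1
  have e2 := H1.rep_eq_add_integral g 1
  simp only [Icc.coe_one] at e1 e2
  rw [← e1, ← e2] at key
  have h1 : inner 𝕜 (H1.dx f) (H1.fn g) + inner 𝕜 (H1.fn f) (H1.dx g)
      = ∫ t in (0 : ℝ)..1, (starRingEnd 𝕜 (H1.dx f t) * (H1.rep g 0 + ∫ s in (0 : ℝ)..t, H1.dx g s)
        + (starRingEnd 𝕜 (H1.rep f 0) + ∫ s in (0 : ℝ)..t, starRingEnd 𝕜 (H1.dx f s))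
          * H1.dx g t) := by
    rw [← integral_vol01, L2.inner_def, L2.inner_def, ← integral_add (L2.integrable_inner _ _)
      (L2.integrable_inner _ _)]
    apply integral_congr_ae
    filter_upwards [H1.fn_ae f, H1.fn_ae g] with t ⟨ht, e3⟩ ⟨_, e4⟩
    have e5 := hconj ⟨t, ht⟩
    have e6 := H1.rep_eq_add_integral g ⟨t, ht⟩
    simp only at e5 e6
    rw [RCLike.inner_apply, RCLike.inner_apply, e3, e4, ← e5, ← e6]
    ring
  rw [h1, RCLike.inner_apply, RCLike.inner_apply, eq_sub_iff_add_eq, mul_comm (H1.rep g 1), key]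
  ring

end Sobolev

/-! ### Multiplication by Sobolev functions -/

section Multiplication

variable {𝕜 : Type} [RCLike 𝕜]

theorem H1.norm_fn_smul_le (a : H1 ℝ) (f : L2 𝕜) :
    ∀ᵐ x ∂vol01, ‖H1.fn a x • f x‖ ≤ ‖H1.rep a‖ * ‖f x‖ := by
  filter_upwards [H1.fn_ae a] with x ⟨hx, e⟩
  rw [norm_smul, e]
  exact mul_le_mul_of_nonneg_right ((H1.rep a).norm_coe_le_norm _) (norm_nonneg _)

theorem H1.memLp_fn_smul (a : H1 ℝ) (f : L2 𝕜) : MemLp (fun x => H1.fn a x • f x) 2 vol01 :=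
  (Lp.memLp f).of_le_mul ((Lp.aestronglyMeasurable (H1.fn a)).smul (Lp.aestronglyMeasurable f))
    (H1.norm_fn_smul_le a f)

/-- Multiplication by a real `H¹` function, as a bounded operator of `L²`. -/
def mulL (a : H1 ℝ) : L2 𝕜 →L[𝕜] L2 𝕜 :=
  let T : L2 𝕜 →ₗ[𝕜] L2 𝕜 :=
    { toFun := fun f => (H1.memLp_fn_smul a f).toLp _
      map_add' := fun f g => by
        apply Lp.ext
        filter_upwards [(H1.memLp_fn_smul a (f + g)).coeFn_toLp, (H1.memLp_fn_smul a f).coeFn_toLp,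
          (H1.memLp_fn_smul a g).coeFn_toLp, Lp.coeFn_add f g,
          Lp.coeFn_add ((H1.memLp_fn_smul a f).toLp _) ((H1.memLp_fn_smul a g).toLp _)]
          with x h1 h2 h3 h4 h5
        rw [h1, h5, Pi.add_apply, h2, h3, h4, Pi.add_apply, smul_add]
      map_smul' := fun c f => by
        apply Lp.ext
        filter_upwards [(H1.memLp_fn_smul a (c • f)).coeFn_toLp, (H1.memLp_fn_smul a f).coeFn_toLp,
          Lp.coeFn_smul c f, Lp.coeFn_smul c ((H1.memLp_fn_smul a f).toLp _)] with x h1 h2 h3 h4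
        rw [h1, RingHom.id_apply, h4, Pi.smul_apply, h2, h3, Pi.smul_apply, smul_comm] }
  T.mkContinuous ‖H1.rep a‖ fun f => by
    apply Lp.norm_le_mul_norm_of_ae_le_mul
    filter_upwards [(H1.memLp_fn_smul a f).coeFn_toLp, H1.norm_fn_smul_le a f] with x h1 h2
    change ‖((H1.memLp_fn_smul a f).toLp _ : ℝ → 𝕜) x‖ ≤ _
    rwa [h1]

theorem mulL_ae (a : H1 ℝ) (f : L2 𝕜) :
    (mulL a f : ℝ → 𝕜) =ᵐ[vol01] fun x => H1.fn a x • f x :=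
  (H1.memLp_fn_smul a f).coeFn_toLp

theorem H1.fn_mul (a : H1 ℝ) (f : H1 𝕜) : H1.fn (H1.mul a f) = mulL a (H1.fn f) :=
  Lp.ext ((H1.mul_ae a f).trans (mulL_ae a (H1.fn f)).symm)

theorem mulL_mulL_cancel {a b : H1 ℝ} (h : ∀ x, H1.rep a x * H1.rep b x = 1) (f : L2 𝕜) :
    mulL a (mulL b f) = f := by
  apply Lp.ext
  filter_upwards [mulL_ae a (mulL b f), mulL_ae b f, H1.fn_ae a, H1.fn_ae b]
    with x h1 h2 ⟨hx, h3⟩ ⟨_, h4⟩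
  rw [h1, h2, h3, h4, smul_smul, h, one_smul]

theorem le_re_inner_mulL {a : H1 ℝ} {a₀ : ℝ} (h : ∀ x, a₀ ≤ H1.rep a x) (f : L2 𝕜) :
    a₀ * ‖f‖ ^ 2 ≤ RCLike.re (inner 𝕜 f (mulL a f)) := by
  have h0 : ‖f‖ ^ 2 = ∫ x, ‖f x‖ ^ 2 ∂vol01 := by
    have h1 : RCLike.re (inner 𝕜 f f) = ∫ x, RCLike.re (inner 𝕜 (f x) (f x)) ∂vol01 := by
      rw [L2.inner_def]
      exact (integral_re (L2.integrable_inner f f)).symm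
    rw [inner_self_eq_norm_sq] at h1
    simpa only [inner_self_eq_norm_sq] using h1
  have h2 : RCLike.re (inner 𝕜 f (mulL a f))
      = ∫ x, RCLike.re (inner 𝕜 (f x) (mulL a f x)) ∂vol01 := by
    rw [L2.inner_def]
    exact (integral_re (L2.integrable_inner f _)).symm
  rw [h0, h2, ← integral_const_mul]
  refine integral_mono_ae ?_ (L2.integrable_inner f (mulL a f)).re ?_
  · refine Integrable.const_mul ?_ a₀
    simpa only [inner_self_eq_norm_sq] using (L2.integrable_inner (𝕜 := 𝕜) f f).re
  · filter_upwards [mulL_ae a f, H1.fn_ae a] with x h3 ⟨hx, h4⟩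
    rw [h3, h4, RCLike.real_smul_eq_coe_smul (K := 𝕜), inner_smul_right,
      RCLike.re_ofReal_mul, inner_self_eq_norm_sq]
    exact mul_le_mul_of_nonneg_right (h _) (sq_nonneg _)

theorem H1.rep_mul (a : H1 ℝ) (f : H1 𝕜) (x : unitInterval) :
    H1.rep (H1.mul a f) x = H1.rep a x • H1.rep f x := by
  have h : H1.rep (H1.mul a f) = ⟨fun x => H1.rep a x • H1.rep f x, by fun_prop⟩ := by
    apply H1.rep_unique
    filter_upwards [H1.mul_ae a f, H1.rep_ae a, H1.rep_ae f] with x h1 h2 h3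
    rw [h1, ← h2, ← h3]
    rfl
  rw [h]
  rfl

/-- Product rule. -/
theorem H1.dx_mul (a : H1 ℝ) (f : H1 𝕜) : (H1.dx (H1.mul a f) : ℝ → 𝕜) =ᵐ[vol01]
    fun x => H1.dx a x • H1.fn f x + H1.fn a x • H1.dx f x := by
  have hbound : ∀ᵐ x ∂vol01, ‖H1.dx a x • H1.fn f x‖ ≤ ‖H1.rep f‖ * ‖H1.dx a x‖ := by
    filter_upwards [H1.fn_ae f] with x ⟨hx, e⟩
    rw [norm_smul, e, mul_comm]
    exact mul_le_mul_of_nonneg_right ((H1.rep f).norm_coe_le_norm _) (norm_nonneg _)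
  have hmem : MemLp (fun x => H1.dx a x • H1.fn f x + H1.fn a x • H1.dx f x) 2 vol01 :=
    ((Lp.memLp (H1.dx a)).of_le_mul ((Lp.aestronglyMeasurable (H1.dx a)).smul
      (Lp.aestronglyMeasurable (H1.fn f))) hbound).add (H1.memLp_fn_smul a (H1.dx f))
  apply H1.dx_ae_eq hmem
  intro x
  have key := (primitive_smul (H1.rep a 0) (H1.rep f 0) (L2.intervalIntegrable (H1.dx a))
    (L2.intervalIntegrable (H1.dx f))).2 x (by simp)
  rw [← H1.rep_eq_add_integral, ← H1.rep_eq_add_integral] at key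
  rw [H1.rep_mul, H1.rep_mul, key]
  congr 1
  apply intervalIntegral.integral_congr_ae
  have h1 := (ae_restrict_iff' measurableSet_Ioo).1 (H1.fn_ae a)
  have h2 := (ae_restrict_iff' measurableSet_Ioo).1 (H1.fn_ae f)
  filter_upwards [h1, h2, Measure.ae_ne volume 1] with t h1 h2 ht1 htx
  rw [uIoc_of_le x.2.1] at htx
  have ht : t ∈ Ioo (0 : ℝ) 1 := ⟨htx.1, lt_of_le_of_ne (htx.2.trans x.2.2) ht1⟩
  obtain ⟨ht', e1⟩ := h1 ht
  obtain ⟨_, e2⟩ := h2 ht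
  rw [e1, e2, H1.rep_eq_add_integral a ⟨t, ht'⟩, H1.rep_eq_add_integral f ⟨t, ht'⟩]

/-- The reciprocal of an `H¹` function which is bounded below is an `H¹` function. -/
theorem H1.exists_inv {a : H1 ℝ} {a₀ : ℝ} (ha₀ : 0 < a₀) (h : ∀ x, a₀ ≤ H1.rep a x) :
    ∃ b : H1 ℝ, ∀ x, H1.rep a x * H1.rep b x = 1 := by
  let F : ℝ → ℝ := fun x => H1.rep a 0 + ∫ t in (0 : ℝ)..x, H1.dx a t
  have hF : ∀ x : unitInterval, F x = H1.rep a x := fun x => (H1.rep_eq_add_integral a x).symm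
  have hFle : ∀ x ∈ uIcc (0 : ℝ) 1, a₀ ≤ F x := by
    intro x hx
    rw [uIcc_of_le zero_le_one] at hx
    have := hF ⟨x, hx⟩
    simp only at this
    rw [this]
    exact h _
  have hFac : AbsolutelyContinuousOnInterval F 0 1 :=
    absCont_primitive _ (L2.intervalIntegrable (H1.dx a))
  have hFd := hasDerivAt_primitive (H1.rep a 0) (L2.intervalIntegrable (H1.dx a))
  -- `1 / F` is absolutely continuous, since `s ↦ 1 / s` is Lipschitz on `[a₀, ∞)`
  have hGac : AbsolutelyContinuousOnInterval (fun x => (F x)⁻¹) 0 1 := by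
    rw [absolutelyContinuousOnInterval_iff] at hFac ⊢
    intro ε hε
    obtain ⟨δ, hδ, H⟩ := hFac (ε * a₀ ^ 2) (by positivity)
    refine ⟨δ, hδ, fun E hE hlt => ?_⟩
    have h1 := H E hE hlt
    have h2 : ∀ i ∈ Finset.range E.1, dist (F (E.2 i).1)⁻¹ (F (E.2 i).2)⁻¹
        ≤ (a₀ ^ 2)⁻¹ * dist (F (E.2 i).1) (F (E.2 i).2) := by
      intro i hi
      have hm := hE.1 i hi
      have p1 := hFle _ hm.1
      have p2 := hFle _ hm.2
      have q1 : 0 < F (E.2 i).1 := ha₀.trans_le p1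
      have q2 : 0 < F (E.2 i).2 := ha₀.trans_le p2
      rw [Real.dist_eq, Real.dist_eq, inv_sub_inv q1.ne' q2.ne', abs_div,
        abs_of_pos (mul_pos q1 q2), abs_sub_comm, div_eq_inv_mul]
      refine mul_le_mul_of_nonneg_right ?_ (abs_nonneg _)
      rw [inv_le_inv₀ (mul_pos q1 q2) (by positivity), sq]
      exact mul_le_mul p1 p2 ha₀.le q1.le
    refine (Finset.sum_le_sum h2).trans_lt ?_
    rw [← Finset.mul_sum, inv_mul_lt_iff₀ (by positivity), mul_comm]
    exact h1
  have hmem : MemLp (fun x => -H1.dx a x / F x ^ 2) 2 vol01 := by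
    refine (Lp.memLp (H1.dx a)).of_le_mul (c := (a₀ ^ 2)⁻¹) ?_ ?_
    · have hc : ContinuousOn (fun x => (F x ^ 2)⁻¹) (uIcc 0 1) :=
        (hFac.continuousOn.pow 2).inv₀ fun x hx =>
          (pow_pos (ha₀.trans_le (hFle x hx)) 2).ne'
      rw [uIcc_of_le zero_le_one] at hc
      simp only [div_eq_mul_inv]
      exact (Lp.aestronglyMeasurable (H1.dx a)).neg.mul
        ((hc.mono Ioo_subset_Icc_self).aestronglyMeasurable measurableSet_Ioo)
    · filter_upwards [ae_restrict_mem measurableSet_Ioo] with x hx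
      have hx' : x ∈ uIcc (0 : ℝ) 1 := by
        rw [uIcc_of_le zero_le_one]
        exact Ioo_subset_Icc_self hx
      have p1 := hFle x hx'
      have p2 : a₀ ^ 2 ≤ F x ^ 2 := pow_le_pow_left₀ ha₀.le p1 2
      rw [norm_div, norm_neg, norm_pow, Real.norm_of_nonneg (ha₀.le.trans p1),
        div_eq_inv_mul]
      exact mul_le_mul_of_nonneg_right ((inv_le_inv₀ (by
        exact pow_pos (ha₀.trans_le p1) 2) (by positivity)).2 p2) (norm_nonneg _)
  have hint : IntervalIntegrable (fun x => -H1.dx a x / F x ^ 2) volume 0 1 :=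
    intervalIntegrable_of_vol01 (hmem.integrable (by norm_num))
  have aP := absCont_primitive (0 : ℝ) hint
  obtain ⟨C, hC⟩ := (hGac.sub aP).const_of_ae_hasDerivAt_zero (by
    filter_upwards [hFd, hasDerivAt_primitive (0 : ℝ) hint] with x h1 h2 hx
    have h3 := ((h1 hx).fun_inv (ha₀.trans_le (hFle x hx)).ne').sub (h2 hx)
    rw [sub_self] at h3
    exact h3)
  refine ⟨H1.prim C (hmem.toLp _), fun x => ?_⟩
  have hx : (x : ℝ) ∈ uIcc (0 : ℝ) 1 := by simp
  have h1 := hC x hx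
  have e : ∫ t in (0 : ℝ)..x, (hmem.toLp _ : ℝ → ℝ) t
      = ∫ t in (0 : ℝ)..x, -H1.dx a t / F t ^ 2 := by
    apply intervalIntegral.integral_congr_ae
    have h4 := (ae_restrict_iff' measurableSet_Ioo).1 hmem.coeFn_toLp
    filter_upwards [h4, Measure.ae_ne volume 1] with t ht ht1 htx
    rw [uIoc_of_le x.2.1] at htx
    exact ht ⟨htx.1, lt_of_le_of_ne (htx.2.trans x.2.2) ht1⟩
  rw [H1.rep_prim, e, ← h1, ← hF]
  simp only [Pi.sub_apply, zero_add, sub_add_cancel]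
  exact mul_inv_cancel₀ (ha₀.trans_le (hFle x hx)).ne'

theorem H1.exists_exp (κ : ℝ) : ∃ E : H1 ℝ, (∀ x, H1.rep E x = Real.exp (-(κ * x))) ∧
    H1.dx E = -(κ • H1.fn E) := by
  have hcont : Continuous fun x : ℝ => -κ * Real.exp (-(κ * x)) := by fun_prop
  have hmem : MemLp (fun x : ℝ => -κ * Real.exp (-(κ * x))) 2 vol01 := by
    obtain ⟨C, hC⟩ := isCompact_Icc.exists_bound_of_continuousOn
      (hcont.continuousOn (s := Icc (0 : ℝ) 1))
    refine MemLp.of_bound hcont.aestronglyMeasurable C ?_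
    filter_upwards [ae_restrict_mem measurableSet_Ioo] with x hx
    exact hC x (Ioo_subset_Icc_self hx)
  have hrep : ∀ x, H1.rep (H1.prim 1 (hmem.toLp _)) x = Real.exp (-(κ * x)) := by
    intro x
    have e : ∫ t in (0 : ℝ)..x, (hmem.toLp _ : ℝ → ℝ) t
        = ∫ t in (0 : ℝ)..x, -κ * Real.exp (-(κ * t)) := by
      apply intervalIntegral.integral_congr_ae
      have h4 := (ae_restrict_iff' measurableSet_Ioo).1 hmem.coeFn_toLp
      filter_upwards [h4, Measure.ae_ne volume 1] with t ht ht1 htx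
      rw [uIoc_of_le x.2.1] at htx
      exact ht ⟨htx.1, lt_of_le_of_ne (htx.2.trans x.2.2) ht1⟩
    have hd : ∀ t ∈ uIcc (0 : ℝ) x,
        HasDerivAt (fun t => Real.exp (-(κ * t))) (-κ * Real.exp (-(κ * t))) t := by
      intro t _
      have h1 : HasDerivAt (fun t : ℝ => -(κ * t)) (-κ) t := by
        simpa using ((hasDerivAt_id' t).const_mul κ).fun_neg
      rw [mul_comm]
      exact h1.exp
    rw [H1.rep_prim, e, intervalIntegral.integral_eq_sub_of_hasDerivAt hd
      (hcont.intervalIntegrable _ _)]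
    simp
  refine ⟨_, hrep, ?_⟩
  rw [H1.dx_prim]
  apply Lp.ext
  filter_upwards [hmem.coeFn_toLp, H1.fn_ae (H1.prim 1 (hmem.toLp _)),
    Lp.coeFn_neg (κ • H1.fn (H1.prim 1 (hmem.toLp _))),
    Lp.coeFn_smul κ (H1.fn (H1.prim 1 (hmem.toLp _)))] with x h1 ⟨hx, h2⟩ h3 h4
  rw [h1, h3, Pi.neg_apply, h4, Pi.smul_apply, h2, hrep, smul_eq_mul, neg_mul]

/-- The transport equation `u' + κ u = h`, `u(0) = ξ`, by variation of constants. -/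
theorem H1.exists_transport {κ : ℝ} (hκ : 0 ≤ κ) : ∃ r : ℝ, 0 ≤ r ∧ r ≤ 1 ∧
    ∀ h : L2 𝕜, ∃ h₁ : 𝕜, ∀ ξ : 𝕜, ∃ u : H1 𝕜, H1.rep u 0 = ξ ∧
      H1.rep u 1 = (r : 𝕜) * ξ + h₁ ∧ H1.dx u + (κ : 𝕜) • H1.fn u = h := by
  obtain ⟨E, hE, hE'⟩ := H1.exists_exp κ
  have hpos : ∀ x, Real.exp (-κ) ≤ H1.rep E x := by
    intro x
    rw [hE, Real.exp_le_exp, neg_le_neg_iff]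
    exact mul_le_of_le_one_right hκ x.2.2
  obtain ⟨E', hEE'⟩ := H1.exists_inv (Real.exp_pos _) hpos
  refine ⟨Real.exp (-κ), (Real.exp_pos _).le, ?_, fun h => ?_⟩
  · rw [Real.exp_le_one_iff]
    exact neg_nonpos.2 hκ
  refine ⟨(Real.exp (-κ) : 𝕜) * ∫ t in (0 : ℝ)..1, mulL E' h t, fun ξ => ?_⟩
  refine ⟨H1.mul E (H1.prim ξ (mulL E' h)), ?_, ?_, ?_⟩
  · rw [H1.rep_mul, H1.rep_prim_zero, hE]
    simp
  · rw [H1.rep_mul, H1.rep_prim, hE, RCLike.real_smul_eq_coe_mul]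
    simp only [Icc.coe_one, mul_one]
    ring
  · have h1 : mulL E (mulL E' h) = h := mulL_mulL_cancel hEE' h
    apply Lp.ext
    have e : (H1.dx E : ℝ → ℝ) =ᵐ[vol01] fun x => -(κ * H1.fn E x) := by
      rw [hE']
      filter_upwards [Lp.coeFn_neg (κ • H1.fn E), Lp.coeFn_smul κ (H1.fn E)] with x h3 h4
      rw [h3, Pi.neg_apply, h4, Pi.smul_apply, smul_eq_mul]
    set p := H1.prim ξ (mulL E' h) with hp
    have hdp : H1.dx p = mulL E' h := H1.dx_prim _ _
    have h2 := mulL_ae E (mulL E' h)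
    rw [h1] at h2
    have h3 := H1.dx_mul E p
    rw [hdp] at h3
    filter_upwards [h2, h3, e, H1.mul_ae E p, Lp.coeFn_add (H1.dx (H1.mul E p))
      ((κ : 𝕜) • H1.fn (H1.mul E p)), Lp.coeFn_smul (κ : 𝕜) (H1.fn (H1.mul E p))]
      with x h2 h3 h4 h5 h6 h7
    rw [h6, Pi.add_apply, h7, Pi.smul_apply, h5, h3, h4, ← h2]
    simp only [RCLike.real_smul_eq_coe_mul, smul_eq_mul]
    push_cast
    ring

end Multiplication

/-! ### Weak equations -/

section WeakEquation

variable {𝕜 : Type} [RCLike 𝕜]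

/-- Lax–Milgram: a coercive operator is onto. -/
theorem surjective_of_coercive {V : Type} [NormedAddCommGroup V] [InnerProductSpace 𝕜 V]
    [CompleteSpace V] (T : V →L[𝕜] V) {c : ℝ} (hc : 0 < c)
    (h : ∀ v, c * ‖v‖ ^ 2 ≤ RCLike.re (inner 𝕜 v (T v))) : Function.Surjective T := by
  have hu : IsUnit T := by
    refine ContinuousLinearMap.isUnit_of_forall_le_norm_inner_map T (c := ⟨c, hc.le⟩) hc ?_
    intro v
    rw [← inner_conj_symm, RCLike.norm_conj, mul_comm]
    exact (h v).trans (RCLike.re_le_norm _)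
  exact (ContinuousLinearMap.isUnit_iff_bijective.1 hu).2

/-- A weak solution of `q' = G` with boundary terms is a strong one: `q` is in `H¹`, and the
boundary terms are its boundary values. -/
theorem H1.exists_of_weak {q G : L2 𝕜} {p₀ p₁ : 𝕜}
    (h : ∀ φ : H1 𝕜, inner 𝕜 (H1.dx φ) q + inner 𝕜 (H1.fn φ) G
      + inner 𝕜 (H1.rep φ 0) p₀ + inner 𝕜 (H1.rep φ 1) p₁ = 0) :
    ∃ w : H1 𝕜, H1.fn w = q ∧ H1.dx w = G ∧ H1.rep w 0 = p₀ ∧ H1.rep w 1 = -p₁ := by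
  set w := H1.prim p₀ G with hw
  have hw0 : H1.rep w 0 = p₀ := H1.rep_prim_zero _ _
  have hwd : H1.dx w = G := H1.dx_prim _ _
  have key : ∀ φ : H1 𝕜, inner 𝕜 (H1.dx φ) (q - H1.fn w)
      + inner 𝕜 (H1.rep φ 1) (H1.rep w 1 + p₁) = 0 := by
    intro φ
    have h1 := h φ
    have h2 := H1.inner_dx_add_inner_fn φ w
    rw [hwd, hw0] at h2
    rw [inner_sub_right, inner_add_right]
    linear_combination h1 - h2
  have h1 : H1.rep w 1 + p₁ = 0 := by
    have := key (H1.prim 1 0)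
    have e : H1.rep (H1.prim (1 : 𝕜) 0) 1 = 1 := by
      have := H1.norm_rep_sub_le (H1.prim (1 : 𝕜) 0) 0 1
      rw [H1.dx_prim, norm_zero, mul_zero, norm_le_zero_iff, H1.rep_prim_zero, sub_eq_zero] at this
      exact this
    rw [H1.dx_prim, inner_zero_left, zero_add, e, RCLike.inner_apply,
      map_one (starRingEnd 𝕜), mul_one] at this
    exact this
  refine ⟨w, ?_, hwd, hw0, eq_neg_of_add_eq_zero_left h1⟩
  have := key (H1.prim 0 (q - H1.fn w))
  rw [H1.dx_prim, h1, inner_zero_right, add_zero, inner_self_eq_zero, sub_eq_zero] at this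
  exact this.symm

end WeakEquation

/-! ### Compact embeddings -/

section Compactness

variable {𝕜 : Type} [RCLike 𝕜]

/-- The embedding of `H¹(0,1)` into `C([0,1])` is compact, by the Arzelà–Ascoli theorem. -/
theorem H1.isCompactOperator_repL :
    IsCompactOperator (H1.repL : H1 𝕜 →L[𝕜] C(unitInterval, 𝕜)) := by
  let e := ContinuousMap.linearIsometryBoundedOfCompact unitInterval 𝕜 𝕜
  have hE : IsCompactOperator (e.toContinuousLinearEquiv.toContinuousLinearMap.comp
      (H1.repL : H1 𝕜 →L[𝕜] C(unitInterval, 𝕜))) := by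
    refine (isCompactOperator_iff_image_closedBall_subset_compact _ one_pos).2 ?_
    set A : Set (BoundedContinuousFunction unitInterval 𝕜) :=
      (e.toContinuousLinearEquiv.toContinuousLinearMap.comp H1.repL) '' Metric.closedBall 0 1
      with hA
    refine ⟨closure A, ?_, subset_closure⟩
    set C := ‖(H1.repL : H1 𝕜 →L[𝕜] C(unitInterval, 𝕜))‖
    refine BoundedContinuousFunction.arzela_ascoli (Metric.closedBall (0 : 𝕜) C)
      (isCompact_closedBall _ _) A ?_ ?_
    · rintro _ x ⟨f, hf, rfl⟩
      rw [mem_closedBall_zero_iff] at hf ⊢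
      have h1 : ‖H1.repL f x‖ ≤ ‖H1.repL f‖ := (H1.repL f).norm_coe_le_norm x
      have h2 : ‖H1.repL f‖ ≤ C * ‖f‖ := (H1.repL (𝕜 := 𝕜)).le_opNorm f
      exact h1.trans (h2.trans (mul_le_of_le_one_right (norm_nonneg (H1.repL (𝕜 := 𝕜))) hf))
    · refine Metric.equicontinuous_of_continuity_modulus (fun t => √|t|) ?_ _ ?_
      · have : Continuous fun t : ℝ => √|t| := by fun_prop
        simpa using this.tendsto 0
      · rintro x y ⟨_, f, hf, rfl⟩
        rw [mem_closedBall_zero_iff] at hf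
        have h1 := H1.norm_rep_sub_le f y x
        rw [dist_eq_norm]
        refine h1.trans ((mul_le_of_le_one_right (Real.sqrt_nonneg _)
          ((H1.norm_dx_le_norm f).trans hf)).trans (le_of_eq ?_))
        rw [Subtype.dist_eq, Real.dist_eq, abs_abs]
  have := hE.clm_comp e.symm.toContinuousLinearEquiv.toContinuousLinearMap
  convert! this using 1

theorem memLp_IccExtend (g : C(unitInterval, 𝕜)) :
    MemLp (IccExtend (zero_le_one' ℝ) g) 2 vol01 :=
  MemLp.of_bound g.continuous.Icc_extend'.aestronglyMeasurable ‖g‖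
    (ae_of_all _ fun _ => g.norm_coe_le_norm _)

/-- Continuous functions on `[0,1]` as elements of `L²(0,1)`. -/
def toL2 : C(unitInterval, 𝕜) →L[𝕜] L2 𝕜 :=
  let T : C(unitInterval, 𝕜) →ₗ[𝕜] L2 𝕜 :=
    { toFun := fun g => (memLp_IccExtend g).toLp _
      map_add' := fun f g => (memLp_IccExtend f).toLp_add (memLp_IccExtend g)
      map_smul' := fun c f => (memLp_IccExtend f).toLp_const_smul c }
  T.mkContinuous 1 fun g => by
    rw [one_mul]
    apply L2.norm_le_of_bound (norm_nonneg _)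
    filter_upwards [(memLp_IccExtend g).coeFn_toLp] with x hx
    change ‖((memLp_IccExtend g).toLp _ : ℝ → 𝕜) x‖ ≤ _
    rw [hx]
    exact g.norm_coe_le_norm _

theorem toL2_rep (f : H1 𝕜) : toL2 (H1.rep f) = H1.fn f :=
  Lp.ext ((memLp_IccExtend (H1.rep f)).coeFn_toLp.trans (H1.rep_ae f))

/-- The embedding of `H¹(0,1)` into `L²(0,1)` is compact. -/
theorem H1.isCompactOperator_fnL : IsCompactOperator (H1.fnL : H1 𝕜 →L[𝕜] L2 𝕜) := by
  have := (H1.isCompactOperator_repL (𝕜 := 𝕜)).clm_comp toL2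
  convert! this using 1
  ext1 f
  exact (toL2_rep f).symm

end Compactness

/-! ### The crane operator -/

section Operator

variable {𝕜 : Type} [RCLike 𝕜]

theorem H1.lift_fn (f : H1 𝕜) (h : H1.fn f ∈ H1InL2 𝕜) : H1.lift ⟨H1.fn f, h⟩ = f :=
  H1.fn_injective (H1.fn_lift ⟨H1.fn f, h⟩)

theorem fn_domYx (Φ : domain 𝕜) : H1.fn (domYx Φ) = H1.dx Φ.1.y := H1.fn_lift _

theorem fn_domZ (Φ : domain 𝕜) : H1.fn (domZ Φ) = Φ.1.z := H1.fn_lift _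

theorem fn_domU (Φ : domain 𝕜) : H1.fn (domU Φ) = Φ.1.u := H1.fn_lift _

theorem rep_domU_zero (Φ : domain 𝕜) : H1.rep (domU Φ) 0 = Φ.1.ξ := Φ.2.2.2.2.1.symm

theorem rep_domZ_zero (Φ : domain 𝕜) : H1.rep (domZ Φ) 0 = Φ.1.ξ := Φ.2.2.2.2.2.1.symm

theorem rep_domZ_one (Φ : domain 𝕜) : H1.rep (domZ Φ) 1 = Φ.1.η := Φ.2.2.2.2.2.2.symm

theorem fn_tension (P : Params) (Φ : domain 𝕜) :
    H1.fn (tension P Φ) = mulL P.a (H1.dx Φ.1.y) := by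
  rw [tension, H1.fn_mul, fn_domYx]

/-- The crane operator as a linear map on its domain. -/
def craneMap (P : Params) : domain 𝕜 →ₗ[𝕜] State 𝕜 := (craneOperator 𝕜 P).toFun

theorem craneMap_apply (P : Params) (Φ : domain 𝕜) :
    craneMap P Φ = (domZ Φ, H1.dx (tension P Φ) - (P.σ : 𝕜) • Φ.1.z,
      -((P.τ : 𝕜)⁻¹ • H1.dx (domU Φ)),
      (P.m : 𝕜)⁻¹ * (H1.rep (tension P Φ) 0 - (P.β : 𝕜) * Φ.1.ξ + (P.α : 𝕜) * H1.rep (domU Φ) 1),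
      -((P.M : 𝕜)⁻¹ * H1.rep (tension P Φ) 1)) := rfl

/-- States of the domain are built from a displacement with a given tension `w`, a velocity and a
delay variable that match at `0`. -/
theorem exists_domain {P : Params} {b : H1 ℝ} (hb : ∀ x, H1.rep P.a x * H1.rep b x = 1)
    {y z u w : H1 𝕜} (hw : H1.fn w = mulL P.a (H1.dx y)) (h0 : H1.rep z 0 = H1.rep u 0) :
    ∃ Φ : domain 𝕜, (Φ : State 𝕜) = (y, H1.fn z, H1.fn u, H1.rep u 0, H1.rep z 1) ∧
      domZ Φ = z ∧ domU Φ = u ∧ tension P Φ = w := by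
  have hy : H1.dx y = H1.fn (H1.mul b w) := by
    rw [H1.fn_mul, hw, mulL_mulL_cancel fun x => (mul_comm _ _).trans (hb x)]
  have hmem : ((y, H1.fn z, H1.fn u, H1.rep u 0, H1.rep z 1) : State 𝕜) ∈ domain 𝕜 := by
    refine ⟨⟨_, hy.symm⟩, ⟨z, rfl⟩, ⟨u, rfl⟩, ?_, ?_, ?_⟩
    · exact congrArg (fun f => H1.rep f 0) (H1.lift_fn u _).symm
    · exact h0.symm.trans (congrArg (fun f => H1.rep f 0) (H1.lift_fn z _).symm)
    · exact congrArg (fun f => H1.rep f 1) (H1.lift_fn z _).symm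
  refine ⟨⟨_, hmem⟩, rfl, H1.lift_fn _ _, H1.lift_fn _ _, ?_⟩
  apply H1.fn_injective
  rw [fn_tension, hw]

/-- The energy of the system (without the rank-one term), as a sesquilinear form. -/
def craneForm (P : Params) (K : ℝ) (Φ Ψ : State 𝕜) : 𝕜 :=
  inner 𝕜 (H1.dx Φ.y) (mulL P.a (H1.dx Ψ.y)) + inner 𝕜 Φ.z Ψ.z
    + ((K * P.τ : ℝ) : 𝕜) * inner 𝕜 Φ.u Ψ.u + (P.m : 𝕜) * inner 𝕜 Φ.ξ Ψ.ξ
    + (P.M : 𝕜) * inner 𝕜 Φ.η Ψ.η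

/-- The operator is dissipative for the energy form: after integration by parts there
remain `-σ ‖z‖²` and the quadratic form `-K/2 |u(1)|² + α Re(ξ̄ u(1)) + (K/2 - β) |ξ|²`, which is
nonpositive
for `α ≤ K ≤ 2β - α`. -/
theorem re_craneForm_craneMap_le {P : Params} (hm : 0 < P.m) (hM : 0 < P.M) (hα : 0 < P.α)
    (hτ : 0 < P.τ) (hσ : 0 < P.σ) {K : ℝ} (hK₁ : P.α ≤ K) (hK₂ : K ≤ 2 * P.β - P.α)
    (Φ : domain 𝕜) :
    RCLike.re (craneForm P K (craneMap P Φ) Φ) ≤ 0 := by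
  have hform : craneForm P K (craneMap P Φ) Φ =
      inner 𝕜 (H1.dx (domZ Φ)) (H1.fn (tension P Φ))
      + inner 𝕜 (H1.dx (tension P Φ) - (P.σ : 𝕜) • Φ.1.z) Φ.1.z
      + ((K * P.τ : ℝ) : 𝕜) * inner 𝕜 (-((P.τ : 𝕜)⁻¹ • H1.dx (domU Φ))) Φ.1.u
      + (P.m : 𝕜) * inner 𝕜 ((P.m : 𝕜)⁻¹ * (H1.rep (tension P Φ) 0 - (P.β : 𝕜) * Φ.1.ξ
        + (P.α : 𝕜) * H1.rep (domU Φ) 1)) Φ.1.ξ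
      + (P.M : 𝕜) * inner 𝕜 (-((P.M : 𝕜)⁻¹ * H1.rep (tension P Φ) 1)) Φ.1.η := by
    rw [fn_tension]
    rfl
  have hm' : (P.m : 𝕜) ≠ 0 := RCLike.ofReal_ne_zero.2 hm.ne'
  have hM' : (P.M : 𝕜) ≠ 0 := RCLike.ofReal_ne_zero.2 hM.ne'
  have hτ' : (P.τ : 𝕜) ≠ 0 := RCLike.ofReal_ne_zero.2 hτ.ne'
  set z := domZ Φ with hz
  set u := domU Φ with hu
  set w := tension P Φ with hw
  have ez : Φ.1.z = H1.fn z := (fn_domZ Φ).symm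
  have eu : Φ.1.u = H1.fn u := (fn_domU Φ).symm
  have eξ : Φ.1.ξ = H1.rep u 0 := (rep_domU_zero Φ).symm
  have eξ' : H1.rep z 0 = H1.rep u 0 := (rep_domZ_zero Φ).trans eξ
  have eη : Φ.1.η = H1.rep z 1 := (rep_domZ_one Φ).symm
  rw [ez, eu, eξ, eη] at hform
  have i1 := congrArg RCLike.re (H1.inner_dx_add_inner_fn z w)
  have i2 := congrArg RCLike.re (H1.inner_dx_add_inner_fn u u)
  rw [eξ'] at i1
  have s1 : RCLike.re (inner 𝕜 (H1.fn z) (H1.dx w)) = RCLike.re (inner 𝕜 (H1.dx w) (H1.fn z)) :=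
    inner_re_symm _ _
  have s2 : RCLike.re (inner 𝕜 (H1.fn u) (H1.dx u)) = RCLike.re (inner 𝕜 (H1.dx u) (H1.fn u)) :=
    inner_re_symm _ _
  have s3 : RCLike.re (inner 𝕜 (H1.rep u 0) (H1.rep w 0))
      = RCLike.re (inner 𝕜 (H1.rep w 0) (H1.rep u 0)) := inner_re_symm _ _
  have s4 : RCLike.re (inner 𝕜 (H1.rep z 1) (H1.rep w 1))
      = RCLike.re (inner 𝕜 (H1.rep w 1) (H1.rep z 1)) := inner_re_symm _ _
  have e3 : ((K * P.τ : ℝ) : 𝕜) * inner 𝕜 (-((P.τ : 𝕜)⁻¹ • H1.dx u)) (H1.fn u)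
      = -((K : 𝕜) * inner 𝕜 (H1.dx u) (H1.fn u)) := by
    rw [inner_neg_left, inner_smul_left, map_inv₀, RCLike.conj_ofReal]
    push_cast
    field_simp
  have e4 : (P.m : 𝕜) * inner 𝕜 ((P.m : 𝕜)⁻¹ * (H1.rep w 0 - (P.β : 𝕜) * H1.rep u 0
        + (P.α : 𝕜) * H1.rep u 1)) (H1.rep u 0)
      = inner 𝕜 (H1.rep w 0) (H1.rep u 0) - (P.β : 𝕜) * inner 𝕜 (H1.rep u 0) (H1.rep u 0)
        + (P.α : 𝕜) * inner 𝕜 (H1.rep u 1) (H1.rep u 0) := by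
    simp only [RCLike.inner_apply, map_mul, map_add, map_sub, map_inv₀, RCLike.conj_ofReal]
    field_simp
  have e5 : (P.M : 𝕜) * inner 𝕜 (-((P.M : 𝕜)⁻¹ * H1.rep w 1)) (H1.rep z 1)
      = -inner 𝕜 (H1.rep w 1) (H1.rep z 1) := by
    simp only [RCLike.inner_apply, map_mul, map_neg, map_inv₀, RCLike.conj_ofReal]
    field_simp
  rw [e3, e4, e5, inner_sub_left, inner_smul_left, RCLike.conj_ofReal] at hform
  rw [hform]
  simp only [map_add, map_sub, map_neg, RCLike.re_ofReal_mul, inner_self_eq_norm_sq]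
    at i1 i2 ⊢
  have hc : RCLike.re (inner 𝕜 (H1.rep u 1) (H1.rep u 0)) ≤ ‖H1.rep u 1‖ * ‖H1.rep u 0‖ :=
    re_inner_le_norm _ _
  have hσz : 0 ≤ P.σ * ‖H1.fn z‖ ^ 2 := by positivity
  have hq : P.α * (‖H1.rep u 1‖ * ‖H1.rep u 0‖)
      ≤ P.α / 2 * (‖H1.rep u 1‖ ^ 2 + ‖H1.rep u 0‖ ^ 2) := by
    nlinarith [mul_nonneg hα.le (sq_nonneg (‖H1.rep u 1‖ - ‖H1.rep u 0‖))]
  have hc' := mul_le_mul_of_nonneg_left hc hα.le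
  have k1 : P.α * ‖H1.rep u 1‖ ^ 2 ≤ K * ‖H1.rep u 1‖ ^ 2 :=
    mul_le_mul_of_nonneg_right hK₁ (sq_nonneg _)
  have k2 : K * ‖H1.rep u 0‖ ^ 2 ≤ (2 * P.β - P.α) * ‖H1.rep u 0‖ ^ 2 :=
    mul_le_mul_of_nonneg_right hK₂ (sq_nonneg _)
  have i3 : K * RCLike.re (inner 𝕜 (H1.dx u) (H1.fn u))
      = K / 2 * (‖H1.rep u 1‖ ^ 2 - ‖H1.rep u 0‖ ^ 2) := by
    rw [← i2, s2]
    ring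
  rw [i3]
  linarith

/-- `l - A` is onto for `l > 0`: eliminating everything but `y` leaves a coercive problem on
`H¹`. -/
theorem exists_smul_sub_craneMap_eq {P : Params} (hm : 0 < P.m) (hM : 0 < P.M)
    (hα : 0 < P.α) (hτ : 0 < P.τ) (hσ : 0 < P.σ) {a₀ : ℝ} (ha₀ : 0 < a₀)
    (ha : ∀ x : unitInterval, a₀ ≤ H1.rep P.a x) (hαβ : P.α < P.β) {l : ℝ} (hl : 0 < l)
    (F : State 𝕜) : ∃ Φ : domain 𝕜,
      (l : 𝕜) • (Φ : State 𝕜) - craneMap P Φ = F := by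
  obtain ⟨f, g, h, p, q⟩ := F
  obtain ⟨b, hb⟩ := H1.exists_inv ha₀ ha
  obtain ⟨r, hr0, hr1, H⟩ := H1.exists_transport (𝕜 := 𝕜) (mul_pos hl hτ).le
  obtain ⟨h₁, H⟩ := H ((P.τ : 𝕜) • h)
  have hm' : (P.m : 𝕜) ≠ 0 := RCLike.ofReal_ne_zero.2 hm.ne'
  have hM' : (P.M : 𝕜) ≠ 0 := RCLike.ofReal_ne_zero.2 hM.ne'
  have hτ' : (P.τ : 𝕜) ≠ 0 := RCLike.ofReal_ne_zero.2 hτ.ne'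
  -- the coefficient of `ξ` in the condition at `0`, once `u(1) = r ξ + h₁` is inserted there
  set k : ℝ := P.m * l + P.β - P.α * r with hk
  have hk0 : 0 < k := by
    have : P.α * r ≤ P.α := mul_le_of_le_one_right hα.le hr1
    have := mul_pos hm hl
    linarith
  let D : H1 𝕜 →L[𝕜] L2 𝕜 := H1.dxL
  let N : H1 𝕜 →L[𝕜] L2 𝕜 := H1.fnL
  let e₀ : H1 𝕜 →L[𝕜] 𝕜 := H1.evalL 0
  let e₁ : H1 𝕜 →L[𝕜] 𝕜 := H1.evalL 1
  -- the operator of the weak equation for `y`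
  let T : H1 𝕜 →L[𝕜] H1 𝕜 := (D.adjoint.comp ((mulL P.a).comp D))
    + N.adjoint.comp ((((l + P.σ) * l : ℝ) : 𝕜) • N) + e₀.adjoint.comp (((k * l : ℝ) : 𝕜) • e₀)
    + e₁.adjoint.comp (((P.M * l * l : ℝ) : 𝕜) • e₁)
  have hT : ∀ φ y : H1 𝕜, inner 𝕜 φ (T y) = inner 𝕜 (H1.dx φ) (mulL P.a (H1.dx y))
      + (((l + P.σ) * l : ℝ) : 𝕜) * inner 𝕜 (H1.fn φ) (H1.fn y)
      + ((k * l : ℝ) : 𝕜) * inner 𝕜 (H1.rep φ 0) (H1.rep y 0)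
      + ((P.M * l * l : ℝ) : 𝕜) * inner 𝕜 (H1.rep φ 1) (H1.rep y 1) := by
    intro φ y
    change inner 𝕜 φ (D.adjoint (mulL P.a (D y)) + N.adjoint ((((l + P.σ) * l : ℝ) : 𝕜) • N y)
      + e₀.adjoint (((k * l : ℝ) : 𝕜) • e₀ y) + e₁.adjoint (((P.M * l * l : ℝ) : 𝕜) • e₁ y)) = _
    simp only [inner_add_right, ContinuousLinearMap.adjoint_inner_right, inner_smul_right]
    rfl
  have hc : 0 < min a₀ ((l + P.σ) * l) := lt_min ha₀ (by positivity)
  obtain ⟨y, hy⟩ := surjective_of_coercive T hc (fun y => by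
    rw [hT, H1.norm_sq_eq]
    simp only [map_add, RCLike.re_ofReal_mul, inner_self_eq_norm_sq]
    have h1 := le_re_inner_mulL ha (H1.dx y)
    have h2 := mul_le_mul_of_nonneg_right (min_le_left a₀ ((l + P.σ) * l))
      (sq_nonneg ‖H1.dx y‖)
    have h3 := mul_le_mul_of_nonneg_right (min_le_right a₀ ((l + P.σ) * l))
      (sq_nonneg ‖H1.fn y‖)
    have h4 : 0 ≤ k * l * ‖H1.rep y 0‖ ^ 2 := by positivity
    have h5 : 0 ≤ P.M * l * l * ‖H1.rep y 1‖ ^ 2 := by positivity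
    linarith)
    (N.adjoint (((l + P.σ : ℝ) : 𝕜) • H1.fn f + g)
      + e₀.adjoint ((k : 𝕜) * H1.rep f 0 + (P.α : 𝕜) * h₁ + (P.m : 𝕜) * p)
      + e₁.adjoint (((P.M * l : ℝ) : 𝕜) * H1.rep f 1 + (P.M : 𝕜) * q))
  set z : H1 𝕜 := (l : 𝕜) • y - f with hz
  have repz : ∀ x, H1.rep z x = (l : 𝕜) * H1.rep y x - H1.rep f x := by
    intro x
    have := map_sub (H1.evalL x) ((l : 𝕜) • y) f
    rw [map_smul] at this
    exact this
  have fnz : H1.fn z = (l : 𝕜) • H1.fn y - H1.fn f := by rw [hz, map_sub, map_smul]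
  obtain ⟨u, hu0, hu1, hu⟩ := H (H1.rep z 0)
  obtain ⟨w, hw, hwd, hw0, hw1⟩ := H1.exists_of_weak (q := mulL P.a (H1.dx y))
    (G := ((l + P.σ : ℝ) : 𝕜) • H1.fn z - g)
    (p₀ := (k : 𝕜) * H1.rep z 0 - (P.α : 𝕜) * h₁ - (P.m : 𝕜) * p)
    (p₁ := ((P.M * l : ℝ) : 𝕜) * H1.rep z 1 - (P.M : 𝕜) * q) (by
      intro φ
      have h1 := hT φ y
      rw [hy] at h1
      simp only [inner_add_right, ContinuousLinearMap.adjoint_inner_right] at h1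
      change inner 𝕜 (H1.fn φ) _ + inner 𝕜 (H1.fn φ) _ + (inner 𝕜 (H1.rep φ 0) _
        + inner 𝕜 (H1.rep φ 0) _ + inner 𝕜 (H1.rep φ 0) _) + (inner 𝕜 (H1.rep φ 1) _
        + inner 𝕜 (H1.rep φ 1) _) = _ at h1
      rw [fnz, repz, repz]
      simp only [inner_sub_right, inner_smul_right, RCLike.inner_apply] at h1 ⊢
      push_cast at h1 ⊢
      linear_combination -h1)
  -- `w` is the tension; its boundary values are the equations for `ξ` and `η`
  obtain ⟨Φ, hΦ, hΦz, hΦu, hΦw⟩ := exists_domain hb hw hu0.symm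
  refine ⟨Φ, ?_⟩
  rw [craneMap_apply, hΦz, hΦu, hΦw, hΦ, hwd, hw0, hw1, hu0, hu1]
  have hu' : H1.dx u = (P.τ : 𝕜) • h - ((l * P.τ : ℝ) : 𝕜) • H1.fn u := eq_sub_of_add_eq hu
  refine Prod.ext ?_ (Prod.ext ?_ (Prod.ext ?_ (Prod.ext ?_ ?_)))
  · change (l : 𝕜) • y - z = f
    rw [hz, sub_sub_cancel]
  · change (l : 𝕜) • H1.fn z - (((l + P.σ : ℝ) : 𝕜) • H1.fn z - g - (P.σ : 𝕜) • H1.fn z) = g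
    push_cast
    module
  · change (l : 𝕜) • H1.fn u - -((P.τ : 𝕜)⁻¹ • H1.dx u) = h
    rw [hu', smul_sub, smul_smul, smul_smul, inv_mul_cancel₀ hτ', one_smul]
    have : (P.τ : 𝕜)⁻¹ * ((l * P.τ : ℝ) : 𝕜) = l := by
      push_cast
      field_simp
    rw [this]
    abel
  · change (l : 𝕜) * H1.rep z 0 - (P.m : 𝕜)⁻¹ * ((k : 𝕜) * H1.rep z 0 - (P.α : 𝕜) * h₁
      - (P.m : 𝕜) * p - (P.β : 𝕜) * H1.rep z 0 + (P.α : 𝕜) * ((r : 𝕜) * H1.rep z 0 + h₁)) = p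
    rw [hk]
    push_cast
    field_simp
    ring
  · change (l : 𝕜) * H1.rep z 1 - -((P.M : 𝕜)⁻¹ *
      -(((P.M * l : ℝ) : 𝕜) * H1.rep z 1 - (P.M : 𝕜) * q)) = q
    push_cast
    field_simp
    ring

end Operator

/-! ### Bounds for the energy -/

section FormBounds

variable {𝕜 : Type} [RCLike 𝕜]

theorem State.norm_y_le (Φ : State 𝕜) : ‖Φ.y‖ ≤ ‖Φ‖ := norm_fst_le Φ

theorem State.norm_z_le (Φ : State 𝕜) : ‖Φ.z‖ ≤ ‖Φ‖ := (norm_fst_le Φ.2).trans (norm_snd_le Φ)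

theorem State.norm_u_le (Φ : State 𝕜) : ‖Φ.u‖ ≤ ‖Φ‖ :=
  ((norm_fst_le Φ.2.2).trans (norm_snd_le Φ.2)).trans (norm_snd_le Φ)

theorem State.norm_ξ_le (Φ : State 𝕜) : ‖Φ.ξ‖ ≤ ‖Φ‖ :=
  ((norm_fst_le Φ.2.2.2).trans (norm_snd_le Φ.2.2)).trans
    ((norm_snd_le Φ.2).trans (norm_snd_le Φ))

theorem State.norm_η_le (Φ : State 𝕜) : ‖Φ.η‖ ≤ ‖Φ‖ :=
  ((norm_snd_le Φ.2.2.2).trans (norm_snd_le Φ.2.2)).trans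
    ((norm_snd_le Φ.2).trans (norm_snd_le Φ))

/-- The displacement, as a bounded operator. -/
def State.yL : State 𝕜 →L[𝕜] H1 𝕜 := ContinuousLinearMap.fst 𝕜 _ _

/-- The velocity, as a bounded operator. -/
def State.zL : State 𝕜 →L[𝕜] L2 𝕜 :=
  (ContinuousLinearMap.fst 𝕜 _ _).comp (ContinuousLinearMap.snd 𝕜 _ _)

/-- The delay variable, as a bounded operator. -/
def State.uL : State 𝕜 →L[𝕜] L2 𝕜 :=
  (ContinuousLinearMap.fst 𝕜 _ _).comp
    ((ContinuousLinearMap.snd 𝕜 (L2 𝕜) _).comp (ContinuousLinearMap.snd 𝕜 (H1 𝕜) _))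

/-- The velocity of the platform, as a bounded functional. -/
def State.ξL : State 𝕜 →L[𝕜] 𝕜 :=
  (ContinuousLinearMap.fst 𝕜 _ _).comp ((ContinuousLinearMap.snd 𝕜 (L2 𝕜) _).comp
    ((ContinuousLinearMap.snd 𝕜 (L2 𝕜) _).comp (ContinuousLinearMap.snd 𝕜 (H1 𝕜) _)))

/-- The velocity of the load, as a bounded functional. -/
def State.ηL : State 𝕜 →L[𝕜] 𝕜 :=
  (ContinuousLinearMap.snd 𝕜 𝕜 𝕜).comp ((ContinuousLinearMap.snd 𝕜 (L2 𝕜) _).comp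
    ((ContinuousLinearMap.snd 𝕜 (L2 𝕜) _).comp (ContinuousLinearMap.snd 𝕜 (H1 𝕜) _)))

theorem le_re_craneForm_self {P : Params} {a₀ : ℝ} (ha : ∀ x : unitInterval, a₀ ≤ H1.rep P.a x)
    (K : ℝ) (Φ : State 𝕜) :
    a₀ * ‖H1.dx Φ.y‖ ^ 2 + ‖Φ.z‖ ^ 2 + K * P.τ * ‖Φ.u‖ ^ 2 + P.m * ‖Φ.ξ‖ ^ 2 + P.M * ‖Φ.η‖ ^ 2
      ≤ RCLike.re (craneForm P K Φ Φ) := by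
  simp only [craneForm, map_add, RCLike.re_ofReal_mul, inner_self_eq_norm_sq]
  linarith [le_re_inner_mulL ha (H1.dx Φ.y)]

theorem norm_craneForm_le {P : Params} (hm : 0 ≤ P.m) (hM : 0 ≤ P.M) {K : ℝ} (hK : 0 ≤ K * P.τ)
    (Φ Ψ : State 𝕜) : ‖craneForm P K Φ Ψ‖ ≤ ‖mulL (𝕜 := 𝕜) P.a‖ * ‖Φ‖ * ‖H1.dx Ψ.y‖
      + ‖Φ‖ * ‖Ψ.z‖ + K * P.τ * (‖Φ‖ * ‖Ψ.u‖) + P.m * (‖Φ‖ * ‖Ψ.ξ‖) + P.M * (‖Φ‖ * ‖Ψ.η‖) := by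
  have hr : ∀ {c : ℝ}, 0 ≤ c → ‖(c : 𝕜)‖ = c := fun h => RCLike.norm_of_nonneg h
  unfold craneForm
  refine (norm_add_le _ _).trans (add_le_add ((norm_add_le _ _).trans (add_le_add
    ((norm_add_le _ _).trans (add_le_add ((norm_add_le _ _).trans (add_le_add ?_ ?_)) ?_)) ?_)) ?_)
  · refine (norm_inner_le_norm _ _).trans ?_
    have h1 := (H1.norm_dx_le_norm Φ.y).trans Φ.norm_y_le
    have h2 := (mulL (𝕜 := 𝕜) P.a).le_opNorm (H1.dx Ψ.y)
    refine (mul_le_mul h1 h2 (norm_nonneg _) (norm_nonneg _)).trans (le_of_eq ?_)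
    ring
  · exact (norm_inner_le_norm _ _).trans (mul_le_mul_of_nonneg_right Φ.norm_z_le (norm_nonneg _))
  · rw [norm_mul, hr hK]
    exact mul_le_mul_of_nonneg_left ((norm_inner_le_norm _ _).trans
      (mul_le_mul_of_nonneg_right Φ.norm_u_le (norm_nonneg _))) hK
  · rw [norm_mul, hr hm]
    exact mul_le_mul_of_nonneg_left ((norm_inner_le_norm _ _).trans
      (mul_le_mul_of_nonneg_right Φ.norm_ξ_le (norm_nonneg _))) hm
  · rw [norm_mul, hr hM]
    exact mul_le_mul_of_nonneg_left ((norm_inner_le_norm _ _).trans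
      (mul_le_mul_of_nonneg_right Φ.norm_η_le (norm_nonneg _))) hM

/-- The norm of a state is controlled by `y(0)` and the quantities in the energy. -/
theorem State.norm_le (Φ : State 𝕜) : ‖Φ‖ ≤ ‖H1.rep Φ.y 0‖ + 2 * ‖H1.dx Φ.y‖ + ‖Φ.z‖ + ‖Φ.u‖
    + ‖Φ.ξ‖ + ‖Φ.η‖ := by
  have h1 := H1.norm_le_add Φ.y
  have h2 := H1.norm_fn_le Φ.y
  have := norm_nonneg (H1.rep Φ.y 0)
  have := norm_nonneg (H1.dx Φ.y)
  have := norm_nonneg Φ.z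
  have := norm_nonneg Φ.u
  have := norm_nonneg Φ.ξ
  have := norm_nonneg Φ.η
  rw [Prod.norm_def, Prod.norm_def, Prod.norm_def, Prod.norm_def]
  refine max_le (by linarith) (max_le (by linarith) (max_le (by linarith)
    (max_le (by linarith) (by linarith))))

theorem State.norm_sq_le (Φ : State 𝕜) : ‖Φ‖ ^ 2 ≤ Φ.usualNormSq := by
  have h1 := sq_nonneg ‖Φ.y‖
  have h2 := sq_nonneg ‖Φ.z‖
  have h3 := sq_nonneg ‖Φ.u‖
  have h4 := sq_nonneg ‖Φ.ξ‖
  have h5 := sq_nonneg ‖Φ.η‖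
  have h0 : 0 ≤ Φ.usualNormSq := by
    unfold State.usualNormSq
    positivity
  rw [← Real.le_sqrt (norm_nonneg _) h0, Prod.norm_def, Prod.norm_def, Prod.norm_def,
    Prod.norm_def]
  unfold State.usualNormSq
  refine max_le ?_ (max_le ?_ (max_le ?_ (max_le ?_ ?_))) <;>
    exact Real.le_sqrt_of_sq_le (by linarith)

theorem State.usualNormSq_le (Φ : State 𝕜) : Φ.usualNormSq ≤ 5 * ‖Φ‖ ^ 2 := by
  unfold State.usualNormSq
  have := pow_le_pow_left₀ (norm_nonneg _) Φ.norm_y_le 2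
  have := pow_le_pow_left₀ (norm_nonneg _) Φ.norm_z_le 2
  have := pow_le_pow_left₀ (norm_nonneg _) Φ.norm_u_le 2
  have := pow_le_pow_left₀ (norm_nonneg _) Φ.norm_ξ_le 2
  have := pow_le_pow_left₀ (norm_nonneg _) Φ.norm_η_le 2
  linarith

end FormBounds

/-! ### The energy inner product -/

section EnergyInner

/-- The integral over `(0,1)`, as a bounded functional of `L²`. -/
def L2.integralL : L2 ℝ →L[ℝ] ℝ :=
  let T : L2 ℝ →ₗ[ℝ] ℝ :=
    { toFun := fun f => ∫ x, f x ∂vol01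
      map_add' := fun f g => by
        rw [← integral_add (L2.integrable f) (L2.integrable g)]
        exact integral_congr_ae (Lp.coeFn_add f g)
      map_smul' := fun c f => by
        rw [RingHom.id_apply, smul_eq_mul, ← integral_const_mul]
        exact integral_congr_ae (Lp.coeFn_smul c f) }
  T.mkContinuous 1 fun f => by
    have h := L2.norm_integral_le f 0 1
    rw [Icc.coe_zero, Icc.coe_one, sub_zero, abs_one, Real.sqrt_one, ← integral_vol01] at h
    exact h

theorem L2.integralL_apply (f : L2 ℝ) : L2.integralL f = ∫ x, f x ∂vol01 := rfl

theorem L2.abs_integralL_le (f : L2 ℝ) : |L2.integralL f| ≤ ‖f‖ := by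
  have h := L2.norm_integral_le f 0 1
  rw [Icc.coe_zero, Icc.coe_one, sub_zero, abs_one, Real.sqrt_one, one_mul,
    ← integral_vol01] at h
  exact h

theorem L2.integralL_dx (f : H1 ℝ) : L2.integralL (H1.dx f) = H1.rep f 1 - H1.rep f 0 := by
  rw [H1.rep_sub_rep, L2.integralL_apply, integral_vol01, Icc.coe_zero, Icc.coe_one]

/-- The mean of an `H¹` function differs from its value at `0` by at most `‖f'‖`. -/
theorem L2.abs_integralL_fn_sub_le (f : H1 ℝ) :
    |L2.integralL (H1.fn f) - H1.rep f 0| ≤ ‖H1.dx f‖ := by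
  set g := H1.prim (H1.rep f 0) (0 : L2 ℝ) with hg
  have hg0 : H1.rep g 0 = H1.rep f 0 := H1.rep_prim_zero _ _
  have hgd : H1.dx g = 0 := H1.dx_prim _ _
  have hI : L2.integralL (H1.fn g) = H1.rep f 0 := by
    have : (H1.fn g : ℝ → ℝ) =ᵐ[vol01] fun _ => H1.rep f 0 := by
      filter_upwards [H1.fn_ae g] with x ⟨hx, e⟩
      have h1 := H1.norm_rep_sub_le g 0 ⟨x, hx⟩
      rw [hgd, norm_zero, mul_zero, norm_le_zero_iff, sub_eq_zero, hg0] at h1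
      rw [e, h1]
    rw [L2.integralL_apply, integral_congr_ae this]
    simp
  have h1 := L2.abs_integralL_le (H1.fn (f - g))
  have h2 := H1.norm_fn_le (f - g)
  have h3 : H1.rep (f - g) 0 = 0 := by
    have := map_sub (H1.evalL 0) f g
    simp only [H1.evalL_apply] at this
    rw [this, hg0, sub_self]
  have h4 : H1.dx (f - g) = H1.dx f := by rw [map_sub, hgd, sub_zero]
  rw [h3, norm_zero, zero_add, h4] at h2
  have h5 := h1.trans h2
  rwa [map_sub, map_sub, hI] at h5

/-- `invariantFunctional` as a bounded functional. -/
def invariantL (P : Params) : State ℝ →L[ℝ] ℝ :=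
  P.σ • L2.integralL.comp (H1.fnL.comp State.yL) + L2.integralL.comp State.zL + P.m • State.ξL
    + P.M • State.ηL + (P.β - P.α) • (H1.evalL 0).comp State.yL
    + (P.τ * P.α) • L2.integralL.comp State.uL

theorem invariantL_apply (P : Params) (Φ : State ℝ) :
    invariantL P Φ = P.σ * L2.integralL (H1.fn Φ.y) + L2.integralL Φ.z + P.m * Φ.ξ + P.M * Φ.η
      + (P.β - P.α) * H1.rep Φ.y 0 + P.τ * P.α * L2.integralL Φ.u := rfl

theorem invariantFunctional_eq (P : Params) (Φ : State ℝ) :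
    invariantFunctional P Φ = invariantL P Φ := by
  rw [invariantL_apply, invariantFunctional,
    integral_add ((L2.integrable (H1.fn Φ.y)).const_mul _) (L2.integrable Φ.z), integral_const_mul]
  rfl

/-- The functional vanishes on the range of the operator, so it is constant along the flow. -/
theorem invariantL_craneMap {P : Params} (hm : 0 < P.m) (hM : 0 < P.M) (hτ : 0 < P.τ)
    (Φ : domain ℝ) : invariantL P (craneMap P Φ) = 0 := by
  rw [invariantL_apply, craneMap_apply]
  change P.σ * L2.integralL (H1.fn (domZ Φ)) + L2.integralL (H1.dx (tension P Φ) - P.σ • Φ.1.z)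
    + P.m * (P.m⁻¹ * (H1.rep (tension P Φ) 0 - P.β * Φ.1.ξ + P.α * H1.rep (domU Φ) 1))
    + P.M * (-(P.M⁻¹ * H1.rep (tension P Φ) 1)) + (P.β - P.α) * H1.rep (domZ Φ) 0
    + P.τ * P.α * L2.integralL (-(P.τ⁻¹ • H1.dx (domU Φ))) = 0
  rw [map_sub, map_smul, map_neg, map_smul, L2.integralL_dx, L2.integralL_dx, fn_domZ,
    rep_domU_zero, rep_domZ_zero, smul_eq_mul, smul_eq_mul]
  have := hm.ne'
  have := hM.ne'
  have := hτ.ne'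
  field_simp
  ring

theorem energyInner_eq (P : Params) (K ϖ : ℝ) (Φ Ψ : State ℝ) :
    energyInner P K ϖ Φ Ψ = craneForm P K Φ Ψ + ϖ * invariantL P Φ * invariantL P Ψ := by
  have h1 : ∫ x, H1.fn P.a x * H1.dx Φ.y x * H1.dx Ψ.y x ∂vol01
      = inner ℝ (H1.dx Φ.y) (mulL P.a (H1.dx Ψ.y)) := by
    rw [L2.inner_def]
    apply integral_congr_ae
    filter_upwards [mulL_ae P.a (H1.dx Ψ.y)] with x hx
    rw [hx, RCLike.inner_apply, conj_trivial, smul_eq_mul]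
    ring
  have h1' : Integrable (fun x => H1.fn P.a x * H1.dx Φ.y x * H1.dx Ψ.y x) vol01 := by
    refine (L2.integrable_inner (𝕜 := ℝ) (H1.dx Φ.y) (mulL P.a (H1.dx Ψ.y))).congr ?_
    filter_upwards [mulL_ae P.a (H1.dx Ψ.y)] with x hx
    rw [hx, RCLike.inner_apply, conj_trivial, smul_eq_mul]
    ring
  have h2 : ∀ f g : L2 ℝ, ∫ x, f x * g x ∂vol01 = inner ℝ f g := by
    intro f g
    rw [L2.inner_def]
    refine integral_congr_ae (ae_of_all _ fun x => ?_)
    simp only [RCLike.inner_apply, conj_trivial, mul_comm]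
  have h2' : Integrable (fun x => Φ.z x * Ψ.z x) vol01 := by
    refine (L2.integrable_inner (𝕜 := ℝ) Φ.z Ψ.z).congr (ae_of_all _ fun x => ?_)
    simp only [RCLike.inner_apply, conj_trivial, mul_comm]
  rw [energyInner, integral_add h1' h2', h1, h2, h2, invariantFunctional_eq, invariantFunctional_eq,
    craneForm]
  simp only [RCLike.inner_apply, conj_trivial, RCLike.ofReal_real_eq_id, id]
  ring

/-- The energy controls the state: `y(0)` is recovered from the invariant functional, in which it
has the coefficient `σ + β - α > 0`. -/
theorem exists_norm_le_energyNorm {P : Params} (hm : 0 < P.m) (hM : 0 < P.M) (hα : 0 < P.α)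
    (hτ : 0 < P.τ) (hσ : 0 < P.σ) {a₀ : ℝ} (ha₀ : 0 < a₀)
    (ha : ∀ x : unitInterval, a₀ ≤ H1.rep P.a x) (hαβ : P.α < P.β) {K : ℝ} (hK : 0 < K)
    {ϖ : ℝ} (hϖ : 0 < ϖ) : ∃ C > 0, ∀ Φ : State ℝ,
      0 ≤ energyInner P K ϖ Φ Φ ∧ ‖Φ‖ ≤ C * energyNorm P K ϖ Φ := by
  have hs : 0 < P.σ + P.β - P.α := by linarith
  refine ⟨((√ϖ)⁻¹ + P.σ * (√a₀)⁻¹ + 1 + P.m * (√P.m)⁻¹ + P.M * (√P.M)⁻¹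
    + P.τ * P.α * (√(K * P.τ))⁻¹) / (P.σ + P.β - P.α) + 2 * (√a₀)⁻¹ + 1 + (√(K * P.τ))⁻¹
    + (√P.m)⁻¹ + (√P.M)⁻¹, by positivity, fun Φ => ?_⟩
  have hform := le_re_craneForm_self ha K Φ
  rw [RCLike.re_to_real] at hform
  have hE := energyInner_eq P K ϖ Φ Φ
  have q1 : 0 ≤ a₀ * ‖H1.dx Φ.y‖ ^ 2 := by positivity
  have q2 : 0 ≤ ‖Φ.z‖ ^ 2 := by positivity
  have q3 : 0 ≤ K * P.τ * ‖Φ.u‖ ^ 2 := by positivity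
  have q4 : 0 ≤ P.m * ‖Φ.ξ‖ ^ 2 := by positivity
  have q5 : 0 ≤ P.M * ‖Φ.η‖ ^ 2 := by positivity
  have q6 : 0 ≤ ϖ * |invariantL P Φ| ^ 2 := by positivity
  have q6' : ϖ * invariantL P Φ * invariantL P Φ = ϖ * |invariantL P Φ| ^ 2 := by
    rw [sq_abs]
    ring
  rw [q6'] at hE
  have hE0 : 0 ≤ energyInner P K ϖ Φ Φ := by linarith
  refine ⟨hE0, ?_⟩
  have aux : ∀ {c t : ℝ}, 0 < c → 0 ≤ t → c * t ^ 2 ≤ energyInner P K ϖ Φ Φ →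
      t ≤ (√c)⁻¹ * energyNorm P K ϖ Φ := by
    intro c t hc ht h
    rw [le_inv_mul_iff₀ (Real.sqrt_pos.2 hc)]
    apply Real.le_sqrt_of_sq_le
    rw [mul_pow, Real.sq_sqrt hc.le]
    exact h
  have b1 := aux ha₀ (norm_nonneg (H1.dx Φ.y)) (by linarith)
  have b2 := aux one_pos (norm_nonneg Φ.z) (by linarith)
  have b3 := aux (mul_pos hK hτ) (norm_nonneg Φ.u) (by linarith)
  have b4 := aux hm (norm_nonneg Φ.ξ) (by linarith)
  have b5 := aux hM (norm_nonneg Φ.η) (by linarith)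
  have b6 := aux hϖ (abs_nonneg (invariantL P Φ)) (by linarith)
  rw [Real.sqrt_one, inv_one, one_mul] at b2
  set E := energyNorm P K ϖ Φ
  -- `∫ σ y` contributes `σ y(0)` up to `σ ‖y'‖`
  have c1 : (P.σ + P.β - P.α) * ‖H1.rep Φ.y 0‖ ≤ |invariantL P Φ| + P.σ * ‖H1.dx Φ.y‖ + ‖Φ.z‖
      + P.m * ‖Φ.ξ‖ + P.M * ‖Φ.η‖ + P.τ * P.α * ‖Φ.u‖ := by
    have e : (P.σ + P.β - P.α) * H1.rep Φ.y 0 = invariantL P Φ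
        - P.σ * (L2.integralL (H1.fn Φ.y) - H1.rep Φ.y 0) - L2.integralL Φ.z - P.m * Φ.ξ
        - P.M * Φ.η - P.τ * P.α * L2.integralL Φ.u := by
      rw [invariantL_apply]
      ring
    have h1 := mul_le_mul_of_nonneg_left (L2.abs_integralL_fn_sub_le Φ.y) hσ.le
    have h2 := L2.abs_integralL_le Φ.z
    have h3 := mul_le_mul_of_nonneg_left (L2.abs_integralL_le Φ.u) (mul_pos hτ hα).le
    have e0 : (P.σ + P.β - P.α) * ‖H1.rep Φ.y 0‖ = |(P.σ + P.β - P.α) * H1.rep Φ.y 0| := by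
      rw [abs_mul, abs_of_pos hs, Real.norm_eq_abs]
    rw [← abs_of_pos hσ, ← abs_mul, abs_of_pos hσ] at h1
    rw [← abs_of_pos (mul_pos hτ hα), ← abs_mul, abs_of_pos (mul_pos hτ hα)] at h3
    have h4 : |P.m * Φ.ξ| = P.m * ‖Φ.ξ‖ := by rw [abs_mul, abs_of_pos hm, Real.norm_eq_abs]
    have h5 : |P.M * Φ.η| = P.M * ‖Φ.η‖ := by rw [abs_mul, abs_of_pos hM, Real.norm_eq_abs]
    rw [e0, e, ← h4, ← h5]
    refine (abs_sub _ _).trans (add_le_add ((abs_sub _ _).trans (add_le_add ((abs_sub _ _).trans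
      (add_le_add ((abs_sub _ _).trans (add_le_add ((abs_sub _ _).trans
      (add_le_add le_rfl h1)) h2)) le_rfl)) le_rfl)) h3)
  have c2 : ‖H1.rep Φ.y 0‖ ≤ ((√ϖ)⁻¹ + P.σ * (√a₀)⁻¹ + 1 + P.m * (√P.m)⁻¹ + P.M * (√P.M)⁻¹
      + P.τ * P.α * (√(K * P.τ))⁻¹) / (P.σ + P.β - P.α) * E := by
    rw [div_mul_eq_mul_div, le_div_iff₀ hs, mul_comm]
    have d1 := mul_le_mul_of_nonneg_left b1 hσ.le
    have d3 := mul_le_mul_of_nonneg_left b3 (mul_pos hτ hα).le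
    have d4 := mul_le_mul_of_nonneg_left b4 hm.le
    have d5 := mul_le_mul_of_nonneg_left b5 hM.le
    linarith
  linarith [State.norm_le Φ]

theorem exists_energyNorm_le {P : Params} (hm : 0 < P.m) (hM : 0 < P.M) (hτ : 0 < P.τ) {K : ℝ}
    (hK : 0 < K) {ϖ : ℝ} (hϖ : 0 < ϖ) : ∃ C > 0, ∀ Φ : State ℝ,
      energyNorm P K ϖ Φ ≤ C * ‖Φ‖ := by
  set C := ‖mulL (𝕜 := ℝ) P.a‖ + 1 + K * P.τ + P.m + P.M + ϖ * ‖invariantL P‖ ^ 2 with hC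
  have hC0 : 0 < C := by positivity
  refine ⟨√C, Real.sqrt_pos.2 hC0, fun Φ => ?_⟩
  rw [energyNorm, ← Real.sqrt_sq (norm_nonneg Φ), ← Real.sqrt_mul hC0.le]
  apply Real.sqrt_le_sqrt
  rw [energyInner_eq]
  have h1 := (Real.le_norm_self _).trans (norm_craneForm_le hm.le hM.le (mul_pos hK hτ).le Φ Φ)
  have hn := norm_nonneg Φ
  have m1 := mul_le_mul_of_nonneg_left ((H1.norm_dx_le_norm Φ.y).trans Φ.norm_y_le)
    (mul_nonneg (norm_nonneg (mulL (𝕜 := ℝ) P.a)) hn)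
  have m3 := mul_le_mul_of_nonneg_left Φ.norm_z_le hn
  have m5 := mul_le_mul_of_nonneg_left (mul_le_mul_of_nonneg_left Φ.norm_u_le hn) (mul_pos hK hτ).le
  have m7 := mul_le_mul_of_nonneg_left (mul_le_mul_of_nonneg_left Φ.norm_ξ_le hn) hm.le
  have m8 := mul_le_mul_of_nonneg_left (mul_le_mul_of_nonneg_left Φ.norm_η_le hn) hM.le
  have hL := pow_le_pow_left₀ (norm_nonneg _) ((invariantL P).le_opNorm Φ) 2
  rw [Real.norm_eq_abs, sq_abs, mul_pow] at hL
  have hL' := mul_le_mul_of_nonneg_left hL hϖ.le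
  rw [hC]
  linarith

/-- The energy inner product. -/
theorem exists_energyCore {P : Params} (hm : 0 < P.m) (hM : 0 < P.M) (hα : 0 < P.α)
    (hτ : 0 < P.τ) (hσ : 0 < P.σ) {a₀ : ℝ} (ha₀ : 0 < a₀)
    (ha : ∀ x : unitInterval, a₀ ≤ H1.rep P.a x) (hαβ : P.α < P.β) {K : ℝ} (hK : 0 < K)
    {ϖ : ℝ} (hϖ : 0 < ϖ) : ∃ core : InnerProductSpace.Core ℝ (State ℝ),
      ∀ Φ Ψ, core.inner Φ Ψ = energyInner P K ϖ Φ Ψ := by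
  obtain ⟨C, hC, h⟩ := exists_norm_le_energyNorm hm hM hα hτ hσ ha₀ ha hαβ hK hϖ
  refine ⟨{ inner := energyInner P K ϖ, conj_inner_symm := ?_, re_inner_nonneg := fun Φ => (h Φ).1,
            add_left := ?_, smul_left := ?_, definite := ?_ }, fun _ _ => rfl⟩
  · intro Φ Ψ
    change energyInner P K ϖ Ψ Φ = energyInner P K ϖ Φ Ψ
    have h1 : ∫ x, (H1.fn P.a x * H1.dx Ψ.y x * H1.dx Φ.y x + Ψ.z x * Φ.z x) ∂vol01
        = ∫ x, (H1.fn P.a x * H1.dx Φ.y x * H1.dx Ψ.y x + Φ.z x * Ψ.z x) ∂vol01 :=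
      integral_congr_ae (ae_of_all _ fun x => by ring)
    have h2 : ∫ x, Ψ.u x * Φ.u x ∂vol01 = ∫ x, Φ.u x * Ψ.u x ∂vol01 :=
      integral_congr_ae (ae_of_all _ fun x => mul_comm _ _)
    rw [energyInner, energyInner, h1, h2]
    ring
  · intro Φ Ψ Θ
    change energyInner P K ϖ (Φ + Ψ) Θ = energyInner P K ϖ Φ Θ + energyInner P K ϖ Ψ Θ
    rw [energyInner_eq, energyInner_eq, energyInner_eq, map_add]
    have : craneForm P K (Φ + Ψ) Θ = craneForm P K Φ Θ + craneForm P K Ψ Θ := by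
      change inner ℝ (H1.dx (Φ.y + Ψ.y)) _ + inner ℝ (Φ.z + Ψ.z) _ + _ * inner ℝ (Φ.u + Ψ.u) _
        + _ * inner ℝ (Φ.ξ + Ψ.ξ) _ + _ * inner ℝ (Φ.η + Ψ.η) _ = _
      rw [map_add]
      simp only [inner_add_left, craneForm]
      ring
    rw [this]
    ring
  · intro Φ Ψ c
    change energyInner P K ϖ (c • Φ) Ψ = c * energyInner P K ϖ Φ Ψ
    rw [energyInner_eq, energyInner_eq, map_smul]
    have : craneForm P K (c • Φ) Ψ = c * craneForm P K Φ Ψ := by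
      change inner ℝ (H1.dx (c • Φ.y)) _ + inner ℝ (c • Φ.z) _ + _ * inner ℝ (c • Φ.u) _
        + _ * inner ℝ (c • Φ.ξ) _ + _ * inner ℝ (c • Φ.η) _ = _
      rw [map_smul]
      simp only [real_inner_smul_left, craneForm]
      ring
    rw [this, smul_eq_mul]
    ring
  · intro Φ hΦ
    have h1 := (h Φ).2
    have h2 : energyInner P K ϖ Φ Φ = 0 := hΦ
    rw [energyNorm, h2, Real.sqrt_zero, mul_zero] at h1
    exact norm_le_zero_iff.1 h1

end EnergyInner

/-! ### The resolvent of the crane operator -/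

section CompactResolvent

/-- An a priori estimate and surjectivity give a point of the resolvent set. -/
theorem exists_isResolventAt {X : Type} [NormedAddCommGroup X] [NormedSpace ℂ X]
    {A : X →ₗ.[ℂ] X} {ζ : ℂ} {C : ℝ} (h : ∀ x : A.domain, ‖(x : X)‖ ≤ C * ‖ζ • (x : X) - A x‖)
    (hs : ∀ v, ∃ x : A.domain, ζ • (x : X) - A x = v) : ∃ R, IsResolventAt A ζ R := by
  let B : A.domain →ₗ[ℂ] X := ζ • A.domain.subtype - A.toFun
  have hB : ∀ x : A.domain, B x = ζ • (x : X) - A x := fun _ => rfl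
  have hinj : Function.Injective B := by
    rw [← LinearMap.ker_eq_bot, LinearMap.ker_eq_bot']
    intro x hx
    have h1 := h x
    rw [← hB, hx, norm_zero, mul_zero, norm_le_zero_iff] at h1
    exact Subtype.ext h1
  let e := LinearEquiv.ofBijective B ⟨hinj, hs⟩
  refine ⟨(A.domain.subtype.comp e.symm.toLinearMap).mkContinuous C fun v => ?_, fun v => ?_,
    fun x => ?_⟩
  · obtain ⟨x, rfl⟩ := e.surjective v
    change ‖((e.symm (e x) : A.domain) : X)‖ ≤ _
    rw [e.symm_apply_apply]
    exact h x
  · exact ⟨(e.symm v).2, e.apply_symm_apply v⟩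
  · exact congrArg Subtype.val (e.symm_apply_apply x)

theorem isCompactOperator_prodMk {𝕜 X Y Z : Type} [NontriviallyNormedField 𝕜]
    [NormedAddCommGroup X] [NormedSpace 𝕜 X] [NormedAddCommGroup Y] [NormedSpace 𝕜 Y]
    [NormedAddCommGroup Z] [NormedSpace 𝕜 Z] {S : X →L[𝕜] Y} {T : X →L[𝕜] Z}
    (hS : IsCompactOperator S) (hT : IsCompactOperator T) : IsCompactOperator (S.prod T) := by
  have := (hS.clm_comp (ContinuousLinearMap.inl 𝕜 Y Z)).add
    (hT.clm_comp (ContinuousLinearMap.inr 𝕜 Y Z))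
  convert! this using 1
  ext1 x
  simp

variable {𝕜 : Type} [RCLike 𝕜]

/-- The estimate for the resolvent of the crane operator at `1`, which follows from
dissipativity and `y = z + F.y`. -/
theorem exists_norm_le_sub_craneMap {P : Params} (hm : 0 < P.m) (hM : 0 < P.M) (hα : 0 < P.α)
    (hτ : 0 < P.τ) (hσ : 0 < P.σ) {a₀ : ℝ} (ha₀ : 0 < a₀)
    (ha : ∀ x : unitInterval, a₀ ≤ H1.rep P.a x) (hαβ : P.α < P.β) :
    ∃ C, ∀ Φ : domain 𝕜, ‖(Φ : State 𝕜)‖ ≤ C * ‖(Φ : State 𝕜) - craneMap P Φ‖ := by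
  have hK := mul_pos hα hτ
  obtain ⟨c, hc, c1, c2, c3, c4, c5⟩ : ∃ c > 0, c ≤ a₀ ∧ c ≤ 1 ∧ c ≤ P.α * P.τ ∧ c ≤ P.m ∧
      c ≤ P.M :=
    ⟨min a₀ (min 1 (min (P.α * P.τ) (min P.m P.M))), by positivity, by simp, by simp, by simp,
      by simp, by simp⟩
  obtain ⟨D, hD, d1, d2, d3, d4, d5⟩ : ∃ D ≥ 0, ‖mulL (𝕜 := 𝕜) P.a‖ ≤ D ∧ 1 ≤ D ∧
      P.α * P.τ ≤ D ∧ P.m ≤ D ∧ P.M ≤ D := by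
    have := norm_nonneg (mulL (𝕜 := 𝕜) P.a)
    refine ⟨‖mulL (𝕜 := 𝕜) P.a‖ + 1 + P.α * P.τ + P.m + P.M, ?_, ?_, ?_, ?_, ?_, ?_⟩ <;> linarith
  refine ⟨2 * (5 * D / c) + 1, fun Φ => ?_⟩
  set F : State 𝕜 := (Φ : State 𝕜) - craneMap P Φ with hF
  -- dissipativity holds for every admissible gain, in particular for `K = α`
  have hdiss := re_craneForm_craneMap_le hm hM hα hτ hσ le_rfl (by linarith) Φ
  have hsub : craneForm P P.α F Φ.1 = craneForm P P.α Φ.1 Φ.1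
      - craneForm P P.α (craneMap P Φ) Φ.1 := by
    change inner 𝕜 (H1.dx (Φ.1.y - (craneMap P Φ).y)) _ + inner 𝕜 (Φ.1.z - (craneMap P Φ).z) _
      + _ * inner 𝕜 (Φ.1.u - (craneMap P Φ).u) _ + _ * inner 𝕜 (Φ.1.ξ - (craneMap P Φ).ξ) _
      + _ * inner 𝕜 (Φ.1.η - (craneMap P Φ).η) _ = _
    rw [map_sub]
    simp only [inner_sub_left, craneForm]
    ring
  have hlow := le_re_craneForm_self ha P.α Φ.1
  have hup := (RCLike.re_le_norm _).trans (norm_craneForm_le hm.le hM.le hK.le F Φ.1)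
  have hre := congrArg RCLike.re hsub
  rw [map_sub] at hre
  have hfny : H1.fn Φ.1.y = Φ.1.z + H1.fn F.y := by
    have : F.y = Φ.1.y - domZ Φ := rfl
    rw [this, map_sub, fn_domZ]
    abel
  have hy : ‖Φ.1.y‖ ≤ ‖Φ.1.z‖ + ‖F‖ + ‖H1.dx Φ.1.y‖ := by
    refine (H1.norm_le_add _).trans (add_le_add ?_ le_rfl)
    rw [hfny]
    exact (norm_add_le _ _).trans (add_le_add le_rfl ((H1.norm_fn_le_norm _).trans F.norm_y_le))
  have hnorm : ‖(Φ : State 𝕜)‖ ≤ ‖Φ.1.y‖ + ‖Φ.1.z‖ + ‖Φ.1.u‖ + ‖Φ.1.ξ‖ + ‖Φ.1.η‖ := by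
    have := norm_nonneg Φ.1.y
    have := norm_nonneg Φ.1.z
    have := norm_nonneg Φ.1.u
    have := norm_nonneg Φ.1.ξ
    have := norm_nonneg Φ.1.η
    rw [Prod.norm_def, Prod.norm_def, Prod.norm_def, Prod.norm_def]
    refine max_le (by linarith) (max_le (by linarith) (max_le (by linarith)
      (max_le (by linarith) (by linarith))))
  have x1 := norm_nonneg (H1.dx Φ.1.y)
  have x2 := norm_nonneg Φ.1.z
  have x3 := norm_nonneg Φ.1.u
  have x4 := norm_nonneg Φ.1.ξ
  have x5 := norm_nonneg Φ.1.η
  have xF := norm_nonneg F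
  set t1 := ‖H1.dx Φ.1.y‖
  set t2 := ‖Φ.1.z‖
  set t3 := ‖Φ.1.u‖
  set t4 := ‖Φ.1.ξ‖
  set t5 := ‖Φ.1.η‖
  set s := t1 + t2 + t3 + t4 + t5 with hs
  have hs0 : 0 ≤ s := by positivity
  have hlow' : c / 5 * s ^ 2 ≤ RCLike.re (craneForm P P.α Φ.1 Φ.1) := by
    have hsq : s ^ 2 ≤ 5 * (t1 ^ 2 + t2 ^ 2 + t3 ^ 2 + t4 ^ 2 + t5 ^ 2) := by
      have := sq_sum_le_card_mul_sum_sq (s := Finset.univ) (f := ![t1, t2, t3, t4, t5])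
      simpa [Fin.sum_univ_succ, hs, add_assoc] using this
    have h1 := mul_le_mul_of_nonneg_left hsq hc.le
    have l1 := mul_le_mul_of_nonneg_right c1 (sq_nonneg t1)
    have l2 := mul_le_mul_of_nonneg_right c2 (sq_nonneg t2)
    have l3 := mul_le_mul_of_nonneg_right c3 (sq_nonneg t3)
    have l4 := mul_le_mul_of_nonneg_right c4 (sq_nonneg t4)
    have l5 := mul_le_mul_of_nonneg_right c5 (sq_nonneg t5)
    linarith
  have hup' : RCLike.re (craneForm P P.α F Φ.1) ≤ D * ‖F‖ * s := by
    have l1 := mul_le_mul_of_nonneg_right d1 (mul_nonneg xF x1)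
    have l2 := mul_le_mul_of_nonneg_right d2 (mul_nonneg xF x2)
    have l3 := mul_le_mul_of_nonneg_right d3 (mul_nonneg xF x3)
    have l4 := mul_le_mul_of_nonneg_right d4 (mul_nonneg xF x4)
    have l5 := mul_le_mul_of_nonneg_right d5 (mul_nonneg xF x5)
    rw [hs]
    linarith
  have hbound : s ≤ 5 * D / c * ‖F‖ := by
    rcases hs0.eq_or_lt with h0 | h0
    · rw [← h0]
      positivity
    · have h1 : c / 5 * s * s ≤ D * ‖F‖ * s := by
        rw [mul_assoc, ← sq]
        linarith
      have h2 := le_of_mul_le_mul_right h1 h0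
      rw [div_mul_eq_mul_div, le_div_iff₀ hc]
      linarith
  linarith

theorem exists_isResolventAt_one {P : Params} (hm : 0 < P.m) (hM : 0 < P.M) (hα : 0 < P.α)
    (hτ : 0 < P.τ) (hσ : 0 < P.σ) {a₀ : ℝ} (ha₀ : 0 < a₀)
    (ha : ∀ x : unitInterval, a₀ ≤ H1.rep P.a x) (hαβ : P.α < P.β) :
    ∃ R, IsResolventAt (craneOperator ℂ P) 1 R := by
  obtain ⟨C, hC⟩ := exists_norm_le_sub_craneMap (𝕜 := ℂ) hm hM hα hτ hσ ha₀ ha hαβ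
  refine exists_isResolventAt (C := C) (fun x => ?_) fun v => ?_
  · rw [one_smul]
    exact hC x
  · obtain ⟨x, hx⟩ := exists_smul_sub_craneMap_eq hm hM hα hτ hσ ha₀ ha hαβ one_pos v
    rw [RCLike.ofReal_one] at hx
    exact ⟨x, hx⟩

/-- The resolvent at `1` gains one derivative in each component, by bounded operators. Here
`Z`, `U`, `W` give the velocity, the delay variable and the tension of `R v`, and `b = 1 / a`. -/
theorem exists_regularity_resolvent_one {P : Params} (hm : 0 < P.m) (hτ : 0 < P.τ)
    {b : H1 ℝ} (hb : ∀ x, H1.rep P.a x * H1.rep b x = 1)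
    {R : State ℂ →L[ℂ] State ℂ} (hR : IsResolventAt (craneOperator ℂ P) 1 R) :
    ∃ Z U W : State ℂ →L[ℂ] H1 ℂ, ∀ v,
      R v = (H1.prim (H1.rep (R v).y 0) (mulL b (H1.fn (W v))), H1.fn (Z v), H1.fn (U v),
        H1.rep (Z v) 0, H1.rep (Z v) 1) := by
  let prim : ℂ × L2 ℂ →L[ℂ] H1 ℂ := H1.coords.symm.toContinuousLinearMap
  have hprim : ∀ f : H1 ℂ, prim (H1.rep f 0, H1.dx f) = f := H1.coords.symm_apply_apply
  let Z : State ℂ →L[ℂ] H1 ℂ := State.yL.comp R - State.yL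
  let U : State ℂ →L[ℂ] H1 ℂ := prim.comp
    ((State.ξL.comp R).prod ((P.τ : ℂ) • (State.uL - State.uL.comp R)))
  let W : State ℂ →L[ℂ] H1 ℂ := prim.comp
    (((P.m : ℂ) • (State.ξL.comp R - State.ξL) + (P.β : ℂ) • State.ξL.comp R
      - (P.α : ℂ) • (H1.evalL 1).comp U).prod
      ((1 + (P.σ : ℂ)) • State.zL.comp R - State.zL))
  refine ⟨Z, U, W, fun v => ?_⟩
  obtain ⟨hv, e⟩ := hR.1 v
  set Φ : domain ℂ := ⟨R v, hv⟩ with hΦ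
  have e' : (R v) - craneMap P Φ = v := by
    rw [one_smul] at e
    exact e
  rw [craneMap_apply] at e'
  have e1 : (R v).y - domZ Φ = v.y := congrArg State.y e'
  have e2 : (R v).z - (H1.dx (tension P Φ) - (P.σ : ℂ) • (R v).z) = v.z := congrArg State.z e'
  have e3 : (R v).u - -((P.τ : ℂ)⁻¹ • H1.dx (domU Φ)) = v.u := congrArg State.u e'
  have e4 : (R v).ξ - (P.m : ℂ)⁻¹ * (H1.rep (tension P Φ) 0 - (P.β : ℂ) * (R v).ξ
    + (P.α : ℂ) * H1.rep (domU Φ) 1) = v.ξ := congrArg State.ξ e'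
  have hZ : Z v = domZ Φ := by
    change (R v).y - v.y = _
    rw [← e1, sub_sub_cancel]
  have hτ' : (P.τ : ℂ) ≠ 0 := Complex.ofReal_ne_zero.2 hτ.ne'
  have hm' : (P.m : ℂ) ≠ 0 := Complex.ofReal_ne_zero.2 hm.ne'
  have hU : U v = domU Φ := by
    rw [← hprim (domU Φ), rep_domU_zero]
    refine congrArg prim (Prod.ext rfl ?_)
    change (P.τ : ℂ) • (v.u - (R v).u) = H1.dx (domU Φ)
    rw [← e3, sub_neg_eq_add, add_sub_cancel_left, smul_smul, mul_inv_cancel₀ hτ', one_smul]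
  have hW : W v = tension P Φ := by
    rw [← hprim (tension P Φ)]
    refine congrArg prim (Prod.ext ?_ ?_)
    · change (P.m : ℂ) * ((R v).ξ - v.ξ) + (P.β : ℂ) * (R v).ξ - (P.α : ℂ) * H1.rep (U v) 1
        = H1.rep (tension P Φ) 0
      rw [hU, ← e4]
      field_simp
      ring
    · change (1 + (P.σ : ℂ)) • (R v).z - v.z = H1.dx (tension P Φ)
      rw [← e2]
      module
  rw [hZ, hU, hW, fn_tension, mulL_mulL_cancel fun x => (mul_comm _ _).trans (hb x)]
  exact Prod.ext (H1.coords.symm_apply_apply _).symm (Prod.ext (fn_domZ Φ).symm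
    (Prod.ext (fn_domU Φ).symm (Prod.ext (rep_domZ_zero Φ).symm (rep_domZ_one Φ).symm)))

/-- The resolvent at `1` factors through the compact embeddings of `H¹`. -/
theorem isCompactOperator_resolvent_one {P : Params} (hm : 0 < P.m) (hτ : 0 < P.τ)
    {a₀ : ℝ} (ha₀ : 0 < a₀) (ha : ∀ x : unitInterval, a₀ ≤ H1.rep P.a x)
    {R : State ℂ →L[ℂ] State ℂ} (hR : IsResolventAt (craneOperator ℂ P) 1 R) :
    IsCompactOperator R := by
  obtain ⟨b, hb⟩ := H1.exists_inv ha₀ ha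
  obtain ⟨Z, U, W, key⟩ := exists_regularity_resolvent_one hm hτ hb hR
  have hfn := H1.isCompactOperator_fnL (𝕜 := ℂ)
  let prim : ℂ × L2 ℂ →L[ℂ] H1 ℂ := H1.coords.symm.toContinuousLinearMap
  let e : State ℂ →L[ℂ] ℂ := (H1.evalL 0).comp (State.yL.comp R)
  let V : State ℂ →L[ℂ] L2 ℂ := (mulL b).comp (H1.fnL.comp W)
  have hV : IsCompactOperator V := (hfn.comp_clm W).clm_comp (mulL b)
  have hY : IsCompactOperator (prim.comp (e.prod V)) :=
    (isCompactOperator_prodMk (isCompactOperator_of_locallyCompactSpace_dom e) hV).clm_comp prim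
  have hZ : IsCompactOperator (H1.fnL.comp Z) := hfn.comp_clm Z
  have hU : IsCompactOperator (H1.fnL.comp U) := hfn.comp_clm U
  have h₀ : IsCompactOperator ((H1.evalL 0).comp Z) :=
    isCompactOperator_of_locallyCompactSpace_dom _
  have h₁ : IsCompactOperator ((H1.evalL 1).comp Z) :=
    isCompactOperator_of_locallyCompactSpace_dom _
  have hR' : R = (prim.comp (e.prod V)).prod ((H1.fnL.comp Z).prod ((H1.fnL.comp U).prod
      (((H1.evalL 0).comp Z).prod ((H1.evalL 1).comp Z)))) := ContinuousLinearMap.ext key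
  rw [hR']
  exact isCompactOperator_prodMk hY (isCompactOperator_prodMk hZ (isCompactOperator_prodMk hU
    (isCompactOperator_prodMk h₀ h₁)))

end CompactResolvent

end Crane

end

theorem mainTheorem3 (P : Crane.Params)
    (hm : 0 < P.m) (hM : 0 < P.M) (hα : 0 < P.α) (hτ : 0 < P.τ) (hσ : 0 < P.σ)
    (a₀ : ℝ) (ha₀ : 0 < a₀) (ha : ∀ x : unitInterval, a₀ ≤ Crane.H1.rep P.a x)
    (hαβ : P.α < P.β)
    (K : ℝ) (hK₁ : P.α ≤ K) (hK₂ : K ≤ 2 * P.β - P.α) (ϖ : ℝ) (hϖ : 0 < ϖ) :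
    -- the inner product is one, and its norm is equivalent to the usual norm
    (∃ core : InnerProductSpace.Core ℝ (Crane.State ℝ),
      ∀ Φ Ψ, core.inner Φ Ψ = Crane.energyInner P K ϖ Φ Ψ) ∧
    (∃ c C : ℝ, 0 < c ∧ 0 < C ∧ ∀ Φ : Crane.State ℝ,
      c * √Φ.usualNormSq ≤ Crane.energyNorm P K ϖ Φ ∧
        Crane.energyNorm P K ϖ Φ ≤ C * √Φ.usualNormSq) ∧
    -- the operator is densely defined
    Dense ((Crane.craneOperator ℝ P).domain : Set (Crane.State ℝ)) ∧
    -- it generates a semigroup of contractions, which gives the strong and mild solutions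
    (∃ S : ℝ → Crane.State ℝ →L[ℝ] Crane.State ℝ,
      Crane.IsC0Semigroup S ∧ Crane.IsGenerator (Crane.craneOperator ℝ P) S ∧
      (∀ t, 0 ≤ t → ∀ Φ, Crane.energyNorm P K ϖ (S t Φ) ≤ Crane.energyNorm P K ϖ Φ) ∧
      (∀ Φ₀ ∈ (Crane.craneOperator ℝ P).domain,
        Crane.IsStrongSolution (Crane.craneOperator ℝ P) Φ₀ (fun t => S t Φ₀) ∧
        ∀ Φ : ℝ → Crane.State ℝ, Crane.IsStrongSolution (Crane.craneOperator ℝ P) Φ₀ Φ →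
          ∀ t, 0 ≤ t → Φ t = S t Φ₀) ∧
      (∀ Φ₀ : Crane.State ℝ,
        Crane.IsMildSolution (Crane.craneOperator ℝ P) Φ₀ (fun t => S t Φ₀) ∧
        ∀ Φ : ℝ → Crane.State ℝ, Crane.IsMildSolution (Crane.craneOperator ℝ P) Φ₀ Φ →
          ∀ t, 0 ≤ t → Φ t = S t Φ₀)) ∧
    -- compact resolvent and structure of the spectrum
    (Crane.resolventSet (Crane.craneOperator ℂ P)).Nonempty ∧
    (∀ ζ ∈ Crane.resolventSet (Crane.craneOperator ℂ P),
      IsCompactOperator (Crane.resolvent (Crane.craneOperator ℂ P) ζ)) ∧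
    (∀ lam ∈ Crane.spectrum (Crane.craneOperator ℂ P),
      Crane.IsIsolatedEigenvalueOfFiniteMultiplicity (Crane.craneOperator ℂ P) lam) := by
  have hK : 0 < K := hα.trans_le hK₁
  obtain ⟨core, hcore⟩ := Crane.exists_energyCore hm hM hα hτ hσ ha₀ ha hαβ hK hϖ
  obtain ⟨C, hC, hlow⟩ := Crane.exists_norm_le_energyNorm hm hM hα hτ hσ ha₀ ha hαβ hK hϖ
  obtain ⟨C', hC', hup⟩ := Crane.exists_energyNorm_le hm hM hτ hK hϖ
  have henergy : ∀ Φ, √(core.inner Φ Φ) = Crane.energyNorm P K ϖ Φ := fun Φ => by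
    rw [hcore, Crane.energyNorm]
  -- the rank-one term of the inner product does not contribute, since the functional vanishes on
  -- the range of the operator
  have hdiss : ∀ Φ : (Crane.craneOperator ℝ P).domain,
      core.inner (Crane.craneOperator ℝ P Φ) (Φ : Crane.State ℝ) ≤ 0 := fun Φ => by
    have h1 : Crane.invariantL P (Crane.craneOperator ℝ P Φ) = 0 :=
      Crane.invariantL_craneMap hm hM hτ Φ
    have h2 := Crane.re_craneForm_craneMap_le hm hM hα hτ hσ hK₁ hK₂ Φ
    rw [hcore, Crane.energyInner_eq, h1, mul_zero, zero_mul, add_zero]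
    exact h2
  obtain ⟨hdense, S, hS, hgen, hcontr, hstrong, hmild⟩ :=
    Crane.exists_contraction_semigroup core (k := C⁻¹) (C := C') (inv_pos.2 hC)
      (fun Φ => by
        rw [henergy, inv_mul_le_iff₀ hC]
        exact (hlow Φ).2)
      (fun Φ => by
        rw [henergy]
        exact hup Φ)
      (Crane.craneOperator ℝ P) hdiss
      (fun l hl v => Crane.exists_smul_sub_craneMap_eq hm hM hα hτ hσ ha₀ ha hαβ hl v)
  obtain ⟨R, hR⟩ := Crane.exists_isResolventAt_one hm hM hα hτ hσ ha₀ ha hαβ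
  have hRc := Crane.isCompactOperator_resolvent_one hm hτ ha₀ ha hR
  refine ⟨⟨core, hcore⟩, ⟨(√5 * C)⁻¹, C', by positivity, hC', fun Φ => ⟨?_, ?_⟩⟩, hdense,
    ⟨S, hS, hgen, fun t ht Φ => ?_, hstrong, hmild⟩, ⟨1, R, hR⟩,
    fun ζ hζ => hR.isCompactOperator (Crane.isResolventAt_resolvent hζ) hRc,
    fun lam hlam => Crane.isIsolatedEigenvalue_of_compact_resolvent hR hRc hlam⟩
  · rw [inv_mul_le_iff₀ (by positivity), mul_assoc]
    refine (Real.sqrt_le_sqrt Φ.usualNormSq_le).trans ?_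
    rw [Real.sqrt_mul (by norm_num), Real.sqrt_sq (norm_nonneg _)]
    exact mul_le_mul_of_nonneg_left (hlow Φ).2 (Real.sqrt_nonneg _)
  · exact (hup Φ).trans (mul_le_mul_of_nonneg_left (Real.le_sqrt_of_sq_le Φ.norm_sq_le) hC'.le)
  · rw [← henergy, ← henergy]
    exact hcontr t ht Φ
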